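/- \textbf{Setting.} Write $z=(x,t)\in\mathbb R^{d}\times\mathbb R$, scaling $\mathfrak s=(1,\dots,1,2)$, $|\mathfrak s|=d+2$, $|k|_{\mathfrak s}=k_1+\dots+k_d+2k_{d+1}$ for $k\in\mathbb N^{d+1}$, $\|(x,t)\|_{\mathfrak s}=\max(|x|,|t|^{1/2})$. Let $$L=\partial_t-\sum_{i,j}a_{i,j}\partial_i\partial_j-\sum_i b_i\partial_i-c ,\qquad a_{i,j}=a_{j,i},$$ where (i) $\bar\lambda_0|\xi|^2\le\sum_{i,j}a_{i,j}(z)\xi_i\xi_j\le\bar\lambda_1|\xi|^2$ for all $z,\xi$, with constants $\bar\lambda_0,\bar\lambda_1>0$, and $a_{i,j},b_i,c$ are smooth on $\mathbb R^{d+1}$ and bounded together with all their derivatives; (ii) the coefficients are $\mathbb Z^d$-periodic in $x$. The fundamental solution of $L$ is $\Gamma=\sum_{\nu\ge0}Z_\nu$, where, with $A=(a_{i,j})$ and $w=(\zeta,\tau)$, $$Z_0(x,t;w)=\mathbf 1_{\{t>\tau\}}\frac{\det(A(w))^{-1/2}}{(4\pi(t-\tau))^{d/2}}\exp\Big(-\frac{\langle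 x-\zeta,A(w)^{-1}(x-\zeta)\rangle}{4(t-\tau)}\Big),$$ and, with $E_1(z;w)=-(LZ_0(\cdot;w))(z)$ for $t>\tau$ (zero otherwise), for $\nu\ge1$, $$E_{\nu+1}(x,t;\zeta,\tau)=\int_\tau^t\!\int_{\mathbb R^d}E_1(x,t;\eta,\sigma)E_\nu(\eta,\sigma;\zeta,\tau)\,d\eta\,d\sigma,\qquad Z_\nu(x,t;\zeta,\tau)=\int_\tau^t\!\int_{\mathbb R^d}Z_0(x,t;\eta,\sigma)E_\nu(\eta,\sigma;\zeta,\tau)\,d\eta\,d\sigma .$$ Let $\kappa:\mathbb R\to[0,1]$ vanish on $(-\infty,0)\cup(1,\infty)$, equal $1$ on $(0,1/2)$ and be smooth on $(0,\infty)$. Let $\phi:\mathbb R^d\to[0,1]$ be smooth, compactly supported in the open Euclidean ball $B_{1+1/10}(0)$, with $\sum_{k\in\mathbb Z^d}\phi(x+k)=1$ for all $x$, and vanishing to infinite order at every $k\in\mathbb Z^d\setminus\{0\}$ (for instance, equal to $1$ near $0$). Set $$K(x,t;\zeta,s)=\sum_{k\in\mathbb Z^d}\kappa(t-s)\,\phi(x-\zeta)\,\Gamma(x,t;\zeta+k,s).$$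 \textbf{Norm.} For $\gamma\geq 0$ let $P^\gamma_{z_0}[f](z)=\sum_{|k|_{\mathfrak s}<\gamma}\frac{D^kf(z_0)}{k!}(z-z_0)^k$ and $P^{(L,R)}_{(z_0,w_0)}[F](z,w)=\sum_{|k|_{\mathfrak s}<L,\,|l|_{\mathfrak s}<R}\frac{D_1^kD_2^lF(z_0,w_0)}{k!\,l!}(z-z_0)^k(w-w_0)^l$. Let $\mathbf k_{<R}=\{k:|k|_{\mathfrak s}<R\}$ and $\partial\mathbf k_{<R}=\{k\notin\mathbf k_{<R}: k-e_{\min\{j:k_j\ne0\}}\in\mathbf k_{<R}\}$. For $L,R\ge0$, $\|K\|_{\beta;L,R}\in[0,\infty]$ is the infimum of the $C\ge0$ for which $K=\sum_{n\ge0}K_n$ off the diagonal, with $K_n(z,w)=0$ for $\|z-w\|_{\mathfrak s}>2^{-n+1}$, where the partial derivatives of $K_n$ that occur below exist and are continuous and, for all $n\ge0$, all points $z,w,z_0,w_0$ and all multi-indices as indicated, \begin{align*} &|D_1^kD_2^lK_n(z,w)|\le C2^{(|\mathfrak s|-\beta+|k|_{\mathfrak s}+|l|_{\mathfrak s})n}&&(|k|_{\mathfrak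 s}<L,\ |l|_{\mathfrak s}<R),\\ &|D_1^kK_n(z,w)-P^R_{w_0}[D_1^kK_n(z,\cdot)](w)|\le C2^{(|\mathfrak s|-\beta+|k|_{\mathfrak s}+R)n}\|w-w_0\|_{\mathfrak s}^R&&(|k|_{\mathfrak s}<L),\\ &|D_2^lK_n(z,w)-P^L_{z_0}[D_2^lK_n(\cdot,w)](z)|\le C2^{(|\mathfrak s|-\beta+|l|_{\mathfrak s}+L)n}\|z-z_0\|_{\mathfrak s}^L&&(|l|_{\mathfrak s}<R),\\ &\big|K_n(z,w)-P^L_{z_0}[K_n(\cdot,w)](z)-P^R_{w_0}[K_n(z,\cdot)](w)+P^{(L,R)}_{(z_0,w_0)}[K_n](z,w)\big|\\ &\qquad\le C2^{(|\mathfrak s|-\beta+L+R)n}\|z-z_0\|_{\mathfrak s}^L\|w-w_0\|_{\mathfrak s}^R,\\ &\Big|\int_{\mathbb R^{d+1}}(z-w)^kD_2^lK_n(z,w)\,dz\Big|\le C2^{-\beta n}&&(k\in\mathbf k_{<R},\ l\in\mathbf k_{<R}\cup\partial\mathbf k_{<R}). \end{align*} \textbf{Claim.} (1) $K$ is non-anticipative,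 i.e. $K(x,t;\zeta,s)=0$ whenever $t<s$, and $\|K\|_{\beta;L,R}<\infty$ for all $L,R\ge0$ and $\beta\le2$. (2) Let $(L^\lambda)_{\lambda\in[0,1]}$ be a family of operators whose coefficients satisfy (i) and (ii) for each $\lambda$, are, at each $(x,t)$, continuously differentiable in $\lambda\in[0,1]$, and whose $\lambda$-derivatives are smooth in $(x,t)$ and bounded together with all their $(x,t)$-derivatives, uniformly over $\lambda\in[0,1]$ and $(x,t)$. Let $K^\lambda$ be the corresponding kernels (with the same $\kappa,\phi$). Then for all $L,R\ge0$ and $\beta\le2$ there is a constant $C$ such that $\|K^\lambda-K^\mu\|_{\beta;L,R}\le C|\lambda-\mu|$ for all $\lambda,\mu\in[0,1]$. -/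

import Mathlib

open MeasureTheory
open scoped ContDiff NNReal ENNReal

noncomputable section

/-! ### Space-time, multi-indices and parabolic scaling -/

/-- Space-time `ℝ^{d+1}`; a point is `(x, t)`, with the Euclidean norm on the space variable. -/
abbrev SpaceTime (d : ℕ) : Type := EuclideanSpace ℝ (Fin d) × ℝ

/-- Multi-indices for the coordinates `(x_1, …, x_d, t)`; the last index is the time. -/
abbrev MultiIndex (d : ℕ) : Type := Fin (d + 1) → ℕ

namespace SpaceTime

variable {d : ℕ}

/-- The `j`-th coordinate of `(x, t) = (x_1, …, x_d, t)`. -/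
def coord (z : SpaceTime d) (j : Fin (d + 1)) : ℝ :=
  Fin.lastCases (motive := fun _ => ℝ) z.2 (fun i => z.1 i) j

/-- The `j`-th coordinate unit vector of space-time. -/
def unit (j : Fin (d + 1)) : SpaceTime d :=
  Fin.lastCases (motive := fun _ => SpaceTime d) (0, 1)
    (fun i => (EuclideanSpace.single i 1, 0)) j

/-- The parabolic size `‖(x, t)‖_𝔰 = max (|x|, |t|^{1/2})`. -/
def parNorm (z : SpaceTime d) : ℝ := max ‖z.1‖ (Real.sqrt |z.2|)

/-- The monomial `z^k`. -/
def monomial (z : SpaceTime d) (k : MultiIndex d) : ℝ := ∏ j, coord z j ^ k j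

/-- The partial derivative `∂_j f`. -/
def pderiv (j : Fin (d + 1)) (f : SpaceTime d → ℝ) : SpaceTime d → ℝ :=
  fun z => lineDeriv ℝ f z (unit j)

/-- The iterated partial derivative `D^k f`. -/
def D (k : MultiIndex d) (f : SpaceTime d → ℝ) : SpaceTime d → ℝ :=
  (List.finRange (d + 1)).foldr (fun j g => (pderiv j)^[k j] g) f

/-- The mixed derivative `D_1^k D_2^l F (z, w)` of a function of two space-time variables. -/
def D₁₂ (k l : MultiIndex d) (F : SpaceTime d → SpaceTime d → ℝ) (z w : SpaceTime d) : ℝ :=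
  D k (fun y => D l (F y) w) z

end SpaceTime

namespace MultiIndex

variable {d : ℕ}

/-- The scaling `𝔰 = (1, …, 1, 2)`. -/
def scaling (j : Fin (d + 1)) : ℕ := if j = Fin.last d then 2 else 1

/-- The scaled degree `|k|_𝔰`. -/
def deg (k : MultiIndex d) : ℕ := ∑ j, scaling j * k j

/-- `k! = ∏ k_j!`. -/
def fact (k : MultiIndex d) : ℕ := ∏ j, (k j).factorial

/-- The finite set of multi-indices with `|k|_𝔰 < γ` (see `mem_below`). -/
def below (d : ℕ) (γ : ℝ) : Finset (MultiIndex d) :=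
  (Fintype.piFinset fun _ : Fin (d + 1) => Finset.range ⌈γ⌉₊).filter
    fun k => ((deg k : ℕ) : ℝ) < γ

theorem le_deg (k : MultiIndex d) (j : Fin (d + 1)) : k j ≤ deg k := by
  have h1 : k j ≤ scaling j * k j := by
    unfold scaling
    split_ifs <;> omega
  exact h1.trans (Finset.single_le_sum (f := fun i => scaling i * k i)
    (fun _ _ => Nat.zero_le _) (Finset.mem_univ j))

theorem mem_below {γ : ℝ} {k : MultiIndex d} : k ∈ below d γ ↔ ((deg k : ℕ) : ℝ) < γ := by
  unfold below
  rw [Finset.mem_filter, and_iff_right_iff_imp]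
  intro h
  rw [Fintype.mem_piFinset]
  intro j
  rw [Finset.mem_range, Nat.lt_ceil]
  exact lt_of_le_of_lt (Nat.cast_le.mpr (le_deg k j)) h

/-- The boundary of `{|k|_𝔰 < γ}`: the `k` outside this set for which `k - e_m` belongs to it,
where `m = min {j : k_j ≠ 0}`. -/
def boundary (d : ℕ) (γ : ℝ) : Set (MultiIndex d) :=
  {k | k ∉ below d γ ∧ ∃ m, k m ≠ 0 ∧ (∀ i < m, k i = 0) ∧ k - Pi.single m 1 ∈ below d γ}

end MultiIndex

namespace SpaceTime

variable {d : ℕ}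

/-- The Taylor polynomial `P^γ_{z₀}[f](z)` of all orders `|k|_𝔰 < γ`. -/
def taylor (γ : ℝ) (f : SpaceTime d → ℝ) (z₀ z : SpaceTime d) : ℝ :=
  ∑ k ∈ MultiIndex.below d γ, D k f z₀ / (MultiIndex.fact k : ℝ) * monomial (z - z₀) k

/-- The two-variable Taylor polynomial `P^{(γ,δ)}_{(z₀,w₀)}[F](z, w)`. -/
def taylor₂ (γ δ : ℝ) (F : SpaceTime d → SpaceTime d → ℝ) (z₀ w₀ z w : SpaceTime d) : ℝ :=
  ∑ k ∈ MultiIndex.below d γ, ∑ l ∈ MultiIndex.below d δ,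
    D₁₂ k l F z₀ w₀ / ((MultiIndex.fact k : ℝ) * (MultiIndex.fact l : ℝ)) *
      monomial (z - z₀) k * monomial (w - w₀) l

end SpaceTime

/-! ### The kernel norms -/

namespace SingularKernel

open SpaceTime MultiIndex

variable {d : ℕ}

/-- `K = ∑_{n ≥ 0} K_n` off the diagonal, with `K_n` supported on `‖z - w‖_𝔰 ≤ 2^{-n+1}`. -/
structure IsDecomposition (K : SpaceTime d → SpaceTime d → ℝ)
    (Kn : ℕ → SpaceTime d → SpaceTime d → ℝ) : Prop where
  hasSum : ∀ z w, z ≠ w → HasSum (fun n => Kn n z w) (K z w)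
  support : ∀ (n : ℕ) z w, (2 : ℝ) ^ (1 - (n : ℝ)) < parNorm (z - w) → Kn n z w = 0

/-- The pairs `(k, l)` for which `D_1^k D_2^l K_n` occurs in the bounds below. -/
def relevant (d : ℕ) (L R : ℝ) : Set (MultiIndex d × MultiIndex d) :=
  {p | (p.1 ∈ below d L ∧ (p.2 ∈ below d R ∨ p.2 = 0)) ∨
    (p.1 = 0 ∧ (p.2 ∈ below d R ∨ p.2 ∈ boundary d R))}

/-- All partial derivatives `D_1^k D_2^l F`, `(k, l) ∈ relevant d L R`, exist and are continuous. -/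
structure HasPartials (L R : ℝ) (F : SpaceTime d → SpaceTime d → ℝ) : Prop where
  continuous : ∀ k l, (k, l) ∈ relevant d L R →
    Continuous fun p : SpaceTime d × SpaceTime d => D₁₂ k l F p.1 p.2
  fst : ∀ k l j, (k + Pi.single j 1, l) ∈ relevant d L R →
    ∀ z w, LineDifferentiableAt ℝ (fun y => D₁₂ k l F y w) z (unit j)
  snd : ∀ k l j, (k, l + Pi.single j 1) ∈ relevant d L R →
    ∀ z w, LineDifferentiableAt ℝ (fun y => D₁₂ k l F z y) w (unit j)

/-- The bounds that define `‖K‖_{β;L,R}`, with constant `C`, for one decomposition `(K_n)`.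
Here `|𝔰| = d + 2`. -/
structure Bounds (β L R : ℝ) (C : ℝ≥0) (Kn : ℕ → SpaceTime d → SpaceTime d → ℝ) : Prop where
  partials : ∀ n, HasPartials L R (Kn n)
  size : ∀ (n : ℕ), ∀ k ∈ below d L, ∀ l ∈ below d R, ∀ z w,
    |D₁₂ k l (Kn n) z w| ≤ C * (2 : ℝ) ^ (((d : ℝ) + 2 - β + deg k + deg l) * n)
  taylor_snd : ∀ (n : ℕ), ∀ k ∈ below d L, ∀ z w w₀,
    |D₁₂ k 0 (Kn n) z w - taylor R (fun y => D₁₂ k 0 (Kn n) z y) w₀ w| ≤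
      C * (2 : ℝ) ^ (((d : ℝ) + 2 - β + deg k + R) * n) * parNorm (w - w₀) ^ R
  taylor_fst : ∀ (n : ℕ), ∀ l ∈ below d R, ∀ z w z₀,
    |D₁₂ 0 l (Kn n) z w - taylor L (fun y => D₁₂ 0 l (Kn n) y w) z₀ z| ≤
      C * (2 : ℝ) ^ (((d : ℝ) + 2 - β + deg l + L) * n) * parNorm (z - z₀) ^ L
  taylor_both : ∀ (n : ℕ) z w z₀ w₀,
    |Kn n z w - taylor L (fun y => Kn n y w) z₀ z - taylor R (Kn n z) w₀ w
        + taylor₂ L R (Kn n) z₀ w₀ z w| ≤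
      C * (2 : ℝ) ^ (((d : ℝ) + 2 - β + L + R) * n) *
        parNorm (z - z₀) ^ L * parNorm (w - w₀) ^ R
  moment : ∀ (n : ℕ), ∀ k ∈ below d R, ∀ l : MultiIndex d, l ∈ below d R ∨ l ∈ boundary d R → ∀ w,
    |∫ z, monomial (z - w) k * D₁₂ 0 l (Kn n) z w| ≤ C * (2 : ℝ) ^ (-β * n)

/-- `‖K‖_{β;L,R}`: the infimum of the constants `C` for which some decomposition of `K` satisfies
the bounds; it is `∞` if there is none. -/
def norm (β L R : ℝ) (K : SpaceTime d → SpaceTime d → ℝ) : ℝ≥0∞ :=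
  ⨅ (C : ℝ≥0) (_ : ∃ Kn, IsDecomposition K Kn ∧ Bounds β L R C Kn), (C : ℝ≥0∞)

/-- `K(x, t; ζ, s) = 0` whenever `t < s`. -/
def NonAnticipative (K : SpaceTime d → SpaceTime d → ℝ) : Prop :=
  ∀ z w, z.2 < w.2 → K z w = 0

end SingularKernel

/-! ### The operator, its fundamental solution and the truncated kernel -/

/-- The point of `ℤ^d ⊂ ℝ^d` with the given integer coordinates. -/
def latticePoint {d : ℕ} (k : Fin d → ℤ) : EuclideanSpace ℝ (Fin d) :=
  WithLp.toLp 2 fun i => (k i : ℝ)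

/-- Smooth, and bounded together with all its derivatives. -/
def SmoothBounded {d : ℕ} (f : SpaceTime d → ℝ) : Prop :=
  ContDiff ℝ ∞ f ∧ ∀ m : ℕ, ∃ C : ℝ, ∀ z, ‖iteratedFDeriv ℝ m f z‖ ≤ C

/-- The coefficients of `L = ∂_t - ∑ a_{ij} ∂_i ∂_j - ∑ b_i ∂_i - c`. -/
structure Coefficients (d : ℕ) where
  a : SpaceTime d → Matrix (Fin d) (Fin d) ℝ
  b : SpaceTime d → Fin d → ℝ
  c : SpaceTime d → ℝ

namespace Coefficients

open SpaceTime

variable {d : ℕ} (A : Coefficients d)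

/-- Symmetric, uniformly elliptic, smooth and bounded with all derivatives. -/
structure Regular : Prop where
  symm : ∀ z, (A.a z).IsSymm
  elliptic : ∃ l₀ l₁ : ℝ, 0 < l₀ ∧ 0 < l₁ ∧ ∀ z (ξ : EuclideanSpace ℝ (Fin d)),
    l₀ * ‖ξ‖ ^ 2 ≤ ∑ i, ∑ j, A.a z i j * ξ i * ξ j ∧
      ∑ i, ∑ j, A.a z i j * ξ i * ξ j ≤ l₁ * ‖ξ‖ ^ 2
  a_smooth : ∀ i j, SmoothBounded fun z => A.a z i j
  b_smooth : ∀ i, SmoothBounded fun z => A.b z i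
  c_smooth : SmoothBounded A.c

/-- The coefficients are `ℤ^d`-periodic in space. -/
structure Periodic : Prop where
  a_periodic : ∀ (k : Fin d → ℤ) x t, A.a (x + latticePoint k, t) = A.a (x, t)
  b_periodic : ∀ (k : Fin d → ℤ) x t, A.b (x + latticePoint k, t) = A.b (x, t)
  c_periodic : ∀ (k : Fin d → ℤ) x t, A.c (x + latticePoint k, t) = A.c (x, t)

/-- The operator `L u = ∂_t u - ∑ a_{ij} ∂_i ∂_j u - ∑ b_i ∂_i u - c u`. -/
def op (u : SpaceTime d → ℝ) (z : SpaceTime d) : ℝ :=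
  pderiv (Fin.last d) u z
    - (∑ i : Fin d, ∑ j : Fin d, A.a z i j * pderiv i.castSucc (pderiv j.castSucc u) z)
    - (∑ i : Fin d, A.b z i * pderiv i.castSucc u z) - A.c z * u z

/-- `ϑ^z(ξ) = ∑ a^{ij}(z) ξ_i ξ_j`, with `(a^{ij})` the inverse matrix. -/
def theta (z : SpaceTime d) (ξ : EuclideanSpace ℝ (Fin d)) : ℝ :=
  ∑ i, ∑ j, (A.a z)⁻¹ i j * ξ i * ξ j

/-- The parametrix `Z(z; w)`, `w = (ζ, τ)`: the fundamental solution, with pole at `w`, of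
`∂_t - ∑ a_{ij}(w) ∂_i ∂_j`; it vanishes for `t ≤ τ`. -/
def parametrix (z w : SpaceTime d) : ℝ :=
  if w.2 < z.2 then
    (4 * Real.pi) ^ (-(d : ℝ) / 2) * (A.a w).det ^ (-(1 : ℝ) / 2) *
      (z.2 - w.2) ^ (-(d : ℝ) / 2) * Real.exp (-(A.theta w (z.1 - w.1)) / (4 * (z.2 - w.2)))
  else 0

/-- The error of the parametrix, `-(L Z(·; w))(z)` for `t > τ`, that is
`∑ (a_{ij}(z) - a_{ij}(w)) ∂_i ∂_j Z + ∑ b_i(z) ∂_i Z + c(z) Z`. -/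
def error (z w : SpaceTime d) : ℝ :=
  if w.2 < z.2 then -A.op (fun y => A.parametrix y w) z else 0

/-- The iterated errors; `errorIter ν` is the `(ν + 1)`-fold space-time convolution of `error`. -/
def errorIter : ℕ → SpaceTime d → SpaceTime d → ℝ
  | 0 => A.error
  | ν + 1 => fun z w => ∫ σ in w.2..z.2, ∫ η, A.error z (η, σ) * errorIter ν (η, σ) w

/-- The terms `Z_ν` of the parametrix series. -/
def parametrixTerm : ℕ → SpaceTime d → SpaceTime d → ℝ
  | 0 => A.parametrix
  | ν + 1 => fun z w => ∫ σ in w.2..z.2, ∫ η, A.parametrix z (η, σ) * A.errorIter ν (η, σ) w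

/-- The fundamental solution `Γ = ∑_ν Z_ν` of `L`, extended by `0` to `t ≤ τ`. -/
def heatKernel (z w : SpaceTime d) : ℝ := ∑' ν, A.parametrixTerm ν z w

/-- `K(x, t; ζ, s) = ∑_{k ∈ ℤ^d} κ(t - s) φ(x - ζ) Γ(x, t; ζ + k, s)`. -/
def truncatedKernel (κ : ℝ → ℝ) (φ : EuclideanSpace ℝ (Fin d) → ℝ) (z w : SpaceTime d) : ℝ :=
  ∑' k : Fin d → ℤ,
    κ (z.2 - w.2) * φ (z.1 - w.1) * A.heatKernel z (w.1 + latticePoint k, w.2)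

end Coefficients

/-- A scalar family `(f_l)`, `l ∈ [0, 1]`, which is pointwise continuously differentiable in `l`
and whose `l`-derivative is smooth in `z` and bounded together with all its `z`-derivatives, each
bound being uniform in `(l, z)`. -/
structure IsC1Family {d : ℕ} (f : ℝ → SpaceTime d → ℝ) : Prop where
  contDiffOn : ∀ z, ContDiffOn ℝ 1 (fun l => f l z) (Set.Icc 0 1)
  smooth : ∀ l ∈ Set.Icc (0 : ℝ) 1,
    ContDiff ℝ ∞ fun z => derivWithin (fun r => f r z) (Set.Icc 0 1) l
  bounded : ∀ m : ℕ, ∃ C : ℝ, ∀ l ∈ Set.Icc (0 : ℝ) 1, ∀ z,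
    ‖iteratedFDeriv ℝ m (fun y => derivWithin (fun r => f r y) (Set.Icc 0 1) l) z‖ ≤ C

/-- All coefficients form `C¹` families. -/
structure Coefficients.IsC1 {d : ℕ} (A : ℝ → Coefficients d) : Prop where
  a_family : ∀ i j, IsC1Family fun l z => (A l).a z i j
  b_family : ∀ i, IsC1Family fun l z => (A l).b z i
  c_family : IsC1Family fun l => (A l).c

/-- The truncation in time. -/
structure IsTimeCutoff (κ : ℝ → ℝ) : Prop where
  mem_Icc : ∀ t, κ t ∈ Set.Icc (0 : ℝ) 1
  eq_zero : ∀ t, t < 0 ∨ 1 < t → κ t = 0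
  eq_one : ∀ t ∈ Set.Ioo (0 : ℝ) (1 / 2), κ t = 1
  smooth : ContDiffOn ℝ ∞ κ (Set.Ioi 0)

/-- The cutoff in space: a smooth partition of unity on the torus, which vanishes to infinite order
at the lattice points other than `0`, the places where `Γ(x, t; ζ + k, s)`, `k ≠ 0`, is singular. -/
structure IsSpaceCutoff {d : ℕ} (φ : EuclideanSpace ℝ (Fin d) → ℝ) : Prop where
  mem_Icc : ∀ x, φ x ∈ Set.Icc (0 : ℝ) 1
  smooth : ContDiff ℝ ∞ φ
  support : tsupport φ ⊆ Metric.ball 0 (1 + 1 / 10)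
  hasSum : ∀ x, HasSum (fun k : Fin d → ℤ => φ (x + latticePoint k)) 1
  flat : ∀ k : Fin d → ℤ, k ≠ 0 → ∀ m : ℕ, iteratedFDeriv ℝ m φ (latticePoint k) = 0

end

/-!
The parametrix construction is carried out in parabolic coordinates. For `t - τ = s²` and
`x - ζ = s ξ`, the parametrix, its error, the iterated errors and the terms of the series are powers
of `s` times profiles `e(ξ, s; w)` that are smooth up to `s = 0` (`IsScaled`,
`isScaled_parametrixTerm`). One space-time convolution becomes an integral of profiles over an
angle `θ` (with `σ - τ = s² sin² θ`) and over a space variable; the substitution is chosen such that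
the space variables are rotated by `θ`, hence the Gaussian weight `exp (-a (|ξ|² + s²))` is
reproduced exactly, without loss in `a`. So the bounds on the iterated profiles and on
their derivatives are products of the constants `∫ sin^ν`, which tend to zero, and the series of
profiles converges with all derivatives (`exists_compose_const`, `exists_heatKernel_profile`).
Everything is uniform over families of coefficients which may depend smoothly on one more real
parameter.

Multiplied by a cutoff that vanishes near the pole, such a kernel is smooth also as a function of
the Cartesian displacement: its derivatives are flat at `s = 0` (`contDiff_of_flat`,
`exists_unscale_const`). This serves in two ways. The term with pole at the base point is cut into
dyadic annuli; a rescaled piece is again of this form, with bounds that do not depend on the scale.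
The terms with pole at a nonzero lattice translate are smooth since the cutoff in space is flat at
these points, and their sum belongs to the scale one (`exists_kernel_pieces`). For kernels
`2^{nd} F_n(δ_n (z - w), w)` with `F_n` bounded with its derivatives and of bounded support, all
bounds of the norm follow for `β = 2`, hence for `β ≤ 2`: the size by the chain rule, the remainders
by an anisotropic Taylor formula, and the moments by integration by parts, which gives back the
derivatives in the second variable that hit the displacement (`exists_bounds_const`).

For the Lipschitz dependence two sets of coefficients at a small distance are joined by a segment
parametrized at a fixed speed; the coefficients are smooth in the parameter of the segment, uniformly
in its end points, so the profiles have a bounded derivative along it, and the difference of the two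
kernels has profiles of the size of the distance (`IsC1.exists_norm_sub_le`). For distant parameters
the uniform bound of each kernel suffices.
-/

noncomputable section

/-! ### Bounds on finitely many derivatives -/

section Jets

variable {V V' F F' G : Type*} [NormedAddCommGroup V] [NormedSpace ℝ V]
  [NormedAddCommGroup V'] [NormedSpace ℝ V'] [NormedAddCommGroup F] [NormedSpace ℝ F]
  [NormedAddCommGroup F'] [NormedSpace ℝ F'] [NormedAddCommGroup G] [NormedSpace ℝ G]

/-- The derivatives of `f` at `x` of all orders `j ≤ N` are at most `M * κ ^ j`. The factor `κ` is
the price of one derivative. -/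
def JetBound (N : ℕ) (κ M : ℝ) (f : V → F) (x : V) : Prop :=
  ∀ j ≤ N, ‖iteratedFDeriv ℝ j f x‖ ≤ M * κ ^ j

namespace JetBound

variable {N : ℕ} {κ κ' M M' : ℝ} {f g : V → F} {x : V}

theorem norm_le (h : JetBound N κ M f x) : ‖f x‖ ≤ M := by
  simpa using h 0 (Nat.zero_le _)

theorem nonneg (h : JetBound N κ M f x) : 0 ≤ M := (norm_nonneg _).trans h.norm_le

theorem mono (h : JetBound N κ M f x) (hκ : 0 ≤ κ) (hκ' : κ ≤ κ') (hM : M ≤ M') :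
    JetBound N κ' M' f x := fun j hj =>
  (h j hj).trans (mul_le_mul hM (pow_le_pow_left₀ hκ hκ' j) (pow_nonneg hκ j) (h.nonneg.trans hM))

theorem of_le {N' : ℕ} (h : JetBound N κ M f x) (hN : N' ≤ N) : JetBound N' κ M f x :=
  fun j hj => h j (hj.trans hN)

theorem congr (h : JetBound N κ M f x) (hfg : g =ᶠ[nhds x] f) : JetBound N κ M g x := fun j hj => by
  rw [(hfg.iteratedFDeriv ℝ j).eq_of_nhds]
  exact h j hj

/-- Absorbing a factor of the price of one derivative into the constant. -/
theorem absorb {c : ℝ} (hc : 1 ≤ c) (hκ : 0 ≤ κ) (h : JetBound N (c * κ) M f x) :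
    JetBound N κ (c ^ N * M) f x := fun j hj => by
  refine (h j hj).trans ?_
  rw [mul_pow, mul_comm (c ^ N), mul_assoc]
  have := pow_le_pow_right₀ hc hj
  have := h.nonneg
  gcongr

theorem add (hf : ContDiff ℝ N f) (hg : ContDiff ℝ N g) (h : JetBound N κ M f x)
    (h' : JetBound N κ M' g x) : JetBound N κ (M + M') (fun y => f y + g y) x := fun j hj => by
  have hj' : (j : WithTop ℕ∞) ≤ N := by exact_mod_cast hj
  rw [show (fun y => f y + g y) = f + g from rfl,
    iteratedFDeriv_add_apply (hf.of_le hj').contDiffAt (hg.of_le hj').contDiffAt]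
  refine (norm_add_le _ _).trans ?_
  rw [add_mul]
  exact add_le_add (h j hj) (h' j hj)

theorem sum {α : Type*} (s : Finset α) {f : α → V → F} {M : α → ℝ}
    (hf : ∀ a ∈ s, ContDiff ℝ N (f a)) (h : ∀ a ∈ s, JetBound N κ (M a) (f a) x) :
    JetBound N κ (∑ a ∈ s, M a) (fun y => ∑ a ∈ s, f a y) x := fun j hj => by
  have hj' : (j : WithTop ℕ∞) ≤ N := by exact_mod_cast hj
  rw [iteratedFDeriv_fun_sum_apply fun a ha => ((hf a ha).of_le hj').contDiffAt, Finset.sum_mul]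
  exact (norm_sum_le _ _).trans (Finset.sum_le_sum fun a ha => h a ha j hj)

/-- The Leibniz rule. -/
theorem bilin (B : F →L[ℝ] F' →L[ℝ] G) (hB : ‖B‖ ≤ 1) (hκ : 0 ≤ κ) {g : V → F'}
    (hf : ContDiff ℝ N f) (hg : ContDiff ℝ N g) (h : JetBound N κ M f x)
    (h' : JetBound N κ M' g x) :
    JetBound N κ (2 ^ N * (M * M')) (fun y => B (f y) (g y)) x := fun j hj => by
  refine (B.norm_iteratedFDeriv_le_of_bilinear_of_le_one hf hg x (n := j)
    (by exact_mod_cast hj) hB).trans ?_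
  have h0 := h.nonneg
  have h0' := h'.nonneg
  calc _ ≤ ∑ i ∈ Finset.range (j + 1), (j.choose i : ℝ) * (M * M' * κ ^ j) := by
        refine Finset.sum_le_sum fun i hi => ?_
        have hi' : i ≤ j := Nat.lt_succ_iff.mp (Finset.mem_range.mp hi)
        have h1 := h i (hi'.trans hj)
        have h2 := h' (j - i) ((Nat.sub_le _ _).trans hj)
        rw [mul_assoc]
        refine mul_le_mul_of_nonneg_left ((mul_le_mul h1 h2 (norm_nonneg _)
          (by positivity)).trans (le_of_eq ?_)) (by positivity)
        conv_rhs => rw [← Nat.add_sub_cancel' hi', pow_add]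
        ring
    _ = 2 ^ j * (M * M' * κ ^ j) := by
        rw [← Finset.sum_mul]
        congr 1
        exact_mod_cast Nat.sum_range_choose j
    _ ≤ _ := by
        have : (2 : ℝ) ^ j ≤ 2 ^ N := pow_le_pow_right₀ one_le_two hj
        rw [mul_assoc (2 ^ N)]
        gcongr

theorem mul {f g : V → ℝ} (hκ : 0 ≤ κ) (hf : ContDiff ℝ N f) (hg : ContDiff ℝ N g)
    (h : JetBound N κ M f x) (h' : JetBound N κ M' g x) :
    JetBound N κ (2 ^ N * (M * M')) (fun y => f y * g y) x :=
  h.bilin (ContinuousLinearMap.mul ℝ ℝ) (ContinuousLinearMap.opNorm_mul_le _ _) hκ hf hg h'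

theorem smul {f : V → ℝ} {g : V → F} (hκ : 0 ≤ κ) (hf : ContDiff ℝ N f) (hg : ContDiff ℝ N g)
    (h : JetBound N κ M f x) (h' : JetBound N κ M' g x) :
    JetBound N κ (2 ^ N * (M * M')) (fun y => f y • g y) x :=
  h.bilin (ContinuousLinearMap.lsmul ℝ ℝ) ContinuousLinearMap.opNorm_lsmul_le hκ hf hg h'

theorem clm_comp (L : F →L[ℝ] F') (hf : ContDiff ℝ N f) (h : JetBound N κ M f x) :
    JetBound N κ (‖L‖ * M) (fun y => L (f y)) x := fun j hj => by
  rw [mul_assoc]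
  exact (L.norm_iteratedFDeriv_comp_left hf.contDiffAt (by exact_mod_cast hj)).trans
    (mul_le_mul_of_nonneg_left (h j hj) (norm_nonneg _))

theorem const_mul {f : V → ℝ} (c : ℝ) (hf : ContDiff ℝ N f) (h : JetBound N κ M f x) :
    JetBound N κ (|c| * M) (fun y => c * f y) x := fun j hj => by
  have := (h.clm_comp (c • ContinuousLinearMap.id ℝ ℝ) hf) j hj
  simp only [_root_.smul_apply, ContinuousLinearMap.id_apply, smul_eq_mul] at this
  refine this.trans ?_
  have h1 : ‖c • ContinuousLinearMap.id ℝ ℝ‖ = |c| := by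
    rw [norm_smul]; simp
  rw [h1]

/-- Faà di Bruno's formula, as a bound. -/
theorem comp {g : F → G} {D : ℝ} (hg : ContDiff ℝ N g) (hf : ContDiff ℝ N f)
    (h : JetBound N 1 M g (f x)) (hD : ∀ i, 1 ≤ i → i ≤ N → ‖iteratedFDeriv ℝ i f x‖ ≤ D ^ i)
    (hD0 : 0 ≤ D) :
    JetBound N D (N.factorial * M) (fun y => g (f y)) x := fun j hj => by
  have h1 := norm_iteratedFDeriv_comp_le hg hf (n := j) (by exact_mod_cast hj) x (C := M) (D := D)
    (fun i hi => by simpa using h i (hi.trans hj)) (fun i hi hij => hD i hi (hij.trans hj))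
  refine h1.trans ?_
  have : (j.factorial : ℝ) ≤ N.factorial := by exact_mod_cast Nat.factorial_le hj
  have := h.nonneg
  gcongr

/-- Composition with an affine map. -/
theorem comp_affine {g : F → G} (L : V →L[ℝ] F) (b : F) (hg : ContDiff ℝ N g)
    (h : JetBound N κ M g (L x + b)) :
    JetBound N (‖L‖ * κ) M (fun y => g (L y + b)) x := fun j hj => by
  have h1 : (fun y => g (L y + b)) = (fun z => g (z + b)) ∘ L := rfl
  have h2 : ContDiff ℝ N fun z => g (z + b) := hg.comp (contDiff_id.add contDiff_const)
  rw [h1, L.iteratedFDeriv_comp_right h2 x (by exact_mod_cast hj), iteratedFDeriv_comp_add_right]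
  refine (ContinuousMultilinearMap.norm_compContinuousLinearMap_le _ _).trans ?_
  rw [Finset.prod_const, Finset.card_univ, Fintype.card_fin, mul_pow, mul_comm (‖L‖ ^ j),
    ← mul_assoc]
  exact mul_le_mul_of_nonneg_right (h j hj) (by positivity)

theorem comp_affine_of_le_one {g : F → G} (L : V →L[ℝ] F) (b : F) (hL : ‖L‖ ≤ 1)
    (hg : ContDiff ℝ N g) (hκ : 0 ≤ κ) (h : JetBound N κ M g (L x + b)) :
    JetBound N κ M (fun y => g (L y + b)) x :=
  (h.comp_affine L b hg).mono (by positivity) (mul_le_of_le_one_left hκ hL) le_rfl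

theorem comp_clm_of_le_one {g : F → G} (L : V →L[ℝ] F) (hL : ‖L‖ ≤ 1)
    (hg : ContDiff ℝ N g) (hκ : 0 ≤ κ) (h : JetBound N κ M g (L x)) :
    JetBound N κ M (fun y => g (L y)) x := by
  simpa using comp_affine_of_le_one (x := x) L 0 hL hg hκ (by simpa using h)

theorem comp_fst {g : V → G} {y : V × F} (hg : ContDiff ℝ N g) (hκ : 0 ≤ κ)
    (h : JetBound N κ M g y.1) : JetBound N κ M (fun y : V × F => g y.1) y :=
  comp_clm_of_le_one (x := y) (ContinuousLinearMap.fst ℝ V F) (ContinuousLinearMap.norm_fst_le ℝ V F)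
    hg hκ h

theorem comp_snd {g : F → G} {y : V × F} (hg : ContDiff ℝ N g) (hκ : 0 ≤ κ)
    (h : JetBound N κ M g y.2) : JetBound N κ M (fun y : V × F => g y.2) y :=
  comp_clm_of_le_one (x := y) (ContinuousLinearMap.snd ℝ V F) (ContinuousLinearMap.norm_snd_le ℝ V F)
    hg hκ h

theorem clm (L : V →L[ℝ] F) (hκ : 0 ≤ κ) (h0 : ‖L x‖ ≤ M) (h1 : ‖L‖ ≤ M * κ) :
    JetBound N κ M (fun y => L y) x := fun j hj => by
  have hM : 0 ≤ M := (norm_nonneg _).trans h0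
  match j with
  | 0 => simpa using h0
  | 1 => simpa using h1
  | j + 2 =>
    rw [← norm_iteratedFDeriv_fderiv]
    have : fderiv ℝ (fun y => L y) = fun _ => L := by ext1 y; exact L.fderiv
    rw [this, iteratedFDeriv_const_of_ne (Nat.succ_ne_zero j)]
    simp only [Pi.zero_apply, norm_zero]
    positivity

theorem const (c : F) (hκ : 0 ≤ κ) (h : ‖c‖ ≤ M) : JetBound N κ M (fun _ : V => c) x :=
  fun j _ => by
  have hM : 0 ≤ M := (norm_nonneg _).trans h
  match j with
  | 0 => simpa using h
  | j + 1 =>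
    rw [iteratedFDeriv_const_of_ne (Nat.succ_ne_zero j)]
    simp only [Pi.zero_apply, norm_zero]
    positivity

theorem prodMk {g : V → F'} (hf : ContDiff ℝ N f) (hg : ContDiff ℝ N g)
    (h : JetBound N κ M f x) (h' : JetBound N κ M' g x) :
    JetBound N κ (M + M') (fun y => (f y, g y)) x := by
  have e : (fun y => (f y, g y)) = fun y => ContinuousLinearMap.inl ℝ F F' (f y)
      + ContinuousLinearMap.inr ℝ F F' (g y) := by
    ext1 y; simp
  rw [e]
  intro j hj
  refine ((h.clm_comp (ContinuousLinearMap.inl ℝ F F') hf).add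
    ((ContinuousLinearMap.inl ℝ F F').contDiff.comp hf)
    ((ContinuousLinearMap.inr ℝ F F').contDiff.comp hg)
    (h'.clm_comp (ContinuousLinearMap.inr ℝ F F') hg) j hj).trans ?_
  have h1 := ContinuousLinearMap.norm_inl_le_one ℝ F F'
  have h2 := ContinuousLinearMap.norm_inr_le_one ℝ F F'
  have h3 := (norm_nonneg _).trans (h j hj)
  have h4 := (norm_nonneg _).trans (h' j hj)
  rw [add_mul, add_mul, mul_assoc, mul_assoc]
  exact add_le_add (mul_le_of_le_one_left h3 h1) (mul_le_of_le_one_left h4 h2)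

theorem fderiv (h : JetBound (N + 1) κ M f x) : JetBound N κ (M * κ) (fderiv ℝ f) x :=
  fun j hj => by
  rw [norm_iteratedFDeriv_fderiv, mul_assoc, ← pow_succ']
  exact h (j + 1) (Nat.succ_le_succ hj)

theorem of_fderiv (h0 : ‖f x‖ ≤ M) (h : JetBound N κ (M * κ) (_root_.fderiv ℝ f) x) :
    JetBound (N + 1) κ M f x := fun j hj => by
  match j with
  | 0 => simpa using h0
  | j + 1 =>
    rw [← norm_iteratedFDeriv_fderiv, pow_succ', ← mul_assoc]
    exact h j (Nat.succ_le_succ_iff.mp hj)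

end JetBound

end Jets

/-! ### Integrals and series depending on a parameter -/

section Parametric

variable {Q : Type*} [MeasurableSpace Q] {μ : Measure Q}

theorem aestronglyMeasurable_fderiv_of_forall {V F : Type*} [NormedAddCommGroup V]
    [NormedSpace ℝ V] [FiniteDimensional ℝ V] [NormedAddCommGroup F] [NormedSpace ℝ F]
    {f : V → Q → F} (hm : ∀ x, AEStronglyMeasurable (f x) μ) (x : V)
    (hd : ∀ q, DifferentiableAt ℝ (fun y => f y q) x) :
    AEStronglyMeasurable (fun q => fderiv ℝ (fun y => f y q) x) μ := by
  have key : ∀ v, AEStronglyMeasurable (fun q => fderiv ℝ (fun y => f y q) x v) μ := by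
    intro v
    refine aestronglyMeasurable_of_tendsto_ae (u := Filter.atTop)
      (f := fun (n : ℕ) q => (n : ℝ) • (f (x + (n : ℝ)⁻¹ • v) q - f x q)) (fun n => ?_) ?_
    · exact ((hm _).sub (hm _)).const_smul (n : ℝ)
    · refine Filter.Eventually.of_forall fun q => ?_
      have h := (hd q).hasFDerivAt.lim v (c := fun n : ℕ => (n : ℝ)) (l := Filter.atTop)
        (by simpa using tendsto_natCast_atTop_atTop (R := ℝ))
      exact h
  let b := Module.finBasis ℝ V
  have e : (fun q => fderiv ℝ (fun y => f y q) x) = fun q =>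
      ∑ i, (LinearMap.toContinuousLinearMap (b.coord i)).smulRight
        (fderiv ℝ (fun y => f y q) x (b i)) := by
    ext q v
    simp only [_root_.sum_apply, ContinuousLinearMap.smulRight_apply,
      LinearMap.coe_toContinuousLinearMap', Module.Basis.coord_apply, ← map_smul]
    rw [← map_sum, b.sum_repr]
  rw [e]
  refine Finset.aestronglyMeasurable_fun_sum _ fun i _ => ?_
  exact (ContinuousLinearMap.smulRightL ℝ V F
    (LinearMap.toContinuousLinearMap (b.coord i))).continuous.comp_aestronglyMeasurable (key _)

/-- An integral of `C^N` functions whose derivatives are dominated is `C^N`, and its derivatives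
are bounded by the integrals of any bounds on the derivatives of the integrand. -/
theorem contDiff_integral_of_dominated {V F : Type} [NormedAddCommGroup V]
    [NormedSpace ℝ V] [FiniteDimensional ℝ V] [NormedAddCommGroup F] [NormedSpace ℝ F]
    {N : ℕ} {f : V → Q → F} {bound : Q → ℝ}
    (hf : ∀ q, ContDiff ℝ N fun x => f x q) (hm : ∀ x, AEStronglyMeasurable (f x) μ)
    (hb : Integrable bound μ)
    (hbound : ∀ j ≤ N, ∀ x q, ‖iteratedFDeriv ℝ j (fun y => f y q) x‖ ≤ bound q) :
    ContDiff ℝ N (fun x => ∫ q, f x q ∂μ) ∧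
      ∀ j ≤ N, ∀ x, ∀ B : Q → ℝ, Integrable B μ →
        (∀ q, ‖iteratedFDeriv ℝ j (fun y => f y q) x‖ ≤ B q) →
        ‖iteratedFDeriv ℝ j (fun y => ∫ q, f y q ∂μ) x‖ ≤ ∫ q, B q ∂μ := by
  have base : ∀ (x : V) (B : Q → ℝ), Integrable B μ →
      (∀ q, ‖iteratedFDeriv ℝ 0 (fun y => f y q) x‖ ≤ B q) →
        ‖iteratedFDeriv ℝ 0 (fun y => ∫ q, f y q ∂μ) x‖ ≤ ∫ q, B q ∂μ := by
    intro x B hB hfB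
    simp only [norm_iteratedFDeriv_zero] at hfB ⊢
    exact norm_integral_le_of_norm_le hB (Filter.Eventually.of_forall hfB)
  induction N generalizing F with
  | zero =>
    refine ⟨?_, ?_⟩
    · simp only [Nat.cast_zero, contDiff_zero] at hf ⊢
      refine continuous_of_dominated hm (fun x => Filter.Eventually.of_forall fun q => ?_) hb
        (Filter.Eventually.of_forall fun q => hf q)
      simpa using hbound 0 le_rfl x q
    · intro j hj
      obtain rfl : j = 0 := by omega
      exact base
  | succ N ih =>
    have hdiff : ∀ q x, DifferentiableAt ℝ (fun y => f y q) x := fun q x =>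
      ((hf q).differentiable (by norm_cast)).differentiableAt
    have hfd : ∀ x, HasFDerivAt (fun y => ∫ q, f y q ∂μ)
        (∫ q, fderiv ℝ (fun y => f y q) x ∂μ) x := fun x => by
      refine hasFDerivAt_integral_of_dominated_of_fderiv_le (s := Set.univ)
        (F' := fun x q => fderiv ℝ (fun y => f y q) x) Filter.univ_mem
        (Filter.Eventually.of_forall hm) ?_ ?_ ?_ hb ?_
      · exact hb.mono' (hm x) (Filter.Eventually.of_forall fun q => by
          simpa using hbound 0 (Nat.zero_le _) x q)
      · exact aestronglyMeasurable_fderiv_of_forall hm x fun q => hdiff q x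
      · refine Filter.Eventually.of_forall fun q y _ => ?_
        simpa using hbound 1 (by omega) y q
      · exact Filter.Eventually.of_forall fun q y _ => (hdiff q y).hasFDerivAt
    have hfd' : fderiv ℝ (fun y => ∫ q, f y q ∂μ) =
        fun x => ∫ q, fderiv ℝ (fun y => f y q) x ∂μ := funext fun x => (hfd x).fderiv
    obtain ⟨h1, h2⟩ := ih (F := V →L[ℝ] F) (f := fun x q => fderiv ℝ (fun y => f y q) x)
      (fun q => (hf q).fderiv_right (by norm_cast))
      (fun x => aestronglyMeasurable_fderiv_of_forall hm x fun q => hdiff q x)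
      (fun j hj x q => by
        have := hbound (j + 1) (by omega) x q
        rwa [← norm_iteratedFDeriv_fderiv] at this)
      (fun x B hB hfB => by
        simp only [norm_iteratedFDeriv_zero] at hfB ⊢
        exact norm_integral_le_of_norm_le hB (Filter.Eventually.of_forall hfB))
    refine ⟨?_, ?_⟩
    · have : ((N + 1 : ℕ) : WithTop ℕ∞) = (N : WithTop ℕ∞) + 1 := by norm_cast
      rw [this, contDiff_succ_iff_fderiv]
      refine ⟨fun x => (hfd x).differentiableAt, by simp, ?_⟩
      rw [hfd']
      exact h1
    · intro j hj
      match j with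
      | 0 => exact base
      | j + 1 =>
        intro x B hB hfB
        rw [← norm_iteratedFDeriv_fderiv, hfd']
        refine h2 j (by omega) x B hB fun q => ?_
        have := hfB q
        rwa [← norm_iteratedFDeriv_fderiv] at this

theorem contDiff_tsum_of_jetBound {α V F : Type*} [NormedAddCommGroup V] [NormedSpace ℝ V]
    [NormedAddCommGroup F] [NormedSpace ℝ F] [CompleteSpace F] {N : ℕ} {f : α → V → F}
    {v : α → ℝ} (hf : ∀ a, ContDiff ℝ N (f a)) (hv : Summable v)
    (hb : ∀ a x, JetBound N 1 (v a) (f a) x) :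
    ContDiff ℝ N (fun x => ∑' a, f a x) ∧
      ∀ (x : V) (κ : ℝ) (c : α → ℝ), Summable c → (∀ a, JetBound N κ (c a) (f a) x) →
        JetBound N κ (∑' a, c a) (fun x => ∑' a, f a x) x := by
  have hb' : ∀ (k : ℕ) (a : α) (x : V), (k : ℕ∞) ≤ (N : ℕ∞) →
      ‖iteratedFDeriv ℝ k (f a) x‖ ≤ v a := fun k a x hk => by
    simpa using hb a x k (by exact_mod_cast hk)
  have hf' : ∀ a, ContDiff ℝ ((N : ℕ∞) : WithTop ℕ∞) (f a) := fun a => by exact_mod_cast hf a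
  refine ⟨?_, ?_⟩
  · have := contDiff_tsum (v := fun _ => v) hf' (fun _ _ => hv) hb'
    exact_mod_cast this
  · intro x κ c hc h j hj
    rw [iteratedFDeriv_tsum_apply (v := fun _ => v) hf' (fun _ _ => hv) hb'
      (by exact_mod_cast hj) x, ← tsum_mul_right]
    exact tsum_of_norm_bounded (hc.mul_right _).hasSum fun a => h a j hj

end Parametric

/-! ### Iterated directional derivatives -/

section IterLine

variable {V V' : Type*} [NormedAddCommGroup V] [NormedSpace ℝ V]
  [NormedAddCommGroup V'] [NormedSpace ℝ V']

/-- The iterated directional derivative along the vectors of a list; the last vector acts first. -/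
def iterLine (vs : List V) (f : V → ℝ) : V → ℝ :=
  vs.foldr (fun v g x => lineDeriv ℝ g x v) f

@[simp] theorem iterLine_nil (f : V → ℝ) : iterLine [] f = f := rfl

theorem iterLine_cons (v : V) (vs : List V) (f : V → ℝ) :
    iterLine (v :: vs) f = fun x => lineDeriv ℝ (iterLine vs f) x v := rfl

theorem iterLine_append (vs ws : List V) (f : V → ℝ) :
    iterLine (vs ++ ws) f = iterLine vs (iterLine ws f) := by
  simp [iterLine, List.foldr_append]

theorem iterLine_eq_iteratedFDeriv {N : ℕ} {f : V → ℝ} (hf : ContDiff ℝ N f) (vs : List V)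
    (h : vs.length ≤ N) : iterLine vs f = fun x => iteratedFDeriv ℝ vs.length f x vs.get := by
  induction vs with
  | nil => ext x; simp
  | cons v vs ih =>
    have hl : vs.length < N := h
    ext x
    rw [iterLine_cons, ih hl.le]
    have hd : DifferentiableAt ℝ (iteratedFDeriv ℝ vs.length f) x :=
      hf.differentiable_iteratedFDeriv (by exact_mod_cast hl) x
    have hd' : DifferentiableAt ℝ (fun y => iteratedFDeriv ℝ vs.length f y vs.get) x :=
      hd.continuousMultilinear_apply_const _
    have e1 : lineDeriv ℝ (fun y => iteratedFDeriv ℝ vs.length f y vs.get) x v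
        = fderiv ℝ (fun y => iteratedFDeriv ℝ vs.length f y vs.get) x v :=
      hd'.lineDeriv_eq_fderiv
    have e2 := fderiv_continuousMultilinear_apply_const_apply hd vs.get v
    have e3 := iteratedFDeriv_succ_apply_left (𝕜 := ℝ) (f := f) (x := x) (n := vs.length)
      (v :: vs).get
    exact (e1.trans e2).trans e3.symm

theorem contDiff_iterLine {N : ℕ} {f : V → ℝ} (hf : ContDiff ℝ N f) (vs : List V) {m : ℕ}
    (h : vs.length + m ≤ N) : ContDiff ℝ m (iterLine vs f) := by
  induction vs generalizing m with
  | nil => exact hf.of_le (by simpa using h)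
  | cons v vs ih =>
    rw [List.length_cons] at h
    have h1 : ContDiff ℝ ((m + 1 : ℕ) : WithTop ℕ∞) (iterLine vs f) := ih (by omega)
    have e : iterLine (v :: vs) f = fun x => fderiv ℝ (iterLine vs f) x v := by
      ext x
      exact ((h1.differentiable (by norm_cast)) x).lineDeriv_eq_fderiv
    rw [e]
    exact (h1.fderiv_right (by norm_cast)).clm_apply contDiff_const

theorem abs_iterLine_le {N : ℕ} {f : V → ℝ} (hf : ContDiff ℝ N f) (vs : List V)
    (h : vs.length ≤ N) (x : V) :
    |iterLine vs f x| ≤ ‖iteratedFDeriv ℝ vs.length f x‖ * (vs.map norm).prod := by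
  have e : (vs.map norm).prod = ∏ i : Fin vs.length, ‖vs.get i‖ := by
    rw [← List.prod_ofFn]
    conv_lhs => rw [← List.ofFn_get vs, List.map_ofFn]
    rfl
  rw [iterLine_eq_iteratedFDeriv hf vs h, e]
  exact (iteratedFDeriv ℝ vs.length f x).le_opNorm vs.get

theorem iterLine_perm {N : ℕ} {f : V → ℝ} (hf : ContDiff ℝ N f) {vs ws : List V}
    (hp : vs.Perm ws) (h : vs.length ≤ N) : iterLine vs f = iterLine ws f := by
  induction hp with
  | nil => rfl
  | cons v _ ih =>
    rw [iterLine_cons, iterLine_cons, ih (Nat.le_of_succ_le h)]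
  | swap v w vs =>
    simp only [List.length_cons] at h
    have h2 : ContDiff ℝ ((2 : ℕ) : WithTop ℕ∞) (iterLine vs f) := contDiff_iterLine hf vs (by omega)
    change iterLine [w, v] (iterLine vs f) = iterLine [v, w] (iterLine vs f)
    generalize iterLine vs f = g at h2 ⊢
    have h1 : ContDiff ℝ 1 (fderiv ℝ g) := h2.fderiv_right (by norm_num)
    have e : ∀ a b : V, iterLine [a, b] g = fun x => fderiv ℝ (fderiv ℝ g) x a b := by
      intro a b
      ext x
      have e1 : (fun y => lineDeriv ℝ g y b) = fun y => fderiv ℝ g y b := by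
        ext y
        exact ((h2.differentiable (by norm_num)) y).lineDeriv_eq_fderiv
      have hd : DifferentiableAt ℝ (fderiv ℝ g) x := (h1.differentiable (by norm_num)) x
      simp only [iterLine, List.foldr_cons, List.foldr_nil]
      rw [e1, (hd.clm_apply (differentiableAt_const b)).lineDeriv_eq_fderiv]
      rw [fderiv_clm_apply hd (differentiableAt_const b)]
      simp
    rw [e, e]
    ext x
    exact (h2.contDiffAt.isSymmSndFDerivAt (by simp)) w v
  | trans h1 _ ih1 ih2 =>
    rw [ih1 h, ih2 (h1.length_eq ▸ h)]

theorem iterLine_const_mul_comp {N : ℕ} {F : V' → ℝ} (hF : ContDiff ℝ N F) (c : ℝ)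
    (L : V →L[ℝ] V') (vs : List V) (h : vs.length ≤ N) (x : V) :
    iterLine vs (fun y => c * F (L y)) x = c * iterLine (vs.map L) F (L x) := by
  induction vs generalizing x with
  | nil => rfl
  | cons v vs ih =>
    have h' : vs.length < N := h
    have h1 : ContDiff ℝ ((1 : ℕ) : WithTop ℕ∞) (iterLine (vs.map L) F) :=
      contDiff_iterLine hF _ (by simpa using h')
    have hd := (h1.differentiable (by norm_num)) (L x)
    rw [iterLine_cons, List.map_cons, iterLine_cons, funext fun y => ih h'.le y]
    have h3 : HasFDerivAt (fun y => c * iterLine (vs.map L) F (L y))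
        (c • (fderiv ℝ (iterLine (vs.map L) F) (L x)).comp L) x :=
      (hd.hasFDerivAt.comp x L.hasFDerivAt).const_mul c
    simp only
    rw [(h3.hasLineDerivAt v).lineDeriv, hd.lineDeriv_eq_fderiv]
    simp

theorem iterLine_sub_sum {N : ℕ} {α : Type*} (s : Finset α) (c : α → ℝ) {f : V → ℝ}
    {g : α → V → ℝ} (hf : ContDiff ℝ N f) (hg : ∀ a ∈ s, ContDiff ℝ N (g a)) (vs : List V)
    (h : vs.length ≤ N) (x : V) :
    iterLine vs (fun y => f y - ∑ a ∈ s, g a y * c a) x =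
      iterLine vs f x - ∑ a ∈ s, iterLine vs (g a) x * c a := by
  have hN : ∀ {u : V → ℝ}, ContDiff ℝ N u → ContDiff ℝ vs.length u := fun hu =>
    hu.of_le (by exact_mod_cast h)
  have hgc : ∀ a ∈ s, ContDiff ℝ vs.length fun y => g a y * c a := fun a ha =>
    (hN (hg a ha)).mul contDiff_const
  rw [iterLine_eq_iteratedFDeriv ((hN hf).sub (ContDiff.sum hgc)) vs le_rfl,
    iterLine_eq_iteratedFDeriv hf vs h]
  simp only
  rw [show (fun y => f y - ∑ a ∈ s, g a y * c a) = f - fun y => ∑ a ∈ s, g a y * c a from rfl,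
    iteratedFDeriv_sub_apply (hN hf).contDiffAt (ContDiff.sum hgc).contDiffAt,
    _root_.sub_apply,
    iteratedFDeriv_fun_sum_apply fun a ha => (hgc a ha).contDiffAt,
    _root_.sum_apply]
  congr 1
  refine Finset.sum_congr rfl fun a ha => ?_
  rw [iterLine_eq_iteratedFDeriv (hg a ha) vs h]
  have e : (fun y => g a y * c a) = c a • g a := by ext y; simp [mul_comm]
  rw [e, iteratedFDeriv_const_smul_apply (hN (hg a ha)).contDiffAt]
  simp [mul_comm]

end IterLine

namespace SpaceTime

open MultiIndex

variable {d : ℕ}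

/-- The list of unit vectors along which `D k` differentiates. -/
def dirs (k : MultiIndex d) : List (SpaceTime d) :=
  (List.finRange (d + 1)).flatMap fun j => List.replicate (k j) (unit j)

theorem iterate_pderiv (j : Fin (d + 1)) (n : ℕ) (f : SpaceTime d → ℝ) :
    (pderiv j)^[n] f = iterLine (List.replicate n (unit j)) f := by
  induction n with
  | zero => rfl
  | succ n ih => rw [Function.iterate_succ_apply', ih, List.replicate_succ]; rfl

theorem D_eq_iterLine (k : MultiIndex d) (f : SpaceTime d → ℝ) : D k f = iterLine (dirs k) f := by
  unfold D dirs
  induction List.finRange (d + 1) with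
  | nil => rfl
  | cons j l ih => rw [List.foldr_cons, ih, iterate_pderiv, List.flatMap_cons, iterLine_append]

theorem length_dirs (k : MultiIndex d) : (dirs k).length = ∑ j, k j := by
  simp [dirs, List.length_flatMap, Fin.sum_univ_def]

theorem length_dirs_le (k : MultiIndex d) : (dirs k).length ≤ deg k := by
  rw [length_dirs]
  refine Finset.sum_le_sum fun j _ => ?_
  unfold scaling
  split_ifs <;> omega

theorem dirs_zero : dirs (0 : MultiIndex d) = [] := by
  apply List.eq_nil_of_length_eq_zero
  simp [length_dirs]

theorem dirs_add_single (k : MultiIndex d) (j : Fin (d + 1)) :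
    (dirs (k + Pi.single j 1)).Perm (unit j :: dirs k) := by
  have key : ∀ l : List (Fin (d + 1)), l.Nodup →
      (j ∉ l → l.flatMap (fun i => List.replicate ((k + Pi.single j 1 : MultiIndex d) i) (unit (d := d) i)) =
        l.flatMap fun i => List.replicate (k i) (unit i)) ∧
      (j ∈ l → (l.flatMap (fun i => List.replicate ((k + Pi.single j 1 : MultiIndex d) i) (unit (d := d) i))).Perm
        (unit j :: l.flatMap fun i => List.replicate (k i) (unit i))) := by
    intro l hl
    induction l with
    | nil => simp
    | cons i l ih =>
      obtain ⟨hi, hl⟩ := List.nodup_cons.mp hl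
      obtain ⟨h1, h2⟩ := ih hl
      by_cases hij : i = j
      · subst hij
        refine ⟨fun h => absurd List.mem_cons_self h, fun _ => ?_⟩
        rw [List.flatMap_cons, List.flatMap_cons, h1 hi]
        simp [List.replicate_succ]
      · have e : (k + Pi.single j 1 : MultiIndex d) i = k i := by simp [hij]
        refine ⟨fun h => ?_, fun h => ?_⟩
        · rw [List.flatMap_cons, List.flatMap_cons, e, h1 (fun h' => h (List.mem_cons_of_mem _ h'))]
        · rw [List.flatMap_cons, List.flatMap_cons, e]
          have h' : j ∈ l := by
            rcases List.mem_cons.mp h with h | h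
            · exact absurd h.symm hij
            · exact h
          exact ((h2 h').append_left _).trans List.perm_middle
  exact (key _ (List.nodup_finRange _)).2 (List.mem_finRange j)

theorem iterLine_inr {G : SpaceTime d × SpaceTime d → ℝ} (vs : List (SpaceTime d))
    (z w : SpaceTime d) :
    iterLine (vs.map fun v => ((0 : SpaceTime d), v)) G (z, w) = iterLine vs (fun y => G (z, y)) w := by
  induction vs generalizing w with
  | nil => rfl
  | cons v vs ih =>
    simp only [List.map_cons, iterLine_cons, lineDeriv]
    congr 1
    ext t
    rw [← ih]
    simp

theorem iterLine_inl {G : SpaceTime d × SpaceTime d → ℝ} (vs : List (SpaceTime d))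
    (z w : SpaceTime d) :
    iterLine (vs.map fun v => (v, (0 : SpaceTime d))) G (z, w) = iterLine vs (fun y => G (y, w)) z := by
  induction vs generalizing z with
  | nil => rfl
  | cons v vs ih =>
    simp only [List.map_cons, iterLine_cons, lineDeriv]
    congr 1
    ext t
    rw [← ih]
    simp

/-- The directions of the mixed derivative `D_1^k D_2^l` in the product of two space-times. -/
def dirs₂ (k l : MultiIndex d) : List (SpaceTime d × SpaceTime d) :=
  (dirs k).map (fun v => (v, 0)) ++ (dirs l).map fun v => (0, v)

theorem D₁₂_eq_iterLine (k l : MultiIndex d) (G : SpaceTime d × SpaceTime d → ℝ)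
    (z w : SpaceTime d) :
    D₁₂ k l (fun z w => G (z, w)) z w = iterLine (dirs₂ k l) G (z, w) := by
  rw [dirs₂, iterLine_append, iterLine_inl, D₁₂, D_eq_iterLine]
  congr 1
  ext y
  rw [iterLine_inr, D_eq_iterLine]

theorem length_dirs₂ (k l : MultiIndex d) :
    (dirs₂ k l).length = (dirs k).length + (dirs l).length := by
  simp [dirs₂]

theorem sum_coord_smul_unit (h : SpaceTime d) : h = ∑ j, coord h j • unit j := by
  rw [Fin.sum_univ_castSucc]
  ext i
  · simp [coord, unit, Prod.fst_sum, Pi.single_apply]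
  · simp [coord, unit, Prod.snd_sum]

theorem monomial_smul (t : ℝ) (h : SpaceTime d) (k : MultiIndex d) :
    monomial (t • h) k = t ^ (∑ j, k j) * monomial h k := by
  have : ∀ j, coord (t • h) j = t * coord h j := fun j => by
    refine Fin.lastCases ?_ (fun i => ?_) j <;> simp [coord]
  simp only [monomial, this, mul_pow, Finset.prod_mul_distrib, Finset.prod_pow_eq_pow_sum]

theorem parNorm_nonneg (z : SpaceTime d) : 0 ≤ parNorm z := le_max_of_le_left (norm_nonneg _)

theorem abs_coord_le (h : SpaceTime d) (j : Fin (d + 1)) :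
    |coord h j| ≤ parNorm h ^ scaling j := by
  refine Fin.lastCases ?_ (fun i => ?_) j
  · simp only [coord, Fin.lastCases_last, scaling, if_true]
    calc |h.2| = Real.sqrt |h.2| ^ 2 := (Real.sq_sqrt (abs_nonneg _)).symm
      _ ≤ _ := pow_le_pow_left₀ (Real.sqrt_nonneg _) (le_max_right _ _) 2
  · have : (i.castSucc : Fin (d + 1)) ≠ Fin.last d := (Fin.castSucc_lt_last i).ne
    simp only [coord, Fin.lastCases_castSucc, scaling, this, if_false, pow_one]
    exact (PiLp.norm_apply_le h.1 i).trans (le_max_left _ _)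

theorem abs_monomial_le (h : SpaceTime d) (k : MultiIndex d) :
    |monomial h k| ≤ parNorm h ^ deg k := by
  rw [monomial, Finset.abs_prod, deg, ← Finset.prod_pow_eq_pow_sum]
  refine Finset.prod_le_prod (fun _ _ => abs_nonneg _) fun j _ => ?_
  rw [abs_pow, pow_mul]
  exact pow_le_pow_left₀ (abs_nonneg _) (abs_coord_le h j) _

theorem coord_unit (i j : Fin (d + 1)) : coord (unit (d := d) j) i = if i = j then 1 else 0 := by
  refine Fin.lastCases ?_ (fun a => ?_) i <;> refine Fin.lastCases ?_ (fun b => ?_) j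
  · simp [coord, unit]
  · simp [coord, unit, (Fin.castSucc_lt_last b).ne']
  · simp [coord, unit, (Fin.castSucc_lt_last a).ne]
  · by_cases h : a = b <;> simp [coord, unit, h]

theorem hasDerivAt_monomial (y : SpaceTime d) (j : Fin (d + 1)) (k : MultiIndex d) :
    HasLineDerivAt ℝ (fun z => monomial z k) (k j * monomial y (k - Pi.single j 1)) y (unit j) := by
  have e : ∀ t : ℝ, monomial (y + t • unit j) k =
      (coord y j + t) ^ k j * ∏ i ∈ Finset.univ.erase j, coord y i ^ k i := by
    intro t
    have hc : ∀ i, coord (y + t • unit j) i = coord y i + t * if i = j then 1 else 0 := by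
      intro i
      rw [← coord_unit]
      refine Fin.lastCases ?_ (fun i => ?_) i <;> simp [coord]
    rw [monomial, ← Finset.mul_prod_erase _ _ (Finset.mem_univ j), hc]
    congr 1
    · simp
    · refine Finset.prod_congr rfl fun i hi => ?_
      rw [hc, if_neg (Finset.ne_of_mem_erase hi)]
      simp
  have h1 : HasDerivAt (fun t : ℝ => (coord y j + t) ^ k j)
      (k j * (coord y j + 0) ^ (k j - 1) * 1) 0 :=
    ((hasDerivAt_id (0 : ℝ)).const_add (coord y j)).pow (k j)
  have h2 := h1.mul_const (∏ i ∈ Finset.univ.erase j, coord y i ^ k i)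
  have e2 : monomial y (k - Pi.single j 1) =
      coord y j ^ (k j - 1) * ∏ i ∈ Finset.univ.erase j, coord y i ^ k i := by
    unfold monomial
    rw [← Finset.mul_prod_erase _ _ (Finset.mem_univ j)]
    congr 1
    · simp
    · refine Finset.prod_congr rfl fun i hi => ?_
      simp [Finset.ne_of_mem_erase hi]
  unfold HasLineDerivAt
  rw [funext e]
  refine h2.congr_deriv ?_
  rw [e2, add_zero, mul_one, mul_assoc]

end SpaceTime

/-! ### Anisotropic Taylor expansion -/

namespace MultiIndex

variable {d : ℕ}

theorem deg_add_single (k : MultiIndex d) (j : Fin (d + 1)) :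
    deg (k + Pi.single j 1) = deg k + scaling j := by
  simp [deg, mul_add, Finset.sum_add_distrib, Pi.single_apply]

theorem sum_add_single (k : MultiIndex d) (j : Fin (d + 1)) :
    ∑ i, (k + Pi.single j 1 : MultiIndex d) i = (∑ i, k i) + 1 := by
  simp [Finset.sum_add_distrib]

theorem fact_add_single (k : MultiIndex d) (j : Fin (d + 1)) :
    fact (k + Pi.single j 1) = (k j + 1) * fact k := by
  unfold fact
  rw [← Finset.mul_prod_erase _ _ (Finset.mem_univ j),
    ← Finset.mul_prod_erase _ (fun i => (k i).factorial) (Finset.mem_univ j), ← mul_assoc]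
  congr 1
  · simp [Nat.factorial_succ]
  · refine Finset.prod_congr rfl fun i hi => ?_
    simp [Finset.ne_of_mem_erase hi]

theorem sub_single_add_single {k : MultiIndex d} {j : Fin (d + 1)} (h : k j ≠ 0) :
    k - Pi.single j 1 + Pi.single j 1 = k := by
  ext i
  by_cases hij : i = j
  · subst hij
    simp only [Pi.add_apply, Pi.sub_apply, Pi.single_eq_same]
    omega
  · simp [hij]

theorem sum_le_deg (k : MultiIndex d) : ∑ j, k j ≤ deg k := by
  rw [← SpaceTime.length_dirs]
  exact SpaceTime.length_dirs_le k

theorem one_le_scaling (j : Fin (d + 1)) : 1 ≤ scaling j := by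
  unfold scaling
  split_ifs <;> omega

theorem sum_le_of_mem_below {γ : ℝ} {k : MultiIndex d} (h : k ∈ below d γ) :
    ∑ j, k j ≤ ⌈γ⌉₊ := by
  have h1 : ((∑ j, k j : ℕ) : ℝ) ≤ deg k := by exact_mod_cast sum_le_deg k
  have h2 := (h1.trans_lt (mem_below.mp h)).le.trans (Nat.le_ceil γ)
  exact_mod_cast h2

theorem one_le_fact (k : MultiIndex d) : (1 : ℝ) ≤ fact k := by
  have : 0 < fact k := Finset.prod_pos fun j _ => Nat.factorial_pos _
  exact_mod_cast this

end MultiIndex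

namespace SpaceTime

open MultiIndex

variable {d : ℕ}

theorem monomial_add_single (h : SpaceTime d) (k : MultiIndex d) (j : Fin (d + 1)) :
    monomial h (k + Pi.single j 1) = monomial h k * coord h j := by
  unfold monomial
  rw [← Finset.mul_prod_erase _ _ (Finset.mem_univ j),
    ← Finset.mul_prod_erase _ (fun i => coord h i ^ k i) (Finset.mem_univ j)]
  have : ∏ i ∈ Finset.univ.erase j, coord h i ^ (k + Pi.single j 1 : MultiIndex d) i =
      ∏ i ∈ Finset.univ.erase j, coord h i ^ k i := by
    refine Finset.prod_congr rfl fun i hi => ?_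
    simp [Finset.ne_of_mem_erase hi]
  rw [this]
  simp only [Pi.add_apply, Pi.single_eq_same, pow_succ]
  ring

theorem D_pderiv {N : ℕ} {f : SpaceTime d → ℝ} (hf : ContDiff ℝ N f) (k : MultiIndex d)
    (j : Fin (d + 1)) (hk : (∑ i, k i) + 1 ≤ N) :
    D k (pderiv j f) = D (k + Pi.single j 1) f := by
  have e : pderiv j f = iterLine [unit j] f := rfl
  rw [D_eq_iterLine, D_eq_iterLine, e, ← iterLine_append]
  refine iterLine_perm hf (List.perm_append_comm.trans (dirs_add_single k j).symm) ?_
  simpa [length_dirs] using hk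

theorem contDiff_pderiv {m : ℕ} {f : SpaceTime d → ℝ} (hf : ContDiff ℝ (m + 1 : ℕ) f)
    (j : Fin (d + 1)) : ContDiff ℝ m (pderiv j f) :=
  contDiff_iterLine hf [unit j] (m := m) (by simp [add_comm])

/-- Differentiating the Taylor polynomial of `f` gives the Taylor polynomials, of lower order, of
the partial derivatives of `f`. -/
theorem hasDerivAt_taylor {m : ℕ} {γ : ℝ} (hγ : γ ≤ m + 1) {f : SpaceTime d → ℝ}
    (hf : ContDiff ℝ (m + 1 : ℕ) f) (z₀ h : SpaceTime d) (t : ℝ) :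
    HasDerivAt (fun t : ℝ => taylor γ f z₀ (z₀ + t • h))
      (∑ j, coord h j * taylor (γ - scaling j) (pderiv j f) z₀ (z₀ + t • h)) t := by
  have e : ∀ (γ : ℝ) (f : SpaceTime d → ℝ) (t : ℝ), taylor γ f z₀ (z₀ + t • h) =
      ∑ k ∈ below d γ, D k f z₀ / (fact k : ℝ) * (t ^ (∑ j, k j) * monomial h k) := by
    intro γ f t
    simp only [taylor, add_sub_cancel_left, monomial_smul]
  have e' : (fun t : ℝ => taylor γ f z₀ (z₀ + t • h)) = _ := funext (e γ f)
  rw [e']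
  have h1 : HasDerivAt (fun t : ℝ => ∑ k ∈ below d γ,
      D k f z₀ / (fact k : ℝ) * (t ^ (∑ j, k j) * monomial h k))
      (∑ k ∈ below d γ, D k f z₀ / (fact k : ℝ) *
        (((∑ j, k j : ℕ) : ℝ) * t ^ ((∑ j, k j) - 1) * monomial h k)) t :=
    HasDerivAt.fun_sum fun k _ => ((hasDerivAt_pow _ t).mul_const _).const_mul _
  refine h1.congr_deriv ?_
  have h2 : ∀ k : MultiIndex d, D k f z₀ / (fact k : ℝ) *
      (((∑ j, k j : ℕ) : ℝ) * t ^ ((∑ j, k j) - 1) * monomial h k) =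
      ∑ j, (k j : ℝ) * (D k f z₀ / (fact k : ℝ) * (t ^ ((∑ j, k j) - 1) * monomial h k)) := by
    intro k
    rw [← Finset.sum_mul]
    push_cast
    ring
  simp only [h2]
  rw [Finset.sum_comm]
  refine Finset.sum_congr rfl fun j _ => ?_
  rw [e, Finset.mul_sum]
  have h3 : ∑ k ∈ below d γ, (k j : ℝ) *
        (D k f z₀ / (fact k : ℝ) * (t ^ ((∑ j, k j) - 1) * monomial h k)) =
      ∑ k ∈ (below d γ).filter fun k => k j ≠ 0, (k j : ℝ) *
        (D k f z₀ / (fact k : ℝ) * (t ^ ((∑ j, k j) - 1) * monomial h k)) := by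
    rw [Finset.sum_filter]
    refine Finset.sum_congr rfl fun k _ => ?_
    split_ifs with hk
    · rfl
    · simp only [ne_eq, not_not] at hk
      simp [hk]
  rw [h3]
  refine Finset.sum_nbij' (fun k => k - Pi.single j 1) (fun k => k + Pi.single j 1) ?_ ?_ ?_ ?_ ?_
  · intro k hk
    rw [Finset.mem_filter, mem_below] at hk
    have h4 := deg_add_single (k - Pi.single j 1) j
    rw [sub_single_add_single hk.2] at h4
    rw [mem_below]
    have : (deg k : ℝ) = deg (k - Pi.single j 1) + scaling j := by exact_mod_cast h4
    linarith [hk.1]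
  · intro k hk
    rw [mem_below] at hk
    rw [Finset.mem_filter, mem_below, deg_add_single]
    refine ⟨?_, by simp⟩
    push_cast
    linarith
  · intro k hk
    exact sub_single_add_single (Finset.mem_filter.mp hk).2
  · intro k _
    exact add_tsub_cancel_right k _
  · intro k hk
    obtain ⟨k', rfl⟩ : ∃ k' : MultiIndex d, k = k' + Pi.single j 1 :=
      ⟨k - Pi.single j 1, (sub_single_add_single (Finset.mem_filter.mp hk).2).symm⟩
    have hk' := (Finset.mem_filter.mp hk).1
    have hlen : (∑ i, k' i) + 1 ≤ m + 1 := by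
      rw [← sum_add_single k' j]
      refine (sum_le_of_mem_below hk').trans (Nat.ceil_le.mpr ?_)
      exact_mod_cast hγ
    rw [add_tsub_cancel_right, sum_add_single, add_tsub_cancel_right, fact_add_single,
      monomial_add_single, D_pderiv hf k' j hlen]
    have h5 : (fact k' : ℝ) ≠ 0 := (zero_lt_one.trans_le (one_le_fact k')).ne'
    have h6 : ((k' j : ℝ) + 1) ≠ 0 := by positivity
    simp only [Pi.add_apply, Pi.single_eq_same]
    push_cast
    field_simp

theorem taylor_self {γ : ℝ} (hγ : 0 < γ) (f : SpaceTime d → ℝ) (z : SpaceTime d) :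
    taylor γ f z z = f z := by
  unfold taylor
  rw [sub_self, Finset.sum_eq_single (0 : MultiIndex d)]
  · simp [D_eq_iterLine, dirs_zero, fact, monomial]
  · intro k _ hk
    obtain ⟨j, hj⟩ := Function.ne_iff.mp hk
    have : monomial (0 : SpaceTime d) k = 0 := by
      refine Finset.prod_eq_zero (Finset.mem_univ j) ?_
      have : coord (0 : SpaceTime d) j = 0 := by
        refine Fin.lastCases ?_ (fun i => ?_) j <;> simp [coord]
      rw [this]
      exact zero_pow hj
    rw [this, mul_zero]
  · intro h
    exact absurd (mem_below.mpr (by simpa [deg] using hγ)) h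

theorem D_zero (f : SpaceTime d → ℝ) : D (0 : MultiIndex d) f = f := by
  rw [D_eq_iterLine, dirs_zero, iterLine_nil]

theorem parNorm_smul_le (h : SpaceTime d) {t : ℝ} (ht0 : 0 ≤ t) (ht : t ≤ 1) :
    parNorm (t • h) ≤ parNorm h := by
  refine max_le_max ?_ (Real.sqrt_le_sqrt ?_)
  · rw [Prod.smul_fst, norm_smul, Real.norm_of_nonneg ht0]
    exact mul_le_of_le_one_left (norm_nonneg _) ht
  · rw [Prod.smul_snd, smul_eq_mul, abs_mul, abs_of_nonneg ht0]
    exact mul_le_of_le_one_left (abs_nonneg _) ht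

theorem pow_mul_rpow_max_le {ρ γ : ℝ} (h0 : 0 ≤ ρ) (h1 : ρ ≤ 1) {s : ℕ} (hs : 1 ≤ s) :
    ρ ^ s * ρ ^ max (γ - s) 0 ≤ ρ ^ γ := by
  rcases h0.eq_or_lt with rfl | h0
  · rw [zero_pow (by omega), zero_mul]
    exact Real.rpow_nonneg le_rfl _
  · rw [← Real.rpow_natCast, ← Real.rpow_add h0]
    refine Real.rpow_le_rpow_of_exponent_ge h0 h1 ?_
    have := le_max_left (γ - s) 0
    linarith

/-- Taylor's theorem at distances at most the scale `1 / r` on which `f` varies. -/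
theorem abs_sub_taylor_le_of_close {r : ℝ} (hr : 0 ≤ r) (m : ℕ) : ∀ {γ : ℝ}, γ ≤ m →
    ∀ {f : SpaceTime d → ℝ}, ContDiff ℝ m f → ∀ {M : ℝ},
    (∀ k : MultiIndex d, ∑ j, k j ≤ m → ∀ y, |D k f y| ≤ M * r ^ deg k) →
    ∀ (z₀ z : SpaceTime d) {ρ : ℝ}, ρ ≤ 1 → r * parNorm (z - z₀) ≤ ρ →
      |f z - taylor γ f z₀ z| ≤ ((d : ℝ) + 1) ^ m * M * ρ ^ max γ 0 := by
  have hzero : ∀ {m : ℕ} {γ : ℝ} {f : SpaceTime d → ℝ} {M : ℝ}, γ ≤ 0 →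
      (∀ k : MultiIndex d, ∑ j, k j ≤ m → ∀ y, |D k f y| ≤ M * r ^ deg k) →
      ∀ (z₀ z : SpaceTime d) (ρ : ℝ), |f z - taylor γ f z₀ z| ≤ ((d : ℝ) + 1) ^ m * M * ρ ^ max γ 0 := by
    intro m γ f M hγ hM z₀ z ρ
    have h1 : below d γ = ∅ := Finset.eq_empty_of_forall_notMem fun k hk => by
      have h2 := mem_below.mp hk
      have : (0 : ℝ) ≤ deg k := Nat.cast_nonneg _
      linarith
    have h2 := hM 0 (by simp) z
    simp only [D_zero, deg, Pi.zero_apply, mul_zero, Finset.sum_const_zero, pow_zero, mul_one] at h2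
    rw [taylor, h1, Finset.sum_empty, sub_zero, max_eq_right hγ, Real.rpow_zero, mul_one]
    exact h2.trans (le_mul_of_one_le_left ((abs_nonneg _).trans h2) (one_le_pow₀ (by linarith [Nat.cast_nonneg (α := ℝ) d])))
  induction m with
  | zero =>
    intro γ hγ f _ M hM z₀ z ρ _ _
    exact hzero (by simpa using hγ) hM z₀ z ρ
  | succ m ih =>
    intro γ hγ f hf M hM z₀ z ρ hρ1 hρ
    rcases le_or_gt γ 0 with hγ0 | hγ0
    · exact hzero hγ0 hM z₀ z ρ
    have hρ0 : 0 ≤ ρ := (mul_nonneg hr (parNorm_nonneg _)).trans hρ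
    have hM0 : 0 ≤ M := by
      have h2 := hM 0 (by simp) z
      simp only [deg, Pi.zero_apply, mul_zero, Finset.sum_const_zero, pow_zero, mul_one] at h2
      exact (abs_nonneg _).trans h2
    set h := z - z₀ with hh
    have hd : ∀ t : ℝ, HasDerivAt (fun t : ℝ => f (z₀ + t • h) - taylor γ f z₀ (z₀ + t • h))
        (∑ j, coord h j * (pderiv j f (z₀ + t • h) -
          taylor (γ - scaling j) (pderiv j f) z₀ (z₀ + t • h))) t := by
      intro t
      have hfd : HasFDerivAt f (fderiv ℝ f (z₀ + t • h)) (z₀ + t • h) :=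
        ((hf.differentiable (by norm_cast)) _).hasFDerivAt
      have h1 : HasDerivAt (fun t : ℝ => z₀ + t • h) h t := by
        simpa using ((hasDerivAt_id t).smul_const h).const_add z₀
      have h2 := (hfd.comp_hasDerivAt t h1).sub (hasDerivAt_taylor (by exact_mod_cast hγ) hf z₀ h t)
      refine h2.congr_deriv ?_
      simp only [mul_sub, Finset.sum_sub_distrib]
      congr 1
      conv_lhs => rw [sum_coord_smul_unit h, map_sum]
      refine Finset.sum_congr rfl fun j _ => ?_
      rw [map_smul, smul_eq_mul]
      congr 1
      rw [← sum_coord_smul_unit h]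
      exact (((hf.differentiable (by norm_cast)) _).lineDeriv_eq_fderiv).symm
    have hbd : ∀ t ∈ Set.Ico (0 : ℝ) 1, ‖∑ j, coord h j * (pderiv j f (z₀ + t • h) -
        taylor (γ - scaling j) (pderiv j f) z₀ (z₀ + t • h))‖ ≤
          ((d : ℝ) + 1) ^ (m + 1) * M * ρ ^ γ := by
      intro t ht
      refine (norm_sum_le _ _).trans ?_
      have : ∀ j : Fin (d + 1), ‖coord h j * (pderiv j f (z₀ + t • h) -
          taylor (γ - scaling j) (pderiv j f) z₀ (z₀ + t • h))‖ ≤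
            ((d : ℝ) + 1) ^ m * M * ρ ^ γ := by
        intro j
        have hs : (1 : ℝ) ≤ scaling j := by exact_mod_cast one_le_scaling j
        have h1 := ih (γ := γ - scaling j) (by push_cast at hγ; linarith)
          (contDiff_pderiv hf j) (M := M * r ^ scaling j) (fun k hk y => by
            rw [D_pderiv hf k j (by omega)]
            refine (hM _ (by rw [sum_add_single]; omega) y).trans (le_of_eq ?_)
            rw [deg_add_single, pow_add]
            ring) z₀ (z₀ + t • h) hρ1 (by
            rw [add_sub_cancel_left]
            exact (mul_le_mul_of_nonneg_left (parNorm_smul_le h ht.1 ht.2.le) hr).trans hρ)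
        rw [norm_mul, Real.norm_eq_abs, Real.norm_eq_abs]
        have h2 : |coord h j| * r ^ scaling j ≤ ρ ^ scaling j := by
          refine (mul_le_mul_of_nonneg_right (abs_coord_le h j) (by positivity)).trans ?_
          rw [← mul_pow, mul_comm]
          exact pow_le_pow_left₀ (mul_nonneg hr (parNorm_nonneg _)) hρ _
        have h3 : (0 : ℝ) ≤ ρ ^ max (γ - scaling j) 0 := Real.rpow_nonneg hρ0 _
        calc _ ≤ |coord h j| * (((d : ℝ) + 1) ^ m * (M * r ^ scaling j) *
                ρ ^ max (γ - scaling j) 0) := mul_le_mul_of_nonneg_left h1 (abs_nonneg _)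
          _ = ((d : ℝ) + 1) ^ m * M * ((|coord h j| * r ^ scaling j) *
                ρ ^ max (γ - scaling j) 0) := by ring
          _ ≤ ((d : ℝ) + 1) ^ m * M * (ρ ^ scaling j * ρ ^ max (γ - scaling j) 0) := by gcongr
          _ ≤ _ := by
            gcongr
            exact pow_mul_rpow_max_le hρ0 hρ1 (one_le_scaling j)
      refine (Finset.sum_le_sum fun j _ => this j).trans (le_of_eq ?_)
      rw [Finset.sum_const, Finset.card_univ, Fintype.card_fin, nsmul_eq_mul]
      push_cast
      ring
    have h1 := norm_image_sub_le_of_norm_deriv_le_segment_01'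
      (fun t _ => (hd t).hasDerivWithinAt) hbd
    simp only [one_smul, zero_smul, add_zero, taylor_self hγ0, sub_self, sub_zero,
      Real.norm_eq_abs] at h1
    rw [hh, add_sub_cancel] at h1
    rwa [max_eq_left hγ0.le]

/-- Taylor's theorem for a function that varies on the scale `1 / r`, in parabolic scaling. -/
theorem exists_taylor_const (d : ℕ) (γ : ℝ) (hγ : 0 ≤ γ) : ∃ C : ℝ, 0 ≤ C ∧
    ∀ {r : ℝ}, 0 ≤ r → ∀ {f : SpaceTime d → ℝ}, ContDiff ℝ ⌈γ⌉₊ f → ∀ {M : ℝ},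
    (∀ k : MultiIndex d, ∑ j, k j ≤ ⌈γ⌉₊ → ∀ y, |D k f y| ≤ M * r ^ deg k) →
    ∀ z₀ z : SpaceTime d,
      |f z - taylor γ f z₀ z| ≤ C * M * (r * parNorm (z - z₀)) ^ γ := by
  refine ⟨((d : ℝ) + 1) ^ ⌈γ⌉₊ + (1 + (below d γ).card), by positivity, ?_⟩
  intro r hr f hf M hM z₀ z
  have hM0 := hM 0 (by simp) z
  simp only [D_zero, deg, Pi.zero_apply, mul_zero, Finset.sum_const_zero, pow_zero, mul_one] at hM0
  have hMn : 0 ≤ M := (abs_nonneg _).trans hM0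
  set ρ := r * parNorm (z - z₀) with hρ
  have hρ0 : 0 ≤ ρ := mul_nonneg hr (parNorm_nonneg _)
  have hργ : 0 ≤ ρ ^ γ := Real.rpow_nonneg hρ0 _
  rcases le_or_gt ρ 1 with h1 | h1
  · refine (abs_sub_taylor_le_of_close hr ⌈γ⌉₊ (Nat.le_ceil γ) hf hM z₀ z h1 le_rfl).trans ?_
    rw [max_eq_left hγ]
    gcongr
    linarith [Nat.cast_nonneg (α := ℝ) (below d γ).card]
  · have h2 : |taylor γ f z₀ z| ≤ (below d γ).card * (M * ρ ^ γ) := by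
      unfold taylor
      refine (Finset.abs_sum_le_sum_abs _ _).trans ?_
      rw [← nsmul_eq_mul]
      refine Finset.sum_le_card_nsmul _ _ _ fun k hk => ?_
      rw [abs_mul, abs_div, Nat.abs_cast]
      have h3 := hM k (sum_le_of_mem_below hk) z₀
      have h4 : |D k f z₀| / (fact k : ℝ) ≤ M * r ^ deg k :=
        (div_le_self (abs_nonneg _) (one_le_fact k)).trans h3
      refine (mul_le_mul h4 (abs_monomial_le _ k) (abs_nonneg _) (by positivity)).trans ?_
      rw [mul_assoc, ← mul_pow]
      refine mul_le_mul_of_nonneg_left ?_ hMn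
      rw [← Real.rpow_natCast]
      exact Real.rpow_le_rpow_of_exponent_le h1.le (mem_below.mp hk).le
    have h3 : (1 : ℝ) ≤ ρ ^ γ := Real.one_le_rpow h1.le hγ
    calc |f z - taylor γ f z₀ z| ≤ |f z| + |taylor γ f z₀ z| := abs_sub _ _
      _ ≤ M * ρ ^ γ + (below d γ).card * (M * ρ ^ γ) :=
        add_le_add (hM0.trans (le_mul_of_one_le_right hMn h3)) h2
      _ ≤ (((d : ℝ) + 1) ^ ⌈γ⌉₊ + (1 + (below d γ).card)) * M * ρ ^ γ := by
        have : 0 ≤ ((d : ℝ) + 1) ^ ⌈γ⌉₊ * (M * ρ ^ γ) := by positivity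
        nlinarith [this]

end SpaceTime

/-! ### Kernels that live on one dyadic scale -/

namespace SpaceTime

open MultiIndex SingularKernel

variable {d : ℕ}

/-- The parabolic dilation `(x, t) ↦ (r x, r² t)`. -/
def dilate (r : ℝ) : SpaceTime d →L[ℝ] SpaceTime d :=
  (r • ContinuousLinearMap.fst ℝ _ _).prod (r ^ 2 • ContinuousLinearMap.snd ℝ _ _)

@[simp] theorem dilate_apply (r : ℝ) (z : SpaceTime d) : dilate r z = (r • z.1, r ^ 2 * z.2) := rfl

/-- The change of coordinates `(z, w) ↦ (dilate r (z - w), w)`. -/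
def relCoord (r : ℝ) : SpaceTime d × SpaceTime d →L[ℝ] SpaceTime d × SpaceTime d :=
  ((dilate r).comp (ContinuousLinearMap.fst ℝ _ _ - ContinuousLinearMap.snd ℝ _ _)).prod
    (ContinuousLinearMap.snd ℝ _ _)

@[simp] theorem relCoord_apply (r : ℝ) (p : SpaceTime d × SpaceTime d) :
    relCoord r p = (dilate r (p.1 - p.2), p.2) := rfl

theorem parNorm_dilate {r : ℝ} (hr : 0 ≤ r) (z : SpaceTime d) :
    parNorm (dilate r z) = r * parNorm z := by
  rw [parNorm, parNorm, mul_max_of_nonneg _ _ hr, dilate_apply, norm_smul, Real.norm_of_nonneg hr,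
    abs_mul, abs_of_nonneg (sq_nonneg r), Real.sqrt_mul (sq_nonneg r), Real.sqrt_sq hr]

theorem norm_unit_le (j : Fin (d + 1)) : ‖unit (d := d) j‖ ≤ 1 := by
  refine Fin.lastCases ?_ (fun i => ?_) j <;> simp [unit, Prod.norm_def]

theorem dilate_unit (r : ℝ) (j : Fin (d + 1)) :
    dilate r (unit (d := d) j) = r ^ scaling j • unit j := by
  refine Fin.lastCases ?_ (fun i => ?_) j
  · simp [unit, scaling]
  · simp [unit, scaling, (Fin.castSucc_lt_last i).ne]

/-- A kernel on the scale `1 / r`: it is `r ^ d` times a function, with `N` derivatives bounded by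
`B`, of the rescaled difference and of the second variable. -/
structure IsScaleKernel (N : ℕ) (r B : ℝ) (G : SpaceTime d × SpaceTime d → ℝ) : Prop where
  exists_profile : ∃ F : SpaceTime d × SpaceTime d → ℝ, ContDiff ℝ N F ∧
    (∀ x, JetBound N 1 B F x) ∧ (∀ y w, 2 < parNorm y → F (y, w) = 0) ∧
    G = fun p => r ^ d * F (relCoord r p)

namespace IsScaleKernel

variable {N : ℕ} {r B : ℝ} {G : SpaceTime d × SpaceTime d → ℝ}

theorem contDiff (h : IsScaleKernel N r B G) : ContDiff ℝ N G := by
  obtain ⟨F, hF, _, _, rfl⟩ := h.exists_profile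
  exact contDiff_const.mul (hF.comp (relCoord r).contDiff)

theorem eq_zero (h : IsScaleKernel N r B G) (hr : 0 ≤ r) {z w : SpaceTime d}
    (hzw : 2 < r * parNorm (z - w)) : G (z, w) = 0 := by
  obtain ⟨F, _, _, h0, rfl⟩ := h.exists_profile
  simp only [relCoord_apply]
  rw [h0 _ _ (by rwa [parNorm_dilate hr]), mul_zero]

theorem nonneg (h : IsScaleKernel N r B G) : 0 ≤ B := by
  obtain ⟨F, _, h1, _, _⟩ := h.exists_profile
  exact (h1 0).nonneg

theorem abs_iterLine_le (h : IsScaleKernel N r B G) (hr : 0 ≤ r)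
    (vs : List (SpaceTime d × SpaceTime d)) (hvs : vs.length ≤ N)
    (x : SpaceTime d × SpaceTime d) :
    |iterLine vs G x| ≤ r ^ d * B * (vs.map fun v => ‖relCoord r v‖).prod := by
  obtain ⟨F, hF, h1, _, rfl⟩ := h.exists_profile
  rw [iterLine_const_mul_comp hF _ _ _ hvs, abs_mul, abs_of_nonneg (pow_nonneg hr d), mul_assoc]
  refine mul_le_mul_of_nonneg_left ?_ (pow_nonneg hr d)
  have hl : (vs.map (relCoord r)).length = vs.length := List.length_map ..
  refine (_root_.abs_iterLine_le hF _ (by rw [hl]; exact hvs) _).trans ?_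
  rw [List.map_map]
  have h2 := h1 (relCoord r x) vs.length hvs
  rw [one_pow, mul_one] at h2
  refine mul_le_mul_of_nonneg_right (by rw [hl]; exact h2) (List.prod_nonneg fun a ha => ?_)
  obtain ⟨v, _, rfl⟩ := List.mem_map.mp ha
  exact norm_nonneg _

theorem prod_norm_dirs_le (g : SpaceTime d → SpaceTime d × SpaceTime d) (hr : 0 ≤ r)
    (hg : ∀ j, ‖relCoord r (g (unit j))‖ ≤ r ^ scaling j) (k : MultiIndex d) :
    (((dirs k).map g).map fun v => ‖relCoord r v‖).prod ≤ r ^ deg k := by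
  have key : ∀ l : List (Fin (d + 1)),
      (((l.flatMap fun j => List.replicate (k j) (unit j)).map g).map
        fun v => ‖relCoord r v‖).prod ≤ (l.map fun j => (r ^ scaling j) ^ k j).prod := by
    intro l
    induction l with
    | nil => simp
    | cons j l ih =>
      simp only [List.flatMap_cons, List.map_append, List.prod_append, List.map_cons,
        List.prod_cons, List.map_replicate, List.prod_replicate]
      refine mul_le_mul (pow_le_pow_left₀ (norm_nonneg _) (hg j) _) ih
        (List.prod_nonneg fun a ha => ?_) (by positivity)
      obtain ⟨v, _, rfl⟩ := List.mem_map.mp ha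
      exact norm_nonneg _
  refine (key _).trans (le_of_eq ?_)
  simp only [← pow_mul]
  rw [deg, ← Finset.prod_pow_eq_pow_sum, Fin.prod_univ_def]

theorem abs_D₁₂_le (h : IsScaleKernel N r B G) (hr : 1 ≤ r) (k l : MultiIndex d)
    (hkl : (∑ j, k j) + ∑ j, l j ≤ N) (z w : SpaceTime d) :
    |D₁₂ k l (fun z w => G (z, w)) z w| ≤ r ^ d * B * r ^ (deg k + deg l) := by
  have hr0 : 0 ≤ r := zero_le_one.trans hr
  have hu : ∀ j, ‖dilate r (unit (d := d) j)‖ ≤ r ^ scaling j := fun j => by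
    rw [dilate_unit, norm_smul, Real.norm_of_nonneg (by positivity)]
    exact mul_le_of_le_one_right (by positivity) (norm_unit_le j)
  rw [D₁₂_eq_iterLine]
  refine (h.abs_iterLine_le hr0 _ (by rw [length_dirs₂, length_dirs, length_dirs]; exact hkl) _).trans ?_
  refine mul_le_mul_of_nonneg_left ?_ (mul_nonneg (by positivity) h.nonneg)
  rw [dirs₂, List.map_append, List.prod_append, pow_add]
  refine mul_le_mul (prod_norm_dirs_le _ hr0 (fun j => ?_) k)
    (prod_norm_dirs_le _ hr0 (fun j => ?_) l) (List.prod_nonneg fun a ha => ?_) (by positivity)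
  · rw [relCoord_apply, sub_zero, Prod.norm_def]
    exact max_le (hu j) (by simpa using by positivity)
  · rw [relCoord_apply, zero_sub, map_neg, Prod.norm_def]
    simp only [norm_neg]
    exact max_le (hu j) ((norm_unit_le j).trans (one_le_pow₀ hr))
  · obtain ⟨v, _, rfl⟩ := List.mem_map.mp ha
    exact norm_nonneg _

/-- Derivatives along the diagonal do not see the scale. -/
theorem abs_iterLine_diag_le (h : IsScaleKernel N r B G) (hr : 0 ≤ r)
    (us : List (SpaceTime d)) (hus : us.length ≤ N) (hu : ∀ u ∈ us, ‖u‖ ≤ 1)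
    (x : SpaceTime d × SpaceTime d) :
    |iterLine (us.map fun u => (u, u)) G x| ≤ r ^ d * B := by
  refine (h.abs_iterLine_le hr _ (by simpa using hus) x).trans
    (mul_le_of_le_one_right (mul_nonneg (by positivity) h.nonneg) ?_)
  clear hus
  induction us with
  | nil => simp
  | cons u us ih =>
    simp only [List.map_cons, List.prod_cons]
    refine mul_le_one₀ ?_ (List.prod_nonneg fun a ha => ?_)
      (ih fun u' hu' => hu u' (List.mem_cons_of_mem _ hu'))
    · rw [relCoord_apply, sub_self, map_zero, Prod.norm_def]
      simpa using hu u List.mem_cons_self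
    · obtain ⟨v, _, rfl⟩ := List.mem_map.mp ha
      exact norm_nonneg _

end IsScaleKernel

theorem D_D₁₂_comm {N : ℕ} {G : SpaceTime d × SpaceTime d → ℝ} (hG : ContDiff ℝ N G)
    (k l : MultiIndex d) (hkl : (∑ j, k j) + ∑ j, l j ≤ N) (z w : SpaceTime d) :
    D l (fun y => D₁₂ k 0 (fun z w => G (z, w)) z y) w = D₁₂ k l (fun z w => G (z, w)) z w := by
  have e : (fun y => D₁₂ k 0 (fun z w => G (z, w)) z y) =
      fun y => iterLine ((dirs k).map fun v => (v, (0 : SpaceTime d))) G (z, y) := by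
    ext y
    rw [D₁₂_eq_iterLine, dirs₂, dirs_zero, List.map_nil, List.append_nil]
  rw [e, D_eq_iterLine, ← iterLine_inr, ← iterLine_append, D₁₂_eq_iterLine, dirs₂]
  rw [iterLine_perm hG List.perm_append_comm]
  simp only [List.length_append, List.length_map, length_dirs]
  omega

theorem contDiff_D₁₂ {N m : ℕ} {G : SpaceTime d × SpaceTime d → ℝ} (hG : ContDiff ℝ N G)
    (k l : MultiIndex d) (hkl : (∑ j, k j) + (∑ j, l j) + m ≤ N) :
    ContDiff ℝ m fun p : SpaceTime d × SpaceTime d => D₁₂ k l (fun z w => G (z, w)) p.1 p.2 := by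
  simp only [D₁₂_eq_iterLine]
  exact contDiff_iterLine hG _ (by rw [length_dirs₂, length_dirs, length_dirs]; exact hkl)

theorem D_D₁₂_left (k l : MultiIndex d) (G : SpaceTime d × SpaceTime d → ℝ) (z w : SpaceTime d) :
    D k (fun y => D₁₂ 0 l (fun z w => G (z, w)) y w) z = D₁₂ k l (fun z w => G (z, w)) z w := by
  simp only [D₁₂, D_zero]

/-! ### Moments -/

theorem measure_parNorm_ball_le (d : ℕ) : ∃ C : ℝ, 0 ≤ C ∧ ∀ {r : ℝ}, 0 < r →
    ∀ (w : SpaceTime d) {f : SpaceTime d → ℝ} {M : ℝ}, 0 ≤ M →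
    (∀ z, |f z| ≤ M) → (∀ z, 2 < r * parNorm (z - w) → f z = 0) →
      |∫ z, f z| ≤ C * M / r ^ (d + 2) := by
  set c := (volume : Measure (EuclideanSpace ℝ (Fin d))).real (Metric.ball 0 1) with hc
  refine ⟨c * 2 ^ d * 8, by positivity, ?_⟩
  intro r hr w f M hM hf h0
  set S : Set (SpaceTime d) := Metric.closedBall w.1 (2 / r) ×ˢ Metric.closedBall w.2 (4 / r ^ 2)
  have hS : ∀ z, z ∉ S → f z = 0 := by
    intro z hz
    refine h0 z ?_
    by_contra hcon
    push Not at hcon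
    have h1 : parNorm (z - w) ≤ 2 / r := by rw [le_div_iff₀ hr, mul_comm]; exact hcon
    refine hz ⟨?_, ?_⟩
    · rw [mem_closedBall_iff_norm]
      exact (le_max_left _ _).trans h1
    · rw [mem_closedBall_iff_norm, Real.norm_eq_abs]
      have h2 : Real.sqrt |z.2 - w.2| ≤ 2 / r := (le_max_right _ _).trans h1
      calc |z.2 - w.2| = Real.sqrt |z.2 - w.2| ^ 2 := (Real.sq_sqrt (abs_nonneg _)).symm
        _ ≤ (2 / r) ^ 2 := pow_le_pow_left₀ (Real.sqrt_nonneg _) h2 2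
        _ = 4 / r ^ 2 := by rw [div_pow]; norm_num
  have hvol : (volume : Measure (SpaceTime d)).real S = c * 2 ^ d * 8 / r ^ (d + 2) := by
    rw [Measure.volume_eq_prod, measureReal_prod_prod]
    have h1 := Measure.addHaar_real_closedBall (volume : Measure (EuclideanSpace ℝ (Fin d))) w.1
      (r := 2 / r) (by positivity)
    rw [h1, Real.volume_real_closedBall (by positivity), finrank_euclideanSpace, Fintype.card_fin, ← hc, div_pow]
    field_simp
    ring
  have hfin : volume S < ⊤ := by
    rw [Measure.volume_eq_prod, Measure.prod_prod]
    exact ENNReal.mul_lt_top measure_closedBall_lt_top measure_closedBall_lt_top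
  rw [← setIntegral_eq_integral_of_forall_compl_eq_zero hS]
  have h2 := norm_setIntegral_le_of_norm_le_const (f := f) (C := M) hfin (fun z _ => hf z)
  rw [hvol] at h2
  refine h2.trans (le_of_eq ?_)
  ring

theorem iterLine_eq_zero_of_open {V : Type*} [NormedAddCommGroup V] [NormedSpace ℝ V] {U : Set V}
    (hU : IsOpen U) {f : V → ℝ} (hf : ∀ x ∈ U, f x = 0) (vs : List V) :
    ∀ x ∈ U, iterLine vs f x = 0 := by
  induction vs with
  | nil => exact hf
  | cons v vs ih =>
    intro x hx
    rw [iterLine_cons]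
    have h1 : iterLine vs f =ᶠ[nhds x] fun _ => 0 :=
      Filter.mem_of_superset (hU.mem_nhds hx) ih
    simp only
    rw [h1.lineDeriv_eq]
    simp [lineDeriv]

theorem continuous_parNorm : Continuous (parNorm (d := d)) := by
  unfold parNorm
  fun_prop

theorem continuous_monomial (k : MultiIndex d) : Continuous fun z : SpaceTime d => monomial z k := by
  refine continuous_finsetProd _ fun j _ => Continuous.pow ?_ _
  refine Fin.lastCases ?_ (fun i => ?_) j
  · simpa [coord] using continuous_snd
  · simp only [coord, Fin.lastCases_castSucc]
    exact (EuclideanSpace.proj i).continuous.comp continuous_fst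

theorem continuous_monomial_sub (w : SpaceTime d) (k : MultiIndex d) :
    Continuous fun z : SpaceTime d => monomial (z - w) k :=
  (continuous_monomial k).comp (continuous_id.sub continuous_const)

theorem integrable_mul_of_eq_zero {g f : SpaceTime d → ℝ} (hg : Continuous g) (hf : Continuous f)
    {w : SpaceTime d} (h0 : ∀ z ∉ Metric.closedBall w 4, f z = 0) :
    Integrable fun z => g z * f z :=
  (hg.mul hf).integrable_of_hasCompactSupport
    (HasCompactSupport.intro (isCompact_closedBall w 4) fun z hz => by rw [Pi.mul_apply, h0 z hz, mul_zero])

theorem integral_monomial_mul_lineDeriv {f f' : SpaceTime d → ℝ} (hf : Continuous f)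
    (hf' : Continuous f') {w : SpaceTime d} (h0 : ∀ z ∉ Metric.closedBall w 4, f z = 0)
    (h0' : ∀ z ∉ Metric.closedBall w 4, f' z = 0) {j : Fin (d + 1)}
    (hd : ∀ z, HasLineDerivAt ℝ f (f' z) z (unit j)) (k : MultiIndex d) :
    ∫ z, monomial (z - w) k * f' z =
      -(k j * ∫ z, monomial (z - w) (k - Pi.single j 1) * f z) := by
  have : (volume : Measure (SpaceTime d)).IsAddHaarMeasure := by
    rw [Measure.volume_eq_prod]
    infer_instance
  have h1 := integral_bilinear_hasLineDerivAt_right_eq_neg_left_of_integrable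
    (μ := (volume : Measure (SpaceTime d)))
    (B := ContinuousLinearMap.mul ℝ ℝ) (v := unit (d := d) j)
    (f := fun z : SpaceTime d => monomial (z - w) k)
    (f' := fun z => k j * monomial (z - w) (k - Pi.single j 1)) (g := f) (g' := f')
    (integrable_mul_of_eq_zero (continuous_const.mul (continuous_monomial_sub w _)) hf h0)
    (integrable_mul_of_eq_zero (continuous_monomial_sub w k) hf' h0')
    (integrable_mul_of_eq_zero (continuous_monomial_sub w k) hf h0)
    (fun z _ => by
      have h2 := hasDerivAt_monomial (z - w) j k
      unfold HasLineDerivAt at h2 ⊢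
      have e : ∀ t : ℝ, z + t • unit j - w = z - w + t • unit j := fun t => by abel
      simpa only [e] using h2)
    (fun z _ => hd z)
  simp only [ContinuousLinearMap.mul_apply'] at h1
  rw [h1, ← integral_const_mul]
  simp only [mul_assoc]

/-- The moments of the derivatives in the second variable. A derivative in the second variable is
a derivative along the diagonal, which costs nothing, minus a derivative in the first variable,
which integration by parts moves to the monomial. -/
theorem exists_moment_const (d n : ℕ) (k : MultiIndex d) : ∃ C : ℝ, 0 ≤ C ∧
    ∀ {N : ℕ} {r B : ℝ} {G : SpaceTime d × SpaceTime d → ℝ}, 1 ≤ r → IsScaleKernel N r B G →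
    ∀ (vs us : List (Fin (d + 1))), vs.length = n → vs.length + us.length ≤ N →
    ∀ w : SpaceTime d,
      |∫ z, monomial (z - w) k * iterLine ((vs.map fun j => ((0 : SpaceTime d), unit (d := d) j)) ++
        us.map fun j => (unit j, unit j)) G (z, w)| ≤ C * B / r ^ 2 := by
  have hsupp : ∀ {N : ℕ} {r B : ℝ} {G : SpaceTime d × SpaceTime d → ℝ}, 1 ≤ r →
      IsScaleKernel N r B G → ∀ (l : List (SpaceTime d × SpaceTime d)) (z w : SpaceTime d),
        2 < r * parNorm (z - w) → iterLine l G (z, w) = 0 := by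
    intro N r B G hr hG l z w h
    have hU : IsOpen {p : SpaceTime d × SpaceTime d | 2 < r * parNorm (p.1 - p.2)} :=
      isOpen_lt continuous_const
        (continuous_const.mul (continuous_parNorm.comp (continuous_fst.sub continuous_snd)))
    exact iterLine_eq_zero_of_open hU
      (fun p hp => hG.eq_zero (zero_le_one.trans hr) hp) l (z, w) h
  induction n generalizing k with
  | zero =>
    obtain ⟨C, hC, h⟩ := measure_parNorm_ball_le d
    refine ⟨C * 2 ^ deg k, by positivity, ?_⟩
    intro N r B G hr hG vs us hvs hus w
    obtain rfl := List.eq_nil_of_length_eq_zero hvs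
    have hr0 : 0 < r := zero_lt_one.trans_le hr
    have hB := hG.nonneg
    have h1 : ∀ z, |iterLine (us.map fun j => (unit (d := d) j, unit (d := d) j)) G (z, w)|
        ≤ r ^ d * B := by
      intro z
      have := hG.abs_iterLine_diag_le hr0.le (us.map (unit (d := d))) (by simpa using hus) (by
        intro u hu
        obtain ⟨j, _, rfl⟩ := List.mem_map.mp hu
        exact norm_unit_le j) (z, w)
      rwa [List.map_map] at this
    refine (h hr0 w (M := 2 ^ deg k * (r ^ d * B)) (by positivity) ?_ ?_).trans (le_of_eq ?_)
    · intro z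
      simp only [List.map_nil, List.nil_append]
      rcases lt_or_ge 2 (r * parNorm (z - w)) with h2 | h2
      · rw [hsupp hr hG _ z w h2, mul_zero, abs_zero]
        positivity
      · rw [abs_mul]
        refine mul_le_mul ?_ (h1 z) (abs_nonneg _) (by positivity)
        refine (abs_monomial_le _ _).trans (pow_le_pow_left₀ (parNorm_nonneg _) ?_ _)
        exact (le_mul_of_one_le_left (parNorm_nonneg _) hr).trans h2
    · intro z hz
      rw [hsupp hr hG _ z w hz, mul_zero]
    · rw [pow_add]
      field_simp
  | succ n ih =>
    choose C hC0 hC using ih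
    refine ⟨C k + ∑ j, k j * C (k - Pi.single j 1), ?_, ?_⟩
    · exact add_nonneg (hC0 k) (Finset.sum_nonneg fun j _ => mul_nonneg (Nat.cast_nonneg _) (hC0 _))
    intro N r B G hr hG vs us hvs hus w
    obtain ⟨j, vs, rfl⟩ := List.exists_cons_of_length_eq_add_one hvs
    simp only [List.length_cons] at hvs hus
    set l := (vs.map fun j => ((0 : SpaceTime d), unit (d := d) j)) ++
        us.map fun j => (unit j, unit j) with hl
    have hlen : l.length + 1 ≤ N := by simp [hl]; omega
    have hball : ∀ (l : List (SpaceTime d × SpaceTime d)), ∀ z ∉ Metric.closedBall w 4,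
        iterLine l G (z, w) = 0 := by
      intro l z hz
      refine hsupp hr hG l z w ?_
      rw [Metric.mem_closedBall, dist_eq_norm, not_le] at hz
      refine lt_of_lt_of_le ?_ (le_mul_of_one_le_left (parNorm_nonneg _) hr)
      rw [Prod.norm_def, lt_max_iff] at hz
      rcases hz with hz | hz
      · exact lt_of_lt_of_le (by linarith) (le_max_left _ _)
      · refine lt_of_lt_of_le ?_ (le_max_right _ _)
        rw [Real.norm_eq_abs] at hz
        exact Real.lt_sqrt_of_sq_lt (by norm_num; exact hz)
    have hcont : ∀ l' : List (SpaceTime d × SpaceTime d), l'.length ≤ N →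
        Continuous fun z => iterLine l' G (z, w) := by
      intro l' hl'
      have hc1 : ContDiff ℝ (0 : ℕ) (iterLine l' G) := contDiff_iterLine hG.contDiff l' (by simpa)
      exact hc1.continuous.comp (continuous_id.prodMk continuous_const)
    have hHd : Differentiable ℝ (iterLine l G) :=
      (contDiff_iterLine hG.contDiff l (m := 1) hlen).differentiable (by norm_num)
    have hlin : ∀ z, iterLine (((0 : SpaceTime d), unit (d := d) j) :: l) G (z, w) =
        iterLine ((unit j, unit j) :: l) G (z, w) - iterLine ((unit j, 0) :: l) G (z, w) := by
      intro z
      rw [iterLine_cons, iterLine_cons, iterLine_cons]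
      simp only
      rw [(hHd _).lineDeriv_eq_fderiv, (hHd _).lineDeriv_eq_fderiv, (hHd _).lineDeriv_eq_fderiv,
        ← map_sub]
      simp
    have hline : ∀ z, HasLineDerivAt ℝ (fun z => iterLine l G (z, w))
        (iterLine ((unit j, 0) :: l) G (z, w)) z (unit j) := by
      intro z
      have h2 := (hHd (z, w)).lineDifferentiableAt (v := (unit (d := d) j, (0 : SpaceTime d)))
      have h3 := h2.hasLineDerivAt
      unfold HasLineDerivAt at h3 ⊢
      have e : ∀ t : ℝ, (z, w) + t • (unit (d := d) j, (0 : SpaceTime d)) = (z + t • unit j, w) :=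
        fun t => by simp
      simp only [e] at h3
      exact h3
    have hpart := integral_monomial_mul_lineDeriv (hcont l (by omega))
      (hcont ((unit j, 0) :: l) (by simpa using hlen)) (hball _) (hball _) hline k
    have hperm : iterLine ((unit (d := d) j, unit (d := d) j) :: l) G =
        iterLine ((vs.map fun j => ((0 : SpaceTime d), unit (d := d) j)) ++
          (j :: us).map fun j => (unit j, unit j)) G := by
      refine iterLine_perm hG.contDiff ?_ (by simpa using hlen)
      rw [hl, List.map_cons]
      exact List.perm_middle.symm
    have hint1 := integrable_mul_of_eq_zero (continuous_monomial_sub w k)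
      (hcont ((unit j, unit j) :: l) (by simpa using hlen)) (hball _)
    have hint2 := integrable_mul_of_eq_zero (continuous_monomial_sub w k)
      (hcont ((unit j, 0) :: l) (by simpa using hlen)) (hball _)
    have e : ∫ z, monomial (z - w) k *
        iterLine (((j :: vs).map fun j => ((0 : SpaceTime d), unit (d := d) j)) ++
          us.map fun j => (unit j, unit j)) G (z, w) =
        (∫ z, monomial (z - w) k * iterLine ((vs.map fun j => ((0 : SpaceTime d), unit (d := d) j)) ++
          (j :: us).map fun j => (unit j, unit j)) G (z, w)) +
        k j * ∫ z, monomial (z - w) (k - Pi.single j 1) * iterLine l G (z, w) := by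
      change ∫ z, monomial (z - w) k * iterLine (((0 : SpaceTime d), unit (d := d) j) :: l) G (z, w)
        = _
      simp only [hlin, mul_sub]
      rw [integral_sub hint1 hint2, hpart, sub_neg_eq_add, hperm]
    rw [e]
    have hB := hG.nonneg
    have h1 := hC k hr hG vs (j :: us) (by omega) (by simp; omega) w
    have h2 := hC (k - Pi.single j 1) hr hG vs us (by omega) (by omega) w
    refine (abs_add_le _ _).trans ?_
    rw [abs_mul, Nat.abs_cast, add_mul, add_div]
    refine add_le_add h1 ?_
    refine (mul_le_mul_of_nonneg_left h2 (Nat.cast_nonneg _)).trans ?_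
    have h3 := Finset.single_le_sum (f := fun j => (k j : ℝ) * C (k - Pi.single j 1))
      (fun j _ => mul_nonneg (Nat.cast_nonneg _) (hC0 _)) (Finset.mem_univ j)
    have hr0 : 0 < r := zero_lt_one.trans_le hr
    calc (k j : ℝ) * (C (k - Pi.single j 1) * B / r ^ 2)
        = (k j * C (k - Pi.single j 1)) * (B / r ^ 2) := by ring
      _ ≤ (∑ j, (k j : ℝ) * C (k - Pi.single j 1)) * (B / r ^ 2) := by gcongr
      _ = _ := by ring

end SpaceTime

/-! ### The kernel norm of a dyadic sum -/

namespace SpaceTime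

open MultiIndex SingularKernel

variable {d : ℕ}

theorem sum_le_of_mem_relevant {L R : ℝ} {k l : MultiIndex d} (h : (k, l) ∈ relevant d L R) :
    (∑ j, k j) + ∑ j, l j ≤ ⌈L⌉₊ + ⌈R⌉₊ + 1 := by
  have hb : ∀ {l : MultiIndex d}, l ∈ boundary d R → ∑ j, l j ≤ ⌈R⌉₊ + 1 := by
    rintro l ⟨_, m, hm, _, h⟩
    have h1 := sum_le_of_mem_below h
    rw [← sub_single_add_single hm, sum_add_single]
    omega
  rcases h with ⟨hk, hl | hl⟩ | ⟨hk, hl | hl⟩ <;> simp only at hk hl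
  · have := sum_le_of_mem_below hk
    have := sum_le_of_mem_below hl
    omega
  · have := sum_le_of_mem_below hk
    simp [hl]
    omega
  · have := sum_le_of_mem_below hl
    simp [hk]
    omega
  · have := hb hl
    simp [hk]
    omega

theorem hasPartials_of_contDiff {N : ℕ} {L R : ℝ} (hN : ⌈L⌉₊ + ⌈R⌉₊ + 1 ≤ N)
    {G : SpaceTime d × SpaceTime d → ℝ} (hG : ContDiff ℝ N G) :
    HasPartials L R fun z w => G (z, w) where
  continuous k l h := (contDiff_D₁₂ (m := 0) hG k l
    (by have := sum_le_of_mem_relevant h; omega)).continuous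
  fst k l j h z w := by
    have h1 := sum_le_of_mem_relevant h
    rw [sum_add_single] at h1
    have h2 := contDiff_D₁₂ (m := 1) hG k l (by omega)
    exact ((h2.comp (contDiff_id.prodMk contDiff_const)).differentiable
      (by norm_num) z).lineDifferentiableAt
  snd k l j h z w := by
    have h1 := sum_le_of_mem_relevant h
    rw [sum_add_single] at h1
    have h2 := contDiff_D₁₂ (m := 1) hG k l (by omega)
    exact ((h2.comp (contDiff_const.prodMk contDiff_id)).differentiable
      (by norm_num) w).lineDifferentiableAt

theorem contDiff_D₁₂_fst {N m : ℕ} {G : SpaceTime d × SpaceTime d → ℝ} (hG : ContDiff ℝ N G)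
    (k l : MultiIndex d) (hkl : (∑ j, k j) + (∑ j, l j) + m ≤ N) (w : SpaceTime d) :
    ContDiff ℝ m fun y => D₁₂ k l (fun z w => G (z, w)) y w :=
  (contDiff_D₁₂ hG k l hkl).comp (contDiff_id.prodMk contDiff_const)

theorem contDiff_D₁₂_snd {N m : ℕ} {G : SpaceTime d × SpaceTime d → ℝ} (hG : ContDiff ℝ N G)
    (k l : MultiIndex d) (hkl : (∑ j, k j) + (∑ j, l j) + m ≤ N) (z : SpaceTime d) :
    ContDiff ℝ m fun y => D₁₂ k l (fun z w => G (z, w)) z y :=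
  (contDiff_D₁₂ hG k l hkl).comp (contDiff_const.prodMk contDiff_id)

section

variable {N : ℕ} {r B L R : ℝ} {G : SpaceTime d × SpaceTime d → ℝ}

theorem abs_taylor_snd_le {CR : ℝ} (hCR : ∀ {r : ℝ}, 0 ≤ r → ∀ {f : SpaceTime d → ℝ},
      ContDiff ℝ ⌈R⌉₊ f → ∀ {M : ℝ},
      (∀ k : MultiIndex d, ∑ j, k j ≤ ⌈R⌉₊ → ∀ y, |D k f y| ≤ M * r ^ deg k) →
      ∀ z₀ z : SpaceTime d, |f z - taylor R f z₀ z| ≤ CR * M * (r * parNorm (z - z₀)) ^ R)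
    (hr : 1 ≤ r) (hG : IsScaleKernel N r B G) (k : MultiIndex d)
    (hk : (∑ j, k j) + ⌈R⌉₊ ≤ N) (z w w₀ : SpaceTime d) :
    |D₁₂ k 0 (fun z w => G (z, w)) z w -
        taylor R (fun y => D₁₂ k 0 (fun z w => G (z, w)) z y) w₀ w| ≤
      CR * (r ^ d * B * r ^ deg k) * (r * parNorm (w - w₀)) ^ R := by
  refine hCR (zero_le_one.trans hr) (contDiff_D₁₂_snd hG.contDiff k 0 (by simpa using hk) z)
    (fun l hl y => ?_) w₀ w
  rw [D_D₁₂_comm hG.contDiff k l (by omega)]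
  refine (hG.abs_D₁₂_le hr k l (by omega) z y).trans (le_of_eq ?_)
  rw [pow_add]
  ring

theorem abs_taylor_fst_le {CL : ℝ} (hCL : ∀ {r : ℝ}, 0 ≤ r → ∀ {f : SpaceTime d → ℝ},
      ContDiff ℝ ⌈L⌉₊ f → ∀ {M : ℝ},
      (∀ k : MultiIndex d, ∑ j, k j ≤ ⌈L⌉₊ → ∀ y, |D k f y| ≤ M * r ^ deg k) →
      ∀ z₀ z : SpaceTime d, |f z - taylor L f z₀ z| ≤ CL * M * (r * parNorm (z - z₀)) ^ L)
    (hr : 1 ≤ r) (hG : IsScaleKernel N r B G) (l : MultiIndex d)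
    (hl : (∑ j, l j) + ⌈L⌉₊ ≤ N) (z w z₀ : SpaceTime d) :
    |D₁₂ 0 l (fun z w => G (z, w)) z w -
        taylor L (fun y => D₁₂ 0 l (fun z w => G (z, w)) y w) z₀ z| ≤
      CL * (r ^ d * B * r ^ deg l) * (r * parNorm (z - z₀)) ^ L := by
  refine hCL (zero_le_one.trans hr) (contDiff_D₁₂_fst hG.contDiff 0 l (by simpa using hl) w)
    (fun k hk y => ?_) z₀ z
  rw [D_D₁₂_left]
  refine (hG.abs_D₁₂_le hr k l (by omega) y w).trans (le_of_eq ?_)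
  rw [pow_add]
  ring

/-- The mixed remainder is the remainder in the first variable of the remainder in the second. -/
theorem abs_taylor_both_le {CL CR : ℝ} (hCL : ∀ {r : ℝ}, 0 ≤ r → ∀ {f : SpaceTime d → ℝ},
      ContDiff ℝ ⌈L⌉₊ f → ∀ {M : ℝ},
      (∀ k : MultiIndex d, ∑ j, k j ≤ ⌈L⌉₊ → ∀ y, |D k f y| ≤ M * r ^ deg k) →
      ∀ z₀ z : SpaceTime d, |f z - taylor L f z₀ z| ≤ CL * M * (r * parNorm (z - z₀)) ^ L)
    (hCR : ∀ {r : ℝ}, 0 ≤ r → ∀ {f : SpaceTime d → ℝ},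
      ContDiff ℝ ⌈R⌉₊ f → ∀ {M : ℝ},
      (∀ k : MultiIndex d, ∑ j, k j ≤ ⌈R⌉₊ → ∀ y, |D k f y| ≤ M * r ^ deg k) →
      ∀ z₀ z : SpaceTime d, |f z - taylor R f z₀ z| ≤ CR * M * (r * parNorm (z - z₀)) ^ R)
    (hr : 1 ≤ r) (hG : IsScaleKernel N r B G) (hN : ⌈L⌉₊ + ⌈R⌉₊ ≤ N) (z w z₀ w₀ : SpaceTime d) :
    |G (z, w) - taylor L (fun y => G (y, w)) z₀ z - taylor R (fun y => G (z, y)) w₀ w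
        + taylor₂ L R (fun z w => G (z, w)) z₀ w₀ z w| ≤
      CL * (CR * (r ^ d * B) * (r * parNorm (w - w₀)) ^ R) * (r * parNorm (z - z₀)) ^ L := by
  set K : SpaceTime d → SpaceTime d → ℝ := fun z w => G (z, w) with hK
  have hG' := hG.contDiff
  set g : SpaceTime d → ℝ := fun y => K y w - ∑ l ∈ below d R,
    D₁₂ 0 l K y w₀ * ((fact l : ℝ)⁻¹ * monomial (w - w₀) l) with hg
  have hgt : ∀ y, g y = K y w - taylor R (K y) w₀ w := by
    intro y
    simp only [hg, taylor, D₁₂, D_zero, div_eq_mul_inv, mul_assoc]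
  have hDc : ∀ l ∈ below d R, ContDiff ℝ ⌈L⌉₊ fun y => D₁₂ 0 l K y w₀ := fun l hl =>
    contDiff_D₁₂_fst hG' 0 l (by
      have := sum_le_of_mem_below hl
      simp only [Pi.zero_apply, Finset.sum_const_zero]
      omega) w₀
  have hKc : ContDiff ℝ ⌈L⌉₊ fun y => K y w :=
    (hG'.comp (contDiff_id.prodMk contDiff_const)).of_le (by exact_mod_cast (by omega))
  have hDg : ∀ k : MultiIndex d, ∑ j, k j ≤ ⌈L⌉₊ → ∀ y, D k g y =
      D₁₂ k 0 K y w - ∑ l ∈ below d R,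
        D₁₂ k l K y w₀ * ((fact l : ℝ)⁻¹ * monomial (w - w₀) l) := by
    intro k hk y
    rw [D_eq_iterLine, hg, iterLine_sub_sum _ _ hKc hDc _ (by rw [length_dirs]; exact hk),
      ← D_eq_iterLine]
    congr 1
    · rw [D₁₂]
      simp only [D_zero]
    · refine Finset.sum_congr rfl fun l _ => ?_
      rw [← D_eq_iterLine, D_D₁₂_left]
  have hgc : ContDiff ℝ ⌈L⌉₊ g := hKc.sub (ContDiff.sum fun l hl => (hDc l hl).mul contDiff_const)
  have h1 := hCL (zero_le_one.trans hr) hgc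
    (M := CR * (r ^ d * B) * (r * parNorm (w - w₀)) ^ R) (fun k hk y => by
      have h2 := abs_taylor_snd_le hCR hr hG k (by omega) y w w₀
      rw [hDg k hk y]
      have e : taylor R (fun y' => D₁₂ k 0 (fun z w => G (z, w)) y y') w₀ w =
          ∑ l ∈ below d R, D₁₂ k l K y w₀ * ((fact l : ℝ)⁻¹ * monomial (w - w₀) l) := by
        unfold taylor
        refine Finset.sum_congr rfl fun l hl => ?_
        rw [D_D₁₂_comm hG' k l (by have := sum_le_of_mem_below hl; omega), div_eq_mul_inv,
          mul_assoc]
      rw [e] at h2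
      refine h2.trans (le_of_eq ?_)
      ring) z₀ z
  refine le_trans (le_of_eq ?_) h1
  congr 1
  have e : taylor L g z₀ z = taylor L (fun y => K y w) z₀ z - taylor₂ L R K z₀ w₀ z w := by
    unfold taylor taylor₂
    rw [← Finset.sum_sub_distrib]
    refine Finset.sum_congr rfl fun k hk => ?_
    rw [hDg k (sum_le_of_mem_below hk) z₀]
    have : D k (fun y => K y w) z₀ = D₁₂ k 0 K z₀ w := by simp only [D₁₂, D_zero]
    rw [this, sub_div, sub_mul, Finset.sum_div, Finset.sum_mul]
    congr 1
    refine Finset.sum_congr rfl fun l _ => ?_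
    have := (zero_lt_one.trans_le (one_le_fact k)).ne'
    have := (zero_lt_one.trans_le (one_le_fact l)).ne'
    field_simp
  rw [e, hgt z]
  ring

end

theorem two_pow_rpow (x : ℝ) (n : ℕ) : (2 : ℝ) ^ (x * n) = ((2 : ℝ) ^ n) ^ x := by
  rw [mul_comm, Real.rpow_mul (by norm_num), Real.rpow_natCast]

/-- A sequence of kernels on the scales `2 ^ (-n)` satisfies the bounds of the kernel norm, for
every order `β ≤ 2`. -/
theorem exists_bounds_const (d : ℕ) (L R : ℝ) (hL : 0 ≤ L) (hR : 0 ≤ R) : ∃ (N : ℕ) (C : ℝ≥0),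
    ∀ (B : ℝ≥0) (Kn : ℕ → SpaceTime d → SpaceTime d → ℝ),
      (∀ n, IsScaleKernel N (2 ^ n) B fun p => Kn n p.1 p.2) →
      ∀ β ≤ 2, Bounds β L R (C * B) Kn := by
  obtain ⟨CL, hCL0, hCL⟩ := exists_taylor_const d L hL
  obtain ⟨CR, hCR0, hCR⟩ := exists_taylor_const d R hR
  choose Cm hCm0 hCm using exists_moment_const d
  set N := ⌈L⌉₊ + ⌈R⌉₊ + 1 with hN
  set c : ℝ := 1 + CL + CR + CL * CR +
    ∑ n ∈ Finset.range (N + 1), ∑ k ∈ below d R, Cm n k with hc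
  have hsum0 : 0 ≤ ∑ n ∈ Finset.range (N + 1), ∑ k ∈ below d R, Cm n k :=
    Finset.sum_nonneg fun n _ => Finset.sum_nonneg fun k _ => hCm0 n k
  have hCLR : 0 ≤ CL * CR := mul_nonneg hCL0 hCR0
  have hc0 : 0 ≤ c := by rw [hc]; linarith
  obtain ⟨c', hc'⟩ : ∃ c' : ℝ≥0, (c' : ℝ) = c := ⟨⟨c, hc0⟩, rfl⟩
  refine ⟨N, c', ?_⟩
  intro B Kn hK β hβ
  have hr : ∀ n : ℕ, (1 : ℝ) ≤ 2 ^ n := fun n => one_le_pow₀ (by norm_num)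
  have hB : (0 : ℝ) ≤ B := B.2
  have hcoe : ((c' * B : ℝ≥0) : ℝ) = c * B := by rw [NNReal.coe_mul, hc']
  -- The exponents are compared by `|𝔰| - β ≥ d`.
  have hpow : ∀ (n a : ℕ) (x : ℝ), (d : ℝ) + a ≤ x → ((2 : ℝ) ^ n) ^ d * (2 ^ n) ^ a ≤ 2 ^ (x * n) := by
    intro n a x hx
    rw [two_pow_rpow, ← pow_add, ← Real.rpow_natCast ((2 : ℝ) ^ n) (d + a)]
    exact Real.rpow_le_rpow_of_exponent_le (hr n) (by push_cast; exact hx)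
  have hpow' : ∀ (n a : ℕ) (x ρ : ℝ), (d : ℝ) + a + ρ ≤ x →
      ((2 : ℝ) ^ n) ^ d * (2 ^ n) ^ a * (2 ^ n) ^ ρ ≤ 2 ^ (x * n) := by
    intro n a x ρ hx
    have h0 : (0 : ℝ) < 2 ^ n := by positivity
    rw [two_pow_rpow, ← pow_add, ← Real.rpow_natCast ((2 : ℝ) ^ n) (d + a), ← Real.rpow_add h0]
    exact Real.rpow_le_rpow_of_exponent_le (hr n) (by push_cast; exact hx)
  refine ⟨fun n => ?_, ?_, ?_, ?_, ?_, ?_⟩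
  · exact hasPartials_of_contDiff le_rfl (hK n).contDiff
  · intro n k hk l hl z w
    have h1 := (hK n).abs_D₁₂_le (hr n) k l (by
      have := sum_le_of_mem_below hk
      have := sum_le_of_mem_below hl
      omega) z w
    refine h1.trans ?_
    have h2 := hpow n (deg k + deg l) ((d : ℝ) + 2 - β + deg k + deg l) (by push_cast; linarith)
    rw [hcoe]
    calc _ = B * (((2 : ℝ) ^ n) ^ d * (2 ^ n) ^ (deg k + deg l)) := by ring
      _ ≤ B * 2 ^ (((d : ℝ) + 2 - β + deg k + deg l) * n) := by gcongr
      _ ≤ _ := by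
        gcongr
        exact le_mul_of_one_le_left hB (by rw [hc]; linarith)
  · intro n k hk z w w₀
    have h1 := abs_taylor_snd_le hCR (hr n) (hK n) k (by
      have := sum_le_of_mem_below hk
      omega) z w w₀
    refine h1.trans ?_
    have h2 := hpow' n (deg k) ((d : ℝ) + 2 - β + deg k + R) R (by linarith)
    rw [hcoe, Real.mul_rpow (by positivity) (parNorm_nonneg _)]
    have h3 : 0 ≤ parNorm (w - w₀) ^ R := Real.rpow_nonneg (parNorm_nonneg _) _
    calc _ = CR * B * (((2 : ℝ) ^ n) ^ d * (2 ^ n) ^ deg k * (2 ^ n) ^ R) *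
              parNorm (w - w₀) ^ R := by ring
      _ ≤ c * B * (2 : ℝ) ^ (((d : ℝ) + 2 - β + deg k + R) * n) * parNorm (w - w₀) ^ R := by
        gcongr
        rw [hc]; linarith
  · intro n l hl z w z₀
    have h1 := abs_taylor_fst_le hCL (hr n) (hK n) l (by
      have := sum_le_of_mem_below hl
      omega) z w z₀
    refine h1.trans ?_
    have h2 := hpow' n (deg l) ((d : ℝ) + 2 - β + deg l + L) L (by linarith)
    rw [hcoe, Real.mul_rpow (by positivity) (parNorm_nonneg _)]
    have h3 : 0 ≤ parNorm (z - z₀) ^ L := Real.rpow_nonneg (parNorm_nonneg _) _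
    calc _ = CL * B * (((2 : ℝ) ^ n) ^ d * (2 ^ n) ^ deg l * (2 ^ n) ^ L) *
              parNorm (z - z₀) ^ L := by ring
      _ ≤ c * B * (2 : ℝ) ^ (((d : ℝ) + 2 - β + deg l + L) * n) * parNorm (z - z₀) ^ L := by
        gcongr
        rw [hc]; linarith
  · intro n z w z₀ w₀
    have h1 := abs_taylor_both_le hCL hCR (hr n) (hK n) (by omega) z w z₀ w₀
    refine h1.trans ?_
    have h2 := hpow' n 0 ((d : ℝ) + 2 - β + L + R) (L + R) (by push_cast; linarith)
    rw [Real.rpow_add (by positivity)] at h2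
    rw [hcoe, Real.mul_rpow (by positivity) (parNorm_nonneg _),
      Real.mul_rpow (by positivity) (parNorm_nonneg _)]
    have h3 : 0 ≤ parNorm (z - z₀) ^ L := Real.rpow_nonneg (parNorm_nonneg _) _
    have h4 : 0 ≤ parNorm (w - w₀) ^ R := Real.rpow_nonneg (parNorm_nonneg _) _
    calc _ = CL * CR * B * (((2 : ℝ) ^ n) ^ d * (2 ^ n) ^ 0 * ((2 ^ n) ^ L * (2 ^ n) ^ R)) *
              parNorm (z - z₀) ^ L * parNorm (w - w₀) ^ R := by ring
      _ ≤ c * B * (2 : ℝ) ^ (((d : ℝ) + 2 - β + L + R) * n) * parNorm (z - z₀) ^ L *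
            parNorm (w - w₀) ^ R := by
        gcongr
        rw [hc]; linarith
  · intro n k hk l hl w
    have hlN : ∑ j, l j ≤ N := by
      have := sum_le_of_mem_relevant (d := d) (L := L) (R := R) (k := 0) (l := l)
        (Or.inr ⟨rfl, hl⟩)
      simp only [Pi.zero_apply, Finset.sum_const_zero, zero_add] at this
      omega
    set vs : List (Fin (d + 1)) := (List.finRange (d + 1)).flatMap fun j => List.replicate (l j) j
      with hvs
    have hvsd : dirs l = vs.map (unit (d := d)) := by
      rw [dirs, hvs, List.map_flatMap]
      simp
    have hlen : vs.length = ∑ j, l j := by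
      rw [← length_dirs, hvsd, List.length_map]
    have h1 := hCm vs.length k (hr n) (hK n) vs [] rfl (by simp; omega) w
    simp only [List.map_nil, List.append_nil] at h1
    have e : ∀ z, D₁₂ 0 l (Kn n) z w =
        iterLine (vs.map fun j => ((0 : SpaceTime d), unit (d := d) j))
          (fun p => Kn n p.1 p.2) (z, w) := by
      intro z
      have := D₁₂_eq_iterLine 0 l (fun p : SpaceTime d × SpaceTime d => Kn n p.1 p.2) z w
      rw [dirs₂, dirs_zero, hvsd, List.map_nil, List.nil_append, List.map_map] at this
      exact this
    simp only [e]
    refine h1.trans ?_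
    have h2 : Cm vs.length k ≤ c := by
      have h3 : Cm vs.length k ≤ ∑ k ∈ below d R, Cm vs.length k :=
        Finset.single_le_sum (f := fun k => Cm vs.length k) (fun k _ => hCm0 _ k) hk
      have h4 := Finset.single_le_sum (f := fun n => ∑ k ∈ below d R, Cm n k)
        (s := Finset.range (N + 1)) (a := vs.length)
        (fun n _ => Finset.sum_nonneg fun k _ => hCm0 n k) (Finset.mem_range.mpr (by omega))
      rw [hc]
      linarith
    have h5 : ((((2 : ℝ) ^ n) ^ 2)⁻¹) ≤ 2 ^ (-β * n) := by
      rw [two_pow_rpow, ← Real.rpow_natCast, ← Real.rpow_neg (by positivity)]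
      exact Real.rpow_le_rpow_of_exponent_le (hr n) (by push_cast; linarith)
    rw [hcoe, div_eq_mul_inv]
    gcongr

theorem norm_le_of_scaleKernels {β L R : ℝ} {N : ℕ} {C : ℝ≥0}
    (hC : ∀ (B : ℝ≥0) (Kn : ℕ → SpaceTime d → SpaceTime d → ℝ),
      (∀ n, IsScaleKernel N (2 ^ n) B fun p => Kn n p.1 p.2) →
      ∀ β ≤ 2, Bounds β L R (C * B) Kn) (hβ : β ≤ 2) {B : ℝ≥0}
    {K : SpaceTime d → SpaceTime d → ℝ} {Kn : ℕ → SpaceTime d → SpaceTime d → ℝ}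
    (hK : ∀ n, IsScaleKernel N (2 ^ n) B fun p => Kn n p.1 p.2)
    (hsum : ∀ z w, z ≠ w → HasSum (fun n => Kn n z w) (K z w)) :
    SingularKernel.norm β L R K ≤ C * B := by
  refine (iInf₂_le (C * B) ⟨Kn, ⟨hsum, fun n z w h => ?_⟩, hC B Kn hK β hβ⟩).trans ?_
  · rw [ENNReal.coe_mul]
  · refine (hK n).eq_zero (by positivity) ?_
    rw [Real.rpow_sub (by norm_num), Real.rpow_one, Real.rpow_natCast,
      div_lt_iff₀ (by positivity)] at h
    linarith

end SpaceTime

/-! ### Composition of parabolically scaled kernels -/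

namespace SpaceTime

variable {d : ℕ}

/-- The first argument after the rotation by `θ` of the pair of `p` and `(ζ, 0)`. -/
def rotOuter (θ : ℝ) (ζ : EuclideanSpace ℝ (Fin d)) (p : SpaceTime d) : SpaceTime d :=
  (Real.cos θ • p.1 - Real.sin θ • ζ, Real.cos θ * p.2)

/-- The second argument after the rotation by `θ` of the pair of `p` and `(ζ, 0)`. -/
def rotInner (θ : ℝ) (ζ : EuclideanSpace ℝ (Fin d)) (p : SpaceTime d) : SpaceTime d :=
  (Real.sin θ • p.1 + Real.cos θ • ζ, Real.sin θ * p.2)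

/-- The point at the parabolically rescaled displacement `p = (ξ, s)`, that is `(s ξ, s²)`,
from `w`. -/
def shift (w p : SpaceTime d) : SpaceTime d := w + p.2 • p

/-- `E(z; w) = s^{m-d-2} e^{s²} e(x/s, s; w)`, where `(x, s²) = z - w`: the kernel `E` has the
profile `e` and the order `m`. The order is two for a kernel as singular as the fundamental solution,
and the orders add up under composition. The factor `e^{s²}` allows profiles that decay in `s`. -/
def IsScaled (m : ℕ) (E : SpaceTime d → SpaceTime d → ℝ) (e : SpaceTime d → SpaceTime d → ℝ) :
    Prop :=
  ∀ (w p : SpaceTime d), 0 < p.2 →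
    E (shift w p) w = p.2 ^ m / p.2 ^ (d + 2) * Real.exp (p.2 ^ 2) * e p w

/-- The profile of the space-time composition of two kernels, in terms of their profiles. -/
def composeProfile (c : ℝ → ℝ) (e₁ e₂ : SpaceTime d → SpaceTime d → ℝ) (p w : SpaceTime d) : ℝ :=
  ∫ θ in Set.Ioo 0 (Real.pi / 2), ∫ ζ : EuclideanSpace ℝ (Fin d),
    c θ * (e₁ (rotOuter θ ζ p) (shift w (rotInner θ ζ p)) * e₂ (rotInner θ ζ p) w)

theorem image_sin_sq {a s : ℝ} (hs : 0 < s) :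
    (fun θ => a + s ^ 2 * Real.sin θ ^ 2) '' Set.Ioo 0 (Real.pi / 2) = Set.Ioo a (a + s ^ 2) := by
  ext σ
  constructor
  · rintro ⟨θ, ⟨h0, h1⟩, rfl⟩
    have hs1 : 0 < Real.sin θ := Real.sin_pos_of_pos_of_lt_pi h0 (by linarith)
    have hc1 : 0 < Real.cos θ := Real.cos_pos_of_mem_Ioo ⟨by linarith, h1⟩
    have := Real.sin_sq_add_cos_sq θ
    have hs2 : 0 < s ^ 2 := by positivity
    have hs3 : 0 < Real.sin θ ^ 2 := by positivity
    have hc3 : 0 < Real.cos θ ^ 2 := by positivity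
    constructor
    · have : 0 < s ^ 2 * Real.sin θ ^ 2 := by positivity
      simp only
      linarith
    · simp only
      have : s ^ 2 * Real.sin θ ^ 2 < s ^ 2 * 1 := by
        apply mul_lt_mul_of_pos_left _ hs2
        linarith
      linarith
  · rintro ⟨h0, h1⟩
    have hs2 : 0 < s ^ 2 := by positivity
    set u := (σ - a) / s ^ 2 with hu
    have hu0 : 0 < u := div_pos (by linarith) hs2
    have hu1 : u < 1 := by rw [hu, div_lt_one hs2]; linarith
    have hq0 : 0 < Real.sqrt u := Real.sqrt_pos.mpr hu0
    have hq1 : Real.sqrt u < 1 := by rw [Real.sqrt_lt' one_pos]; simpa using hu1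
    refine ⟨Real.arcsin (Real.sqrt u), ⟨Real.arcsin_pos.mpr hq0,
      Real.arcsin_lt_pi_div_two.mpr hq1⟩, ?_⟩
    simp only
    rw [Real.sin_arcsin (by linarith) hq1.le, Real.sq_sqrt hu0.le, hu]
    field_simp
    ring

/-- Composition of kernels in scaled coordinates. With the intermediate time
`σ = τ + s² sin² θ` and the intermediate point on the Brownian bridge, the two profiles are
evaluated at the two components of a rotation, so that no singularity remains. -/
theorem IsScaled.comp {k₁ k₂ : ℕ} {E₁ E₂ e₁ e₂ : SpaceTime d → SpaceTime d → ℝ}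
    (h₁ : IsScaled (k₁ + 1) E₁ e₁) (h₂ : IsScaled (k₂ + 1) E₂ e₂) :
    IsScaled (k₁ + k₂ + 2) (fun z w => ∫ σ in w.2..z.2, ∫ η, E₁ z (η, σ) * E₂ (η, σ) w)
      (composeProfile (fun θ => 2 * (Real.cos θ ^ k₁ * Real.sin θ ^ k₂)) e₁ e₂) := by
  intro w p hp
  have hpi := Real.pi_pos
  obtain ⟨ξ, s⟩ := p
  simp only at hp
  have hz2 : (shift w (ξ, s)).2 = w.2 + s ^ 2 := by simp [shift, sq]
  simp only [hz2]
  rw [intervalIntegral.integral_of_le (by nlinarith), integral_Ioc_eq_integral_Ioo,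
    ← image_sin_sq hp, integral_image_eq_integral_abs_deriv_smul measurableSet_Ioo
      (f' := fun θ => s ^ 2 * (2 * Real.sin θ * Real.cos θ)) ?_ ?_]
  · rw [composeProfile, ← integral_const_mul]
    refine setIntegral_congr_fun measurableSet_Ioo fun θ hθ => ?_
    have hS : 0 < Real.sin θ := Real.sin_pos_of_pos_of_lt_pi hθ.1 (by linarith [hθ.2])
    have hC : 0 < Real.cos θ := Real.cos_pos_of_mem_Ioo ⟨by linarith [hθ.1], hθ.2⟩
    have hSC := Real.sin_sq_add_cos_sq θ
    set S := Real.sin θ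
    set C := Real.cos θ
    set F : EuclideanSpace ℝ (Fin d) → ℝ := fun η =>
      E₁ (shift w (ξ, s)) (η, w.2 + s ^ 2 * S ^ 2) * E₂ (η, w.2 + s ^ 2 * S ^ 2) w with hF
    -- The space variable is `η = w + s sin² θ ξ + s sin θ cos θ ζ`: mean and deviation of a bridge.
    have hsub : ∫ η, F η = (s * S * C) ^ d *
        ∫ ζ, F ((w.1 + (s * S ^ 2) • ξ) + (s * S * C) • ζ) := by
      have h3 := Measure.integral_comp_smul (volume : Measure (EuclideanSpace ℝ (Fin d)))
        (fun η => F ((w.1 + (s * S ^ 2) • ξ) + η)) (s * S * C)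
      rw [h3, integral_add_left_eq_self, finrank_euclideanSpace, Fintype.card_fin, smul_eq_mul,
        abs_of_pos (by positivity), ← mul_assoc, mul_inv_cancel₀ (by positivity), one_mul]
    rw [hsub, abs_of_pos (by positivity), smul_eq_mul, ← mul_assoc, ← integral_const_mul,
      ← integral_const_mul]
    refine integral_congr_ae (Filter.Eventually.of_forall fun ζ => ?_)
    simp only [hF]
    set η := (w.1 + (s * S ^ 2) • ξ) + (s * S * C) • ζ with hη
    have e2 : ((η, w.2 + s ^ 2 * S ^ 2) : SpaceTime d) = shift w (rotInner θ ζ (ξ, s)) := by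
      ext i
      · simp only [shift, rotInner, hη, Prod.fst_add, Prod.smul_fst, PiLp.add_apply,
          PiLp.smul_apply, smul_eq_mul]
        ring
      · simp only [shift, rotInner, Prod.snd_add, Prod.smul_snd, smul_eq_mul]
        ring
    have e1 : shift w (ξ, s) = shift (η, w.2 + s ^ 2 * S ^ 2) (rotOuter θ ζ (ξ, s)) := by
      have hC2 : C ^ 2 = 1 - S ^ 2 := by linarith
      ext i
      · simp only [shift, rotOuter, hη, Prod.fst_add, Prod.smul_fst, PiLp.add_apply,
          PiLp.smul_apply, PiLp.sub_apply, smul_eq_mul]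
        linear_combination (-(s * ξ i)) * hC2
      · simp only [shift, rotOuter, Prod.snd_add, Prod.smul_snd, smul_eq_mul]
        linear_combination (-(s ^ 2)) * hC2
    have h2 := h₂ w (rotInner θ ζ (ξ, s)) (by simp only [rotInner]; positivity)
    have h1 := h₁ (η, w.2 + s ^ 2 * S ^ 2) (rotOuter θ ζ (ξ, s)) (by simp only [rotOuter]; positivity)
    rw [← e1] at h1
    rw [← e2] at h2
    rw [h1, h2, ← e2]
    -- The factors `e^{s²}` are multiplicative under the rotation.
    have hexp : Real.exp ((rotOuter θ ζ (ξ, s)).2 ^ 2) * Real.exp ((rotInner θ ζ (ξ, s)).2 ^ 2) =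
        Real.exp (s ^ 2) := by
      rw [← Real.exp_add]
      congr 1
      simp only [rotOuter, rotInner]
      linear_combination s ^ 2 * hSC
    rw [← hexp]
    have ho : (rotOuter θ ζ (ξ, s)).2 = C * s := rfl
    have hi : (rotInner θ ζ (ξ, s)).2 = S * s := rfl
    rw [ho, hi]
    generalize Real.exp ((C * s) ^ 2) = x₁
    generalize Real.exp ((S * s) ^ 2) = x₂
    generalize e₁ _ _ = y₁
    generalize e₂ _ _ = y₂
    field_simp
    ring
  · intro θ _
    have := (((Real.hasDerivAt_sin θ).pow 2).const_mul (s ^ 2)).const_add w.2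
    refine (this.congr_deriv ?_).hasDerivWithinAt
    simp
  · intro θ hθ θ' hθ' h
    simp only at h
    have hs2 : 0 < s ^ 2 := by positivity
    have h1 : Real.sin θ ^ 2 = Real.sin θ' ^ 2 := by
      have h2 : s ^ 2 * Real.sin θ ^ 2 = s ^ 2 * Real.sin θ' ^ 2 := by linarith
      exact mul_left_cancel₀ hs2.ne' h2
    have hS : 0 ≤ Real.sin θ := Real.sin_nonneg_of_nonneg_of_le_pi hθ.1.le (by linarith [hθ.2, hθ.1])
    have hS' : 0 ≤ Real.sin θ' :=
      Real.sin_nonneg_of_nonneg_of_le_pi hθ'.1.le (by linarith [hθ'.2, hθ'.1])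
    have h3 : Real.sin θ = Real.sin θ' := (pow_left_inj₀ hS hS' (by norm_num)).mp h1
    exact Real.injOn_sin ⟨by linarith [hθ.1], hθ.2.le⟩ ⟨by linarith [hθ'.1], hθ'.2.le⟩ h3

end SpaceTime

/-! ### Gaussian weights are stable under composition -/

namespace SpaceTime

variable {d : ℕ}

/-- The Gaussian weight `exp (-a (|ξ|² + s²))`. -/
def gaussWeight (a : ℝ) (p : SpaceTime d) : ℝ := Real.exp (-(a * (‖p.1‖ ^ 2 + p.2 ^ 2)))

theorem gaussWeight_pos (a : ℝ) (p : SpaceTime d) : 0 < gaussWeight a p := Real.exp_pos _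

theorem exists_one_add_pow_mul_exp_le (N : ℕ) {a : ℝ} (ha : 0 < a) : ∃ C : ℝ, 0 < C ∧
    ∀ r : ℝ, 0 ≤ r → (1 + r) ^ N * Real.exp (-(a * r ^ 2)) ≤ C := by
  refine ⟨N.factorial * Real.exp (1 + 1 / (4 * a)), by positivity, fun r hr => ?_⟩
  have h1 := Real.pow_div_factorial_le_exp (1 + r) (by linarith) N
  rw [div_le_iff₀ (by positivity)] at h1
  have h2 : 1 + r ≤ 1 + 1 / (4 * a) + a * r ^ 2 := by
    have : 0 ≤ a * (r - 1 / (2 * a)) ^ 2 := by positivity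
    have e : a * (r - 1 / (2 * a)) ^ 2 = a * r ^ 2 - r + 1 / (4 * a) := by
      field_simp
      ring
    linarith
  calc _ ≤ Real.exp (1 + r) * N.factorial * Real.exp (-(a * r ^ 2)) := by gcongr
    _ = N.factorial * Real.exp (1 + r + -(a * r ^ 2)) := by rw [Real.exp_add (1 + r)]; ring
    _ ≤ _ := mul_le_mul_of_nonneg_left (Real.exp_le_exp.mpr (by linarith)) (by positivity)

theorem sq_norm_le (p : SpaceTime d) : ‖p‖ ^ 2 ≤ ‖p.1‖ ^ 2 + p.2 ^ 2 := by
  rw [Prod.norm_def, Real.norm_eq_abs]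
  rcases max_cases ‖p.1‖ |p.2| with ⟨h, _⟩ | ⟨h, _⟩ <;> rw [h]
  · nlinarith
  · rw [sq_abs]; nlinarith [sq_nonneg ‖p.1‖]

theorem exists_one_add_pow_mul_gaussWeight_le (d N : ℕ) {a : ℝ} (ha : 0 < a) : ∃ C : ℝ, 0 < C ∧
    ∀ p : SpaceTime d, (1 + ‖p‖) ^ N * gaussWeight a p ≤ C := by
  obtain ⟨C, hC, h⟩ := exists_one_add_pow_mul_exp_le N ha
  refine ⟨C, hC, fun p => le_trans ?_ (h ‖p‖ (norm_nonneg _))⟩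
  refine mul_le_mul_of_nonneg_left (Real.exp_le_exp.mpr ?_) (by positivity)
  have := mul_le_mul_of_nonneg_left (sq_norm_le p) ha.le
  linarith

theorem integrable_one_add_pow_mul_exp (d N : ℕ) {a : ℝ} (ha : 0 < a) :
    Integrable fun ζ : EuclideanSpace ℝ (Fin d) => (1 + ‖ζ‖) ^ N * Real.exp (-(a * ‖ζ‖ ^ 2)) := by
  obtain ⟨C, hC, h⟩ := exists_one_add_pow_mul_exp_le (N + (d + 1)) ha
  have h1 : Integrable fun ζ : EuclideanSpace ℝ (Fin d) => (1 + ‖ζ‖) ^ (-((d : ℝ) + 1)) :=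
    integrable_one_add_norm (by simp)
  refine (h1.const_mul C).mono' (by fun_prop) (Filter.Eventually.of_forall fun ζ => ?_)
  have h0 : 0 < 1 + ‖ζ‖ := by positivity
  rw [Real.norm_of_nonneg (by positivity), Real.rpow_neg h0.le, ← div_eq_mul_inv,
    le_div_iff₀ (by positivity)]
  have h2 := h ‖ζ‖ (norm_nonneg _)
  rw [pow_add] at h2
  have e : (1 + ‖ζ‖) ^ ((d : ℝ) + 1) = (1 + ‖ζ‖) ^ (d + 1) := by
    rw [← Real.rpow_natCast]; push_cast; rfl
  rw [e]
  calc _ = (1 + ‖ζ‖) ^ N * (1 + ‖ζ‖) ^ (d + 1) * Real.exp (-(a * ‖ζ‖ ^ 2)) := by ring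
    _ ≤ C := h2

/-- The invariance of the Gaussian under rotations: the weights of the two profiles in a composition
give back the weight of the result, with the same `a`, and an integrable function of `ζ`. -/
theorem gaussWeight_rot (a θ : ℝ) (ζ : EuclideanSpace ℝ (Fin d)) (p : SpaceTime d) :
    gaussWeight a (rotOuter θ ζ p) * gaussWeight a (rotInner θ ζ p) =
      gaussWeight a p * Real.exp (-(a * ‖ζ‖ ^ 2)) := by
  unfold gaussWeight
  rw [← Real.exp_add, ← Real.exp_add]
  congr 1
  have h := Real.sin_sq_add_cos_sq θ
  simp only [rotOuter, rotInner]
  rw [norm_sub_sq_real, norm_add_sq_real, norm_smul, norm_smul, norm_smul, norm_smul,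
    real_inner_smul_left, real_inner_smul_right, real_inner_smul_left, real_inner_smul_right]
  simp only [mul_pow, Real.norm_eq_abs, sq_abs]
  linear_combination (-(a * (‖p.1‖ ^ 2 + p.2 ^ 2 + ‖ζ‖ ^ 2))) * h

theorem norm_rotInner_le (θ : ℝ) (ζ : EuclideanSpace ℝ (Fin d)) (p : SpaceTime d) :
    ‖rotInner θ ζ p‖ ≤ ‖p‖ + ‖ζ‖ := by
  have hs := Real.abs_sin_le_one θ
  have hc := Real.abs_cos_le_one θ
  rw [Prod.norm_def]
  refine max_le ?_ ?_
  · refine (norm_add_le _ _).trans (add_le_add ?_ ?_)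
    · rw [norm_smul, Real.norm_eq_abs]
      exact (mul_le_of_le_one_left (norm_nonneg _) hs).trans (norm_fst_le p)
    · rw [norm_smul, Real.norm_eq_abs]
      exact mul_le_of_le_one_left (norm_nonneg _) hc
  · simp only [rotInner, norm_mul, Real.norm_eq_abs]
    have := (mul_le_of_le_one_left (abs_nonneg p.2) hs).trans (norm_snd_le p)
    linarith [norm_nonneg ζ]

theorem norm_iteratedFDeriv_clm_le {V F : Type*} [NormedAddCommGroup V] [NormedSpace ℝ V]
    [NormedAddCommGroup F] [NormedSpace ℝ F] (L : V →L[ℝ] F) (x : V) {i : ℕ} (hi : 1 ≤ i) :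
    ‖iteratedFDeriv ℝ i (fun y => L y) x‖ ≤ ‖L‖ := by
  obtain ⟨i, rfl⟩ := Nat.exists_eq_add_of_le' hi
  rw [← norm_iteratedFDeriv_fderiv]
  have : fderiv ℝ (fun y => L y) = fun _ => L := by ext1 y; exact L.fderiv
  rw [this]
  match i with
  | 0 => simp
  | i + 1 => simp [iteratedFDeriv_const_of_ne (Nat.succ_ne_zero i)]

theorem norm_prodMap_le {V F F' : Type*} [NormedAddCommGroup V] [NormedSpace ℝ V]
    [NormedAddCommGroup F] [NormedSpace ℝ F] [NormedAddCommGroup F'] [NormedSpace ℝ F']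
    (L : V →L[ℝ] F) (L' : V →L[ℝ] F') (h : ‖L‖ ≤ 1) (h' : ‖L'‖ ≤ 1) : ‖L.prod L'‖ ≤ 1 := by
  refine ContinuousLinearMap.opNorm_le_bound _ zero_le_one fun x => ?_
  rw [ContinuousLinearMap.prod_apply, Prod.norm_def]
  exact max_le ((L.le_of_opNorm_le h x).trans le_rfl) ((L'.le_of_opNorm_le h' x).trans le_rfl)

/-- The profile of a composition, with the extra parameter carried along. -/
def composeParam (c : ℝ → ℝ) (f g : SpaceTime d × (SpaceTime d × ℝ) → ℝ)
    (x : SpaceTime d × (SpaceTime d × ℝ)) : ℝ :=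
  composeProfile c (fun p w => f (p, (w, x.2.2))) (fun p w => g (p, (w, x.2.2))) x.1 x.2.1

section Step

variable {N : ℕ} {a A B : ℝ} {f g : SpaceTime d × (SpaceTime d × ℝ) → ℝ}

/-- The map `(p, p', w, τ) ↦ (p, shift w p', τ)`. -/
def shiftMap (y : SpaceTime d × (SpaceTime d × (SpaceTime d × ℝ))) :
    SpaceTime d × (SpaceTime d × ℝ) := (y.1, (shift y.2.2.1 y.2.1, y.2.2.2))

theorem contDiff_shiftMap {n : WithTop ℕ∞} : ContDiff ℝ n (shiftMap (d := d)) := by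
  unfold shiftMap shift
  fun_prop

theorem norm_iteratedFDeriv_add_smul_le {V F : Type*} [NormedAddCommGroup V] [NormedSpace ℝ V]
    [NormedAddCommGroup F] [NormedSpace ℝ F] {N : ℕ} (L S : V →L[ℝ] F) (T : V →L[ℝ] ℝ)
    (hL : ‖L‖ ≤ 1) (hS : ‖S‖ ≤ 1) (hT : ‖T‖ ≤ 1) {r : ℝ} (hr0 : 0 ≤ r) {y : V} (hSy : ‖S y‖ ≤ r)
    (hTy : ‖T y‖ ≤ r) {i : ℕ} (hi : 1 ≤ i) (hiN : i ≤ N) :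
    ‖iteratedFDeriv ℝ i (fun y => L y + T y • S y) y‖ ≤ ((2 ^ N + 1) * (1 + r)) ^ i := by
  have hr : 0 < 1 + r := by positivity
  have hTc : ContDiff ℝ N fun y => T y := T.contDiff
  have hSc : ContDiff ℝ N fun y => S y := S.contDiff
  have hJc : ContDiff ℝ N fun y => T y • S y := hTc.smul hSc
  -- Both factors are linear: their values are at most `1 + r`, their derivatives at most `1`
  have h1 : JetBound N (1 + r)⁻¹ (1 + r) (fun y => T y) y :=
    JetBound.clm T (by positivity) (by linarith) (by rwa [mul_inv_cancel₀ hr.ne'])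
  have h2 : JetBound N (1 + r)⁻¹ (1 + r) (fun y => S y) y :=
    JetBound.clm S (by positivity) (by linarith) (by rwa [mul_inv_cancel₀ hr.ne'])
  have h3 := (h1.smul (by positivity) hTc hSc h2) i hiN
  have h4 : ‖iteratedFDeriv ℝ i (fun y => T y • S y) y‖ ≤ 2 ^ N * (1 + r) := by
    refine h3.trans ?_
    obtain ⟨k, rfl⟩ := Nat.exists_eq_add_of_le' hi
    have h5 : ((1 + r)⁻¹ : ℝ) ^ k ≤ 1 :=
      pow_le_one₀ (by positivity) (inv_le_one_of_one_le₀ (by linarith))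
    rw [pow_succ]
    calc 2 ^ N * ((1 + r) * (1 + r)) * ((1 + r)⁻¹ ^ k * (1 + r)⁻¹)
        ≤ 2 ^ N * ((1 + r) * (1 + r)) * (1 * (1 + r)⁻¹) := by gcongr
      _ = 2 ^ N * (1 + r) := by field_simp
  have hiN' : (i : WithTop ℕ∞) ≤ N := by exact_mod_cast hiN
  have e : (fun y => L y + T y • S y) = (fun y => L y) + fun y => T y • S y := rfl
  rw [e, iteratedFDeriv_add_apply L.contDiff.contDiffAt (hJc.of_le hiN').contDiffAt]
  have h5 : ‖iteratedFDeriv ℝ i (fun y => L y) y‖ ≤ 1 := (norm_iteratedFDeriv_clm_le L y hi).trans hL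
  have h6 : (1 : ℝ) ≤ 1 + r := by linarith
  have h7 : (1 : ℝ) ≤ (2 ^ N + 1) * (1 + r) := by
    have : (1 : ℝ) ≤ 2 ^ N := one_le_pow₀ (by norm_num)
    nlinarith
  calc _ ≤ 1 + 2 ^ N * (1 + r) := (norm_add_le _ _).trans (add_le_add h5 h4)
    _ ≤ (2 ^ N + 1) * (1 + r) := by linarith
    _ ≤ _ := le_self_pow₀ h7 (Nat.one_le_iff_ne_zero.mp hi)

theorem norm_iteratedFDeriv_shiftMap_le {N : ℕ} (y : SpaceTime d × (SpaceTime d × (SpaceTime d × ℝ)))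
    {i : ℕ} (hi : 1 ≤ i) (hiN : i ≤ N) :
    ‖iteratedFDeriv ℝ i shiftMap y‖ ≤ ((2 ^ N + 1) * (1 + ‖y.2.1‖)) ^ i := by
  let pr : SpaceTime d × (SpaceTime d × (SpaceTime d × ℝ)) →L[ℝ] SpaceTime d :=
    (ContinuousLinearMap.fst ℝ _ _).comp (ContinuousLinearMap.snd ℝ _ _)
  let L : SpaceTime d × (SpaceTime d × (SpaceTime d × ℝ)) →L[ℝ] SpaceTime d × (SpaceTime d × ℝ) :=
    (ContinuousLinearMap.fst ℝ _ _).prod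
      ((ContinuousLinearMap.snd ℝ _ _).comp (ContinuousLinearMap.snd ℝ _ _))
  let S : SpaceTime d × (SpaceTime d × (SpaceTime d × ℝ)) →L[ℝ] SpaceTime d × (SpaceTime d × ℝ) :=
    (ContinuousLinearMap.inr ℝ _ _).comp ((ContinuousLinearMap.inl ℝ _ _).comp pr)
  let T : SpaceTime d × (SpaceTime d × (SpaceTime d × ℝ)) →L[ℝ] ℝ :=
    (ContinuousLinearMap.snd ℝ _ ℝ).comp pr
  have e : (shiftMap : SpaceTime d × (SpaceTime d × (SpaceTime d × ℝ)) → _) =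
      fun y => L y + T y • S y := by
    ext1 y
    refine Prod.ext ?_ (Prod.ext ?_ ?_) <;> simp [shiftMap, shift, L, S, T, pr]
  have hS : ∀ x, ‖S x‖ = ‖x.2.1‖ := fun x => by
    have : S x = (0, (x.2.1, 0)) := rfl
    rw [this, Prod.norm_def, Prod.norm_def]
    simp
  have hT : ∀ x, ‖T x‖ ≤ ‖x.2.1‖ := fun x => norm_snd_le x.2.1
  have hx : ∀ x : SpaceTime d × (SpaceTime d × (SpaceTime d × ℝ)), ‖x.2.1‖ ≤ ‖x‖ := fun x =>
    (norm_fst_le _).trans (norm_snd_le x)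
  rw [e]
  refine norm_iteratedFDeriv_add_smul_le L S T
    (norm_prodMap_le _ _ (ContinuousLinearMap.norm_fst_le ..)
      (ContinuousLinearMap.opNorm_le_bound _ zero_le_one fun x => ?_))
    (ContinuousLinearMap.opNorm_le_bound _ zero_le_one fun x => ?_)
    (ContinuousLinearMap.opNorm_le_bound _ zero_le_one fun x => ?_) (norm_nonneg _)
    (hS y).le (hT y) hi hiN
  · rw [one_mul]
    exact (norm_snd_le _).trans (norm_snd_le x)
  · rw [one_mul, hS]
    exact hx x
  · rw [one_mul]
    exact (hT x).trans (hx x)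

/-- The integrand of a composition before the rotation. -/
def composeKernel (f g : SpaceTime d × (SpaceTime d × ℝ) → ℝ)
    (y : SpaceTime d × (SpaceTime d × (SpaceTime d × ℝ))) : ℝ :=
  f (shiftMap y) * g y.2

theorem contDiff_composeKernel (hf : ContDiff ℝ N f) (hg : ContDiff ℝ N g) :
    ContDiff ℝ N (composeKernel f g) :=
  (hf.comp contDiff_shiftMap).mul (hg.comp contDiff_snd)

theorem _root_.JetBound.comp_shiftMap {M : ℝ}
    {y : SpaceTime d × (SpaceTime d × (SpaceTime d × ℝ))} (hf : ContDiff ℝ N f)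
    (h : JetBound N 1 M f (shiftMap y)) :
    JetBound N ((2 ^ N + 1) * (1 + ‖y.2.1‖)) (N.factorial * M) (fun y => f (shiftMap y)) y :=
  JetBound.comp hf contDiff_shiftMap h
    (fun _ hi hiN => norm_iteratedFDeriv_shiftMap_le y hi hiN) (by positivity)

theorem jetBound_composeKernel (hf : ContDiff ℝ N f) (hg : ContDiff ℝ N g)
    (hfb : ∀ x, JetBound N 1 (A * gaussWeight a x.1) f x)
    (hgb : ∀ x, JetBound N (1 + ‖x.1‖) (B * gaussWeight a x.1) g x)
    (y : SpaceTime d × (SpaceTime d × (SpaceTime d × ℝ))) :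
    JetBound N (1 + ‖y.2.1‖) (2 ^ N * (((2 ^ N + 1) ^ N * (N.factorial * (A * gaussWeight a y.1))) *
      (B * gaussWeight a y.2.1))) (composeKernel f g) y := by
  have hr : 0 ≤ 1 + ‖y.2.1‖ := by positivity
  have h3 := (JetBound.comp_shiftMap hf (hfb (shiftMap y))).absorb (by
    have : (0 : ℝ) ≤ 2 ^ N := by positivity
    linarith) hr
  have h2 := JetBound.comp_snd (y := y) hg hr (hgb y.2)
  exact JetBound.mul hr (hf.comp contDiff_shiftMap) (hg.comp contDiff_snd) h3 h2

/-- The linear part of the rotation, with the base point and the parameter carried along. -/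
def rotCLM (θ : ℝ) : SpaceTime d × (SpaceTime d × ℝ) →L[ℝ]
    SpaceTime d × (SpaceTime d × (SpaceTime d × ℝ)) :=
  (Real.cos θ • ContinuousLinearMap.fst ℝ _ _).prod
    ((Real.sin θ • ContinuousLinearMap.fst ℝ _ _).prod (ContinuousLinearMap.snd ℝ _ _))

theorem norm_rotCLM_le (θ : ℝ) : ‖rotCLM (d := d) θ‖ ≤ 1 := by
  have h : ∀ c : ℝ, |c| ≤ 1 →
      ‖c • ContinuousLinearMap.fst ℝ (SpaceTime d) (SpaceTime d × ℝ)‖ ≤ 1 := fun c hc => by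
    rw [norm_smul]
    exact mul_le_one₀ hc (norm_nonneg _) (ContinuousLinearMap.norm_fst_le ..)
  exact norm_prodMap_le _ _ (h _ (Real.abs_cos_le_one θ))
    (norm_prodMap_le _ _ (h _ (Real.abs_sin_le_one θ)) (ContinuousLinearMap.norm_snd_le ..))

/-- The translation part of the rotation. -/
def rotShift (θ : ℝ) (ζ : EuclideanSpace ℝ (Fin d)) :
    SpaceTime d × (SpaceTime d × (SpaceTime d × ℝ)) :=
  ((-(Real.sin θ • ζ), 0), ((Real.cos θ • ζ, 0), 0))

theorem rotCLM_add_rotShift (θ : ℝ) (ζ : EuclideanSpace ℝ (Fin d))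
    (x : SpaceTime d × (SpaceTime d × ℝ)) :
    rotCLM θ x + rotShift θ ζ = (rotOuter θ ζ x.1, rotInner θ ζ x.1, x.2) := by
  refine Prod.ext (Prod.ext ?_ ?_) (Prod.ext (Prod.ext ?_ ?_) ?_) <;>
    simp [rotCLM, rotShift, rotOuter, rotInner, sub_eq_add_neg]

theorem jetBound_rotated (hf : ContDiff ℝ N f) (hg : ContDiff ℝ N g)
    (hfb : ∀ x, JetBound N 1 (A * gaussWeight a x.1) f x)
    (hgb : ∀ x, JetBound N (1 + ‖x.1‖) (B * gaussWeight a x.1) g x)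
    (θ : ℝ) (ζ : EuclideanSpace ℝ (Fin d)) (x : SpaceTime d × (SpaceTime d × ℝ)) :
    JetBound N (1 + ‖x.1‖) (2 ^ N * (2 ^ N + 1) ^ N * N.factorial * A * B *
        ((1 + ‖ζ‖) ^ N * Real.exp (-(a * ‖ζ‖ ^ 2))) * gaussWeight a x.1)
      (fun x => composeKernel f g (rotCLM θ x + rotShift θ ζ)) x := by
  have h1 := jetBound_composeKernel hf hg hfb hgb (rotCLM θ x + rotShift θ ζ)
  have h2 := h1.comp_affine_of_le_one (rotCLM θ) (rotShift θ ζ) (norm_rotCLM_le θ)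
    (contDiff_composeKernel hf hg) (by positivity)
  rw [rotCLM_add_rotShift] at h2
  simp only at h2
  have h3 : 1 + ‖rotInner θ ζ x.1‖ ≤ (1 + ‖ζ‖) * (1 + ‖x.1‖) := by
    nlinarith [norm_rotInner_le θ ζ x.1, norm_nonneg ζ, norm_nonneg x.1]
  have h4 := (h2.mono (by positivity) h3 le_rfl).absorb (by linarith [norm_nonneg ζ])
    (by positivity)
  refine h4.mono (by positivity) le_rfl (le_of_eq ?_)
  have h5 := gaussWeight_rot a θ ζ x.1
  linear_combination (1 + ‖ζ‖) ^ N * 2 ^ N * (2 ^ N + 1) ^ N * N.factorial * A * B * h5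

end Step

/-- Composition preserves Gaussian bounds on the profiles: the constants multiply, up to a factor
that depends only on the weight in the composition. One derivative of the inner profile may cost
`1 + ‖p‖`; this is reproduced by the composition without loss. -/
theorem exists_compose_const (d N : ℕ) {a : ℝ} (ha : 0 < a) : ∃ K : ℝ, 0 ≤ K ∧
    ∀ {f g : SpaceTime d × (SpaceTime d × ℝ) → ℝ} {A B : ℝ}, ContDiff ℝ N f → ContDiff ℝ N g →
    (∀ x, JetBound N 1 (A * gaussWeight a x.1) f x) →
    (∀ x, JetBound N (1 + ‖x.1‖) (B * gaussWeight a x.1) g x) →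
    ∀ {c : ℝ → ℝ}, Continuous c → ContDiff ℝ N (composeParam c f g) ∧
      ∀ x, JetBound N (1 + ‖x.1‖)
        (K * A * B * (∫ θ in Set.Ioo 0 (Real.pi / 2), |c θ|) * gaussWeight a x.1)
        (composeParam c f g) x := by
  obtain ⟨C₀, hC₀, hsup⟩ := exists_one_add_pow_mul_gaussWeight_le d N ha
  set k : EuclideanSpace ℝ (Fin d) → ℝ := fun ζ => (1 + ‖ζ‖) ^ N * Real.exp (-(a * ‖ζ‖ ^ 2)) with hk
  have hk0 : ∀ ζ, 0 ≤ k ζ := fun ζ => by positivity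
  have hkint : Integrable k := integrable_one_add_pow_mul_exp d N ha
  refine ⟨2 ^ N * (2 ^ N + 1) ^ N * N.factorial * ∫ ζ, k ζ,
    mul_nonneg (by positivity) (integral_nonneg hk0), ?_⟩
  intro f g A B hf hg hfb hgb c hc
  set K₀ : ℝ := 2 ^ N * (2 ^ N + 1) ^ N * N.factorial with hK₀
  set μ : Measure ℝ := volume.restrict (Set.Ioo 0 (Real.pi / 2)) with hμ
  set ν : Measure (ℝ × EuclideanSpace ℝ (Fin d)) := μ.prod volume with hν
  have hA : 0 ≤ A := by
    have := (hfb 0).nonneg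
    exact nonneg_of_mul_nonneg_left this (gaussWeight_pos a _)
  have hB : 0 ≤ B := by
    have := (hgb 0).nonneg
    exact nonneg_of_mul_nonneg_left this (gaussWeight_pos a _)
  have hcint : Integrable (fun θ => |c θ|) μ :=
    (hc.abs.integrableOn_Icc (a := 0) (b := Real.pi / 2)).mono_set Set.Ioo_subset_Icc_self
  have hqint : Integrable (fun q : ℝ × EuclideanSpace ℝ (Fin d) => |c q.1| * k q.2) ν :=
    hcint.mul_prod hkint
  set Φ : SpaceTime d × (SpaceTime d × ℝ) → ℝ × EuclideanSpace ℝ (Fin d) → ℝ := fun x q =>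
    c q.1 * composeKernel f g (rotCLM q.1 x + rotShift q.1 q.2) with hΦ
  have hker := contDiff_composeKernel hf hg
  have hΦc : ∀ q : ℝ × EuclideanSpace ℝ (Fin d),
      ContDiff ℝ N fun x => composeKernel f g (rotCLM q.1 x + rotShift (d := d) q.1 q.2) :=
    fun q : ℝ × EuclideanSpace ℝ (Fin d) =>
      hker.comp ((rotCLM q.1).contDiff.add contDiff_const)
  have hjet : ∀ x q, JetBound N (1 + ‖x.1‖) (K₀ * A * B * gaussWeight a x.1 * (|c q.1| * k q.2))
      (fun x => Φ x q) x := fun x q => by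
    refine ((jetBound_rotated hf hg hfb hgb q.1 q.2 x).const_mul (c q.1) (hΦc q)).mono
      (by positivity) le_rfl (le_of_eq ?_)
    simp only [hK₀, hk]
    ring
  have hmeas : ∀ x, AEStronglyMeasurable (Φ x) ν := fun x => by
    refine Continuous.aestronglyMeasurable ?_
    refine (hc.comp continuous_fst).mul (hker.continuous.comp ?_)
    simp only [rotCLM_add_rotShift, rotOuter, rotInner]
    fun_prop
  have hbound : ∀ j ≤ N, ∀ x q, ‖iteratedFDeriv ℝ j (fun y => Φ y q) x‖ ≤
      K₀ * A * B * C₀ * (|c q.1| * k q.2) := fun j hj x q => by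
    refine (hjet x q j hj).trans ?_
    have h1 : (1 + ‖x.1‖) ^ j ≤ (1 + ‖x.1‖) ^ N :=
      pow_le_pow_right₀ (by linarith [norm_nonneg x.1]) hj
    have h2 := hsup x.1
    have h3 := gaussWeight_pos a x.1
    have h4 := hk0 q.2
    calc _ = K₀ * A * B * (|c q.1| * k q.2) * ((1 + ‖x.1‖) ^ j * gaussWeight a x.1) := by ring
      _ ≤ K₀ * A * B * (|c q.1| * k q.2) * ((1 + ‖x.1‖) ^ N * gaussWeight a x.1) := by gcongr
      _ ≤ K₀ * A * B * (|c q.1| * k q.2) * C₀ := by gcongr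
      _ = _ := by ring
  obtain ⟨h1, h2⟩ := contDiff_integral_of_dominated (μ := ν) (f := Φ)
    (fun q => contDiff_const.mul (hΦc q)) hmeas (hqint.const_mul _) hbound
  have e : composeParam c f g = fun x => ∫ q, Φ x q ∂ν := by
    ext x
    have hi : Integrable (Φ x) ν := (hqint.const_mul _).mono' (hmeas x)
      (Filter.Eventually.of_forall fun q => by simpa using hbound 0 (Nat.zero_le _) x q)
    rw [hν, integral_prod _ hi, composeParam, composeProfile]
    refine integral_congr_ae (Filter.Eventually.of_forall fun θ => ?_)
    refine integral_congr_ae (Filter.Eventually.of_forall fun ζ => ?_)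
    simp only [hΦ, rotCLM_add_rotShift, composeKernel, shiftMap]
  refine ⟨e ▸ h1, fun x j hj => ?_⟩
  have h3 := h2 j hj x (fun q => K₀ * A * B * gaussWeight a x.1 * (1 + ‖x.1‖) ^ j * (|c q.1| * k q.2))
    (hqint.const_mul _) (fun q => (hjet x q j hj).trans (le_of_eq (by ring)))
  rw [e]
  refine h3.trans (le_of_eq ?_)
  rw [integral_const_mul, hν, integral_prod_mul (fun θ => |c θ|) k]
  ring

end SpaceTime

/-! ### Derivatives of the parametrix -/

namespace Coefficients

open SpaceTime

variable {d : ℕ} (A : Coefficients d)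

/-- The `i`-th component of `a(w)⁻¹ ξ`. -/
def invMul (w : SpaceTime d) (ξ : EuclideanSpace ℝ (Fin d)) (i : Fin d) : ℝ :=
  ∑ j, (A.a w)⁻¹ i j * ξ j

theorem theta_eq_sum_invMul (w : SpaceTime d) (ξ : EuclideanSpace ℝ (Fin d)) :
    A.theta w ξ = ∑ i, ξ i * A.invMul w ξ i := by
  unfold theta invMul
  refine Finset.sum_congr rfl fun i _ => ?_
  rw [Finset.mul_sum]
  exact Finset.sum_congr rfl fun j _ => by ring

theorem invMul_smul (w : SpaceTime d) (r : ℝ) (ξ : EuclideanSpace ℝ (Fin d)) (i : Fin d) :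
    A.invMul w (r • ξ) i = r * A.invMul w ξ i := by
  unfold invMul
  rw [Finset.mul_sum]
  exact Finset.sum_congr rfl fun j _ => by simp; ring

theorem theta_smul (w : SpaceTime d) (r : ℝ) (ξ : EuclideanSpace ℝ (Fin d)) :
    A.theta w (r • ξ) = r ^ 2 * A.theta w ξ := by
  rw [theta_eq_sum_invMul, theta_eq_sum_invMul, Finset.mul_sum]
  refine Finset.sum_congr rfl fun i _ => ?_
  rw [invMul_smul]
  simp
  ring

theorem invMul_add_single (w : SpaceTime d) (ξ : EuclideanSpace ℝ (Fin d)) (r : ℝ) (i j : Fin d) :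
    A.invMul w (ξ + r • EuclideanSpace.single j 1) i = A.invMul w ξ i + r * (A.a w)⁻¹ i j := by
  unfold invMul
  simp [mul_add, Finset.sum_add_distrib, mul_comm]

variable {A} {w : SpaceTime d}

theorem inv_symm (hs : (A.a w).IsSymm) (i j : Fin d) : (A.a w)⁻¹ i j = (A.a w)⁻¹ j i := by
  have h : ((A.a w)⁻¹).IsSymm := by
    rw [Matrix.IsSymm, Matrix.transpose_nonsing_inv, hs.eq]
  exact h.apply j i

theorem theta_add_single (hs : (A.a w).IsSymm) (ξ : EuclideanSpace ℝ (Fin d)) (r : ℝ) (j : Fin d) :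
    A.theta w (ξ + r • EuclideanSpace.single j 1) =
      A.theta w ξ + 2 * r * A.invMul w ξ j + r ^ 2 * (A.a w)⁻¹ j j := by
  rw [theta_eq_sum_invMul, theta_eq_sum_invMul]
  have h : ∑ i, ξ i * (A.a w)⁻¹ i j = A.invMul w ξ j := by
    unfold invMul
    exact Finset.sum_congr rfl fun i _ => by rw [inv_symm hs i j, mul_comm]
  calc _ = ∑ i, (ξ i * A.invMul w ξ i + r * (ξ i * (A.a w)⁻¹ i j)
        + (r * (if i = j then 1 else 0) * A.invMul w ξ i
        + r ^ 2 * ((if i = j then 1 else 0) * (A.a w)⁻¹ i j))) := by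
        refine Finset.sum_congr rfl fun i _ => ?_
        rw [invMul_add_single]
        simp only [PiLp.add_apply, PiLp.smul_apply, PiLp.single_apply, smul_eq_mul]
        ring
    _ = _ := by
        rw [Finset.sum_add_distrib, Finset.sum_add_distrib, ← Finset.mul_sum, h,
          Finset.sum_add_distrib, ← Finset.mul_sum]
        simp [mul_assoc]
        ring

theorem hasDerivAt_theta (hs : (A.a w).IsSymm) (ξ : EuclideanSpace ℝ (Fin d)) (j : Fin d) :
    HasDerivAt (fun r : ℝ => A.theta w (ξ + r • EuclideanSpace.single j 1)) (2 * A.invMul w ξ j) 0 := by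
  simp only [theta_add_single hs]
  have h := (((hasDerivAt_id (0 : ℝ)).const_mul 2).mul_const (A.invMul w ξ j)).const_add (A.theta w ξ)
  have h2 := ((hasDerivAt_id (0 : ℝ)).pow 2).mul_const ((A.a w)⁻¹ j j)
  simpa using h.fun_add h2

theorem hasDerivAt_parametrix_space (hs : (A.a w).IsSymm) (z : SpaceTime d) (j : Fin d) :
    HasDerivAt (fun r : ℝ => A.parametrix (z + r • unit j.castSucc) w)
      (-(A.parametrix z w * A.invMul w (z.1 - w.1) j / (2 * (z.2 - w.2)))) 0 := by
  have e : ∀ r : ℝ, z + r • unit j.castSucc = (z.1 + r • EuclideanSpace.single j 1, z.2) := fun r => by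
    simp only [unit, Fin.lastCases_castSucc]
    exact Prod.ext (by simp) (by simp)
  simp only [e, parametrix]
  by_cases h : w.2 < z.2
  · simp only [h, if_true]
    have ht : 0 < z.2 - w.2 := sub_pos.mpr h
    have e2 : ∀ r : ℝ, z.1 + r • EuclideanSpace.single j 1 - w.1 =
      z.1 - w.1 + r • EuclideanSpace.single j 1 := fun r => by abel
    simp only [e2]
    have h1 := (((hasDerivAt_theta hs (z.1 - w.1) j).neg.div_const (4 * (z.2 - w.2))).exp).const_mul
      ((4 * Real.pi) ^ (-(d : ℝ) / 2) * (A.a w).det ^ (-(1 : ℝ) / 2) *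
      (z.2 - w.2) ^ (-(d : ℝ) / 2))
    refine h1.congr_deriv ?_
    simp only [zero_smul, add_zero, Pi.neg_apply]
    field_simp
    ring
  · simp only [h, if_false]
    simpa using hasDerivAt_const (0 : ℝ) (0 : ℝ)

theorem pderiv_parametrix_space (hs : (A.a w).IsSymm) (j : Fin d) :
    pderiv j.castSucc (fun y => A.parametrix y w) = fun z =>
      -(A.parametrix z w * A.invMul w (z.1 - w.1) j / (2 * (z.2 - w.2))) := by
  ext z
  exact (hasDerivAt_parametrix_space hs z j).deriv

theorem pderiv_pderiv_parametrix (hs : (A.a w).IsSymm) (i j : Fin d) (z : SpaceTime d) :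
    pderiv i.castSucc (pderiv j.castSucc fun y => A.parametrix y w) z =
      A.parametrix z w * (A.invMul w (z.1 - w.1) i * A.invMul w (z.1 - w.1) j /
        (4 * (z.2 - w.2) ^ 2) - (A.a w)⁻¹ i j / (2 * (z.2 - w.2))) := by
  rw [pderiv_parametrix_space hs j]
  have h1 : HasDerivAt (fun r : ℝ => A.invMul w ((z + r • unit i.castSucc).1 - w.1) j)
      ((A.a w)⁻¹ j i) 0 := by
    have e : ∀ r : ℝ, (z + r • unit i.castSucc).1 - w.1 =
        z.1 - w.1 + r • EuclideanSpace.single i 1 := fun r => by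
      simp only [unit, Fin.lastCases_castSucc]
      simp
      abel
    simp only [e, invMul_add_single]
    simpa using ((hasDerivAt_id (0 : ℝ)).mul_const ((A.a w)⁻¹ j i)).const_add
      (A.invMul w (z.1 - w.1) j)
  have e2 : ∀ r : ℝ, (z + r • unit i.castSucc).2 - w.2 = z.2 - w.2 := fun r => by
    simp only [unit, Fin.lastCases_castSucc]
    simp
  have h2 := (((hasDerivAt_parametrix_space hs z i).mul h1).div_const (2 * (z.2 - w.2))).neg
  refine (HasDerivAt.deriv (HasDerivAt.congr_of_eventuallyEq h2 (.of_forall fun r => ?_))).trans ?_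
  · simp only [e2]
    rfl
  rw [inv_symm hs j i]
  simp only [zero_smul, add_zero]
  by_cases h : z.2 - w.2 = 0
  · simp [h]
  · field_simp
    ring

theorem pderiv_parametrix_time {z : SpaceTime d} (h : w.2 < z.2) :
    pderiv (Fin.last d) (fun y => A.parametrix y w) z =
      A.parametrix z w * (A.theta w (z.1 - w.1) / (4 * (z.2 - w.2) ^ 2) -
        d / (2 * (z.2 - w.2))) := by
  have ht : 0 < z.2 - w.2 := sub_pos.mpr h
  have e : ∀ r : ℝ, z + r • unit (Fin.last d) = (z.1, z.2 + r) := fun r => by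
    simp only [unit, Fin.lastCases_last]
    exact Prod.ext (by simp) (by simp)
  unfold pderiv lineDeriv
  simp only [e, parametrix]
  have hr : HasDerivAt (fun r : ℝ => z.2 + r - w.2) 1 0 := by
    simpa using ((hasDerivAt_id (0 : ℝ)).const_add z.2).sub_const w.2
  have h1 : HasDerivAt (fun r : ℝ => (z.2 + r - w.2) ^ (-(d : ℝ) / 2))
      (-(d : ℝ) / 2 * (z.2 - w.2) ^ (-(d : ℝ) / 2 - 1)) 0 := by
    have := hr.rpow_const (p := -(d : ℝ) / 2) (Or.inl (by simpa using ht.ne'))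
    simpa [mul_comm, mul_assoc] using this
  have h2 : HasDerivAt (fun r : ℝ => Real.exp (-(A.theta w (z.1 - w.1)) / (4 * (z.2 + r - w.2))))
      (Real.exp (-(A.theta w (z.1 - w.1)) / (4 * (z.2 - w.2))) *
        (A.theta w (z.1 - w.1) / (4 * (z.2 - w.2) ^ 2))) 0 := by
    have := ((hasDerivAt_const (0 : ℝ) (-(A.theta w (z.1 - w.1)))).div (hr.const_mul 4)
      (by simpa using ht.ne')).exp
    refine this.congr_deriv ?_
    simp only [add_zero, Pi.div_apply]
    field_simp
    ring
  have h3 := (h1.mul h2).const_mul ((4 * Real.pi) ^ (-(d : ℝ) / 2) * (A.a w).det ^ (-(1 : ℝ) / 2))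
  have h4 : ∀ᶠ r in nhds (0 : ℝ), w.2 < z.2 + r := by
    have : Filter.Tendsto (fun r : ℝ => z.2 + r) (nhds 0) (nhds (z.2 + 0)) :=
      tendsto_const_nhds.add Filter.tendsto_id
    exact this.eventually_const_lt (by simpa using h)
  refine (HasDerivAt.congr_of_eventuallyEq h3 (h4.mono fun r hr => ?_)).deriv.trans ?_
  · simp only [hr, if_true, Pi.mul_apply]
    ring
  · simp only [h, if_true, add_zero, Real.rpow_sub_one ht.ne']
    field_simp
    ring

theorem sum_mul_invMul (hdet : IsUnit (A.a w).det)
    (ξ : EuclideanSpace ℝ (Fin d)) :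
    ∑ i, ∑ j, A.a w i j * (A.invMul w ξ i * A.invMul w ξ j) = A.theta w ξ := by
  rw [theta_eq_sum_invMul]
  have h1 : A.a w * (A.a w)⁻¹ = 1 := Matrix.mul_nonsing_inv _ hdet
  have h2 : ∀ i, ∑ j, A.a w i j * A.invMul w ξ j = ξ i := fun i => by
    have : (A.a w).mulVec ((A.a w)⁻¹.mulVec ξ.ofLp) = ξ.ofLp := by
      rw [Matrix.mulVec_mulVec, h1, Matrix.one_mulVec]
    exact congrFun this i
  refine Finset.sum_congr rfl fun i _ => ?_
  rw [← h2 i, Finset.sum_mul]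
  exact Finset.sum_congr rfl fun j _ => by ring

theorem sum_mul_inv (hs : (A.a w).IsSymm) (hdet : IsUnit (A.a w).det) :
    ∑ i, ∑ j, A.a w i j * (A.a w)⁻¹ i j = d := by
  have h1 : A.a w * (A.a w)⁻¹ = 1 := Matrix.mul_nonsing_inv _ hdet
  have h2 := congrArg Matrix.trace h1
  rw [Matrix.trace_one] at h2
  simp only [Matrix.trace, Matrix.diag, Matrix.mul_apply, Fintype.card_fin] at h2
  rw [← h2]
  exact Finset.sum_congr rfl fun i _ => Finset.sum_congr rfl fun j _ => by rw [inv_symm hs i j]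

/-- The parametrix solves the equation with coefficients frozen at `w`; hence only the difference
of the leading coefficients and the lower order terms remain in the error. -/
theorem error_eq (hs : (A.a w).IsSymm) (hdet : IsUnit (A.a w).det) {z : SpaceTime d}
    (h : w.2 < z.2) :
    A.error z w = A.parametrix z w *
      ((∑ i, ∑ j, (A.a z i j - A.a w i j) *
        (A.invMul w (z.1 - w.1) i * A.invMul w (z.1 - w.1) j / (4 * (z.2 - w.2) ^ 2)
          - (A.a w)⁻¹ i j / (2 * (z.2 - w.2))))
        - (∑ i, A.b z i * A.invMul w (z.1 - w.1) i / (2 * (z.2 - w.2))) + A.c z) := by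
  have ht : 0 < z.2 - w.2 := sub_pos.mpr h
  have hheat : ∑ i, ∑ j, A.a w i j *
        (A.invMul w (z.1 - w.1) i * A.invMul w (z.1 - w.1) j / (4 * (z.2 - w.2) ^ 2)
          - (A.a w)⁻¹ i j / (2 * (z.2 - w.2))) =
      A.theta w (z.1 - w.1) / (4 * (z.2 - w.2) ^ 2) - d / (2 * (z.2 - w.2)) := by
    rw [← sum_mul_invMul hdet, ← sum_mul_inv hs hdet, Finset.sum_div, Finset.sum_div,
      ← Finset.sum_sub_distrib]
    refine Finset.sum_congr rfl fun i _ => ?_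
    rw [Finset.sum_div, Finset.sum_div, ← Finset.sum_sub_distrib]
    exact Finset.sum_congr rfl fun j _ => by ring
  rw [error, if_pos h, op, pderiv_parametrix_time h, ← hheat]
  simp only [pderiv_pderiv_parametrix hs]
  simp only [pderiv_parametrix_space hs]
  have e1 : ∀ i, A.b z i * -(A.parametrix z w * A.invMul w (z.1 - w.1) i / (2 * (z.2 - w.2))) =
    -A.parametrix z w * (A.b z i * A.invMul w (z.1 - w.1) i / (2 * (z.2 - w.2))) := fun i => by ring
  have e2 : ∀ x y : ℝ, x * (A.parametrix z w * y) = A.parametrix z w * (x * y) := fun x y => by ring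
  simp only [e1, e2 (A.a z _ _), ← Finset.mul_sum, sub_mul (A.a z _ _), Finset.sum_sub_distrib]
  ring

/-! ### The profiles of the parametrix and of its error -/

/-- The profile of the parametrix, of order two; the term `s²` in the exponent makes it decay in
both components of the displacement. -/
def parametrixProfile (A : Coefficients d) (p w : SpaceTime d) : ℝ :=
  (4 * Real.pi) ^ (-(d : ℝ) / 2) * (A.a w).det ^ (-(1 : ℝ) / 2) *
    Real.exp (-(A.theta w p.1 / 4 + p.2 ^ 2))

/-- The difference quotient `(a_{ij}(w + s p) - a_{ij}(w)) / s`, in Hadamard's form. -/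
def slope (A : Coefficients d) (i j : Fin d) (p w : SpaceTime d) : ℝ :=
  ∫ θ in Set.Ioo (0 : ℝ) 1, fderiv ℝ (fun z => A.a z i j) (w + (θ * p.2) • p) p

/-- The profile of the error, of order one: two derivatives cost the factor `s^{-2}`, of which the
difference of the leading coefficients gives back one power of `s`. -/
def errorProfile (A : Coefficients d) (p w : SpaceTime d) : ℝ :=
  (∑ i, ∑ j, A.slope i j p w *
      ((A.invMul w p.1 i * A.invMul w p.1 j / 4 - (A.a w)⁻¹ i j / 2) * A.parametrixProfile p w))
    - (∑ i, A.b (shift w p) i * (A.invMul w p.1 i / 2 * A.parametrixProfile p w))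
    + A.c (shift w p) * (p.2 * A.parametrixProfile p w)

theorem shift_sub_fst (w p : SpaceTime d) : (shift w p).1 - w.1 = p.2 • p.1 := by
  simp [shift]

theorem shift_sub_snd (w p : SpaceTime d) : (shift w p).2 - w.2 = p.2 ^ 2 := by
  simp [shift]; ring

theorem isScaled_parametrix (A : Coefficients d) :
    IsScaled 2 A.parametrix A.parametrixProfile := by
  intro w p hp
  have h : w.2 < (shift w p).2 := sub_pos.mp (by rw [shift_sub_snd]; positivity)
  rw [parametrix, if_pos h, shift_sub_fst, shift_sub_snd, theta_smul, parametrixProfile]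
  have h1 : (p.2 ^ 2) ^ (-(d : ℝ) / 2) = (p.2 ^ d)⁻¹ := by
    rw [← Real.rpow_natCast, ← Real.rpow_mul hp.le]
    push_cast
    rw [show (2 : ℝ) * (-(d : ℝ) / 2) = -(d : ℝ) by ring, Real.rpow_neg hp.le, Real.rpow_natCast]
  have h2 : -(p.2 ^ 2 * A.theta w p.1) / (4 * p.2 ^ 2) = p.2 ^ 2 + -(A.theta w p.1 / 4 + p.2 ^ 2) := by
    field_simp
    ring
  rw [h1, h2, Real.exp_add, pow_add]
  field_simp

theorem sub_eq_mul_slope (A : Coefficients d) {i j : Fin d}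
    (ha : ContDiff ℝ 1 fun z => A.a z i j) (p w : SpaceTime d) :
    A.a (shift w p) i j - A.a w i j = p.2 * A.slope i j p w := by
  have hd : ∀ θ : ℝ, HasDerivAt (fun θ : ℝ => A.a (w + (θ * p.2) • p) i j)
      (fderiv ℝ (fun z => A.a z i j) (w + (θ * p.2) • p) (p.2 • p)) θ := fun θ => by
    have h1 : HasDerivAt (fun θ : ℝ => w + (θ * p.2) • p) (p.2 • p) θ := by
      simpa using (((hasDerivAt_id θ).mul_const p.2).smul_const p).const_add w
    exact ((ha.differentiable one_ne_zero _).hasFDerivAt).comp_hasDerivAt θ h1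
  have hc : Continuous fun θ : ℝ => fderiv ℝ (fun z => A.a z i j) (w + (θ * p.2) • p) (p.2 • p) :=
    ((ha.continuous_fderiv one_ne_zero).comp (by fun_prop)).clm_apply continuous_const
  have h := intervalIntegral.integral_eq_sub_of_hasDerivAt (a := 0) (b := 1) (fun θ _ => hd θ)
    (hc.intervalIntegrable _ _)
  simp only [one_mul, zero_mul, zero_smul, add_zero] at h
  rw [show shift w p = w + p.2 • p from rfl, ← h, slope, ← integral_const_mul,
    intervalIntegral.integral_of_le zero_le_one, integral_Ioc_eq_integral_Ioo]
  simp only [map_smul, smul_eq_mul]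

theorem isScaled_error {A : Coefficients d} (hs : ∀ w, (A.a w).IsSymm)
    (hdet : ∀ w, IsUnit (A.a w).det) (ha : ∀ i j, ContDiff ℝ 1 fun z => A.a z i j) :
    IsScaled 1 A.error A.errorProfile := by
  intro w p hp
  have h : w.2 < (shift w p).2 := sub_pos.mp (by rw [shift_sub_snd]; positivity)
  rw [error_eq (hs w) (hdet w) h, isScaled_parametrix A w p hp, errorProfile]
  simp only [shift_sub_fst, shift_sub_snd, invMul_smul, sub_eq_mul_slope A (ha _ _)]
  have e1 : ∀ i j, p.2 * A.slope i j p w * (p.2 * A.invMul w p.1 i * (p.2 * A.invMul w p.1 j) /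
      (4 * (p.2 ^ 2) ^ 2) - (A.a w)⁻¹ i j / (2 * p.2 ^ 2)) = p.2⁻¹ *
      (A.slope i j p w * (A.invMul w p.1 i * A.invMul w p.1 j / 4 - (A.a w)⁻¹ i j / 2)) :=
    fun i j => by
      field_simp
  have e2 : ∀ i, A.b (shift w p) i * (p.2 * A.invMul w p.1 i) / (2 * p.2 ^ 2) =
      p.2⁻¹ * (A.b (shift w p) i * (A.invMul w p.1 i / 2)) := fun i => by
    field_simp
  simp only [e1, e2, ← Finset.mul_sum]
  have e3 : ∀ u v : ℝ, u * (v * A.parametrixProfile p w) = u * v * A.parametrixProfile p w :=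
    fun u v => by ring
  simp only [e3, ← Finset.sum_mul]
  generalize ∑ i, ∑ j, A.slope i j p w * _ = S
  generalize ∑ i, A.b _ i * _ = S'
  field_simp

theorem parametrix_eq_zero (A : Coefficients d) {z w : SpaceTime d} (h : z.2 ≤ w.2) :
    A.parametrix z w = 0 := if_neg h.not_gt

/-- The profiles of the iterated errors; the composition of the orders `1` and `ν + 1` has the
weight `2 sin^ν θ`. -/
def errorIterProfile (A : Coefficients d) : ℕ → SpaceTime d → SpaceTime d → ℝ
  | 0 => A.errorProfile
  | ν + 1 => composeProfile (fun θ => 2 * (Real.cos θ ^ 0 * Real.sin θ ^ ν)) A.errorProfile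
      (errorIterProfile A ν)

theorem isScaled_errorIter {A : Coefficients d} (hs : ∀ w, (A.a w).IsSymm)
    (hdet : ∀ w, IsUnit (A.a w).det) (ha : ∀ i j, ContDiff ℝ 1 fun z => A.a z i j) (ν : ℕ) :
    IsScaled (ν + 1) (A.errorIter ν) (A.errorIterProfile ν) := by
  induction ν with
  | zero => exact isScaled_error hs hdet ha
  | succ ν ih =>
    have h := IsScaled.comp (k₁ := 0) (isScaled_error hs hdet ha) ih
    rw [Nat.zero_add] at h
    exact h

/-- The profiles of the terms of the parametrix series, of order `ν + 2`. -/
def termProfile (A : Coefficients d) : ℕ → SpaceTime d → SpaceTime d → ℝ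
  | 0 => A.parametrixProfile
  | ν + 1 => composeProfile (fun θ => 2 * (Real.cos θ ^ 1 * Real.sin θ ^ ν)) A.parametrixProfile
      (A.errorIterProfile ν)

theorem isScaled_parametrixTerm {A : Coefficients d} (hs : ∀ w, (A.a w).IsSymm)
    (hdet : ∀ w, IsUnit (A.a w).det) (ha : ∀ i j, ContDiff ℝ 1 fun z => A.a z i j) (ν : ℕ) :
    IsScaled (ν + 2) (A.parametrixTerm ν) (A.termProfile ν) := by
  cases ν with
  | zero => exact isScaled_parametrix A
  | succ ν =>
    have h := IsScaled.comp (k₁ := 1) (isScaled_parametrix A) (isScaled_errorIter hs hdet ha ν)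
    rw [show 1 + ν + 2 = ν + 1 + 2 by omega] at h
    exact h

end Coefficients

/-! ### Families of functions with uniform weighted bounds -/

section Controlled

variable {ι V F G : Type*} [NormedAddCommGroup V] [NormedSpace ℝ V] [NormedAddCommGroup F]
  [NormedSpace ℝ F] [NormedAddCommGroup G] [NormedSpace ℝ G]

/-- The functions `f i` are `N` times continuously differentiable, and these derivatives are
bounded by a multiple of the weight `wt`, uniformly in `i`. -/
def Controlled (N : ℕ) (wt : V → ℝ) (f : ι → V → F) : Prop :=
  (∀ i, ContDiff ℝ N (f i)) ∧ ∃ C, 0 ≤ C ∧ ∀ i x, JetBound N 1 (C * wt x) (f i) x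

namespace Controlled

variable {N : ℕ} {wt wt' : V → ℝ} {f : ι → V → F}

theorem mono (h : Controlled N wt f) (hwt : ∃ K, 0 ≤ K ∧ ∀ x, wt x ≤ K * wt' x) :
    Controlled N wt' f := by
  obtain ⟨h1, C, hC, h⟩ := h
  obtain ⟨K, hK, hwt⟩ := hwt
  refine ⟨h1, C * K, by positivity, fun i x => (h i x).mono zero_le_one le_rfl ?_⟩
  rw [mul_assoc]
  exact mul_le_mul_of_nonneg_left (hwt x) hC

theorem mono_le (h : Controlled N wt f) (hwt : ∀ x, wt x ≤ wt' x) : Controlled N wt' f :=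
  h.mono ⟨1, zero_le_one, fun x => by rw [one_mul]; exact hwt x⟩

theorem add {g : ι → V → F} (hf : Controlled N wt f) (hg : Controlled N wt g) :
    Controlled N wt fun i x => f i x + g i x := by
  obtain ⟨h1, C, hC, h⟩ := hf
  obtain ⟨h1', C', hC', h'⟩ := hg
  refine ⟨fun i => (h1 i).add (h1' i), C + C', by positivity, fun i x => ?_⟩
  rw [add_mul]
  exact (h i x).add (h1 i) (h1' i) (h' i x)

theorem sum {α : Type*} (s : Finset α) {f : α → ι → V → F} (hf : ∀ a ∈ s, Controlled N wt (f a)) :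
    Controlled N wt fun i x => ∑ a ∈ s, f a i x := by
  choose! h1 C hC h using hf
  refine ⟨fun i => ContDiff.sum fun a ha => h1 a ha i, ∑ a ∈ s, C a,
    Finset.sum_nonneg fun a ha => hC a ha, fun i x => ?_⟩
  rw [Finset.sum_mul]
  exact JetBound.sum s (fun a ha => h1 a ha i) fun a ha => h a ha i x

theorem bilin {H : Type*} [NormedAddCommGroup H] [NormedSpace ℝ H] {g : ι → V → G}
    (B : F →L[ℝ] G →L[ℝ] H) (hB : ‖B‖ ≤ 1) (hf : Controlled N wt f) (hg : Controlled N wt' g) :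
    Controlled N (fun x => wt x * wt' x) fun i x => B (f i x) (g i x) := by
  obtain ⟨h1, C, hC, h⟩ := hf
  obtain ⟨h1', C', hC', h'⟩ := hg
  refine ⟨fun i => B.isBoundedBilinearMap.contDiff.comp ((h1 i).prodMk (h1' i)),
    2 ^ N * (C * C'), by positivity, fun i x => ?_⟩
  refine ((h i x).bilin B hB zero_le_one (h1 i) (h1' i) (h' i x)).mono zero_le_one le_rfl
    (le_of_eq ?_)
  ring

theorem mul {f g : ι → V → ℝ} (hf : Controlled N wt f) (hg : Controlled N wt' g) :
    Controlled N (fun x => wt x * wt' x) fun i x => f i x * g i x :=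
  hf.bilin (ContinuousLinearMap.mul ℝ ℝ) (ContinuousLinearMap.opNorm_mul_le _ _) hg

theorem smul {f : ι → V → ℝ} {g : ι → V → F} (hf : Controlled N wt f) (hg : Controlled N wt' g) :
    Controlled N (fun x => wt x * wt' x) fun i x => f i x • g i x :=
  hf.bilin (ContinuousLinearMap.lsmul ℝ ℝ) ContinuousLinearMap.opNorm_lsmul_le hg

theorem const (c : F) : Controlled N (fun _ : V => 1) fun (_ : ι) (_ : V) => c :=
  ⟨fun _ => contDiff_const, ‖c‖, norm_nonneg _, fun _ _ =>
    JetBound.const c zero_le_one (by rw [mul_one])⟩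

theorem const_mul {f : ι → V → ℝ} (c : ℝ) (hf : Controlled N wt f) :
    Controlled N wt fun i x => c * f i x :=
  ((const c).mul hf).mono_le fun x => by rw [one_mul]

theorem neg {f : ι → V → ℝ} (hf : Controlled N wt f) : Controlled N wt fun i x => -f i x := by
  simpa using hf.const_mul (-1)

theorem sub {f g : ι → V → ℝ} (hf : Controlled N wt f) (hg : Controlled N wt g) :
    Controlled N wt fun i x => f i x - g i x := by
  simpa [sub_eq_add_neg] using hf.add hg.neg

theorem prod {α : Type*} (s : Finset α) {f : α → ι → V → ℝ}
    (hf : ∀ a ∈ s, Controlled N (fun _ => 1) (f a)) :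
    Controlled N (fun _ => 1) fun i x => ∏ a ∈ s, f a i x := by
  classical
  induction s using Finset.induction_on with
  | empty => simpa using const (ι := ι) (V := V) (N := N) (1 : ℝ)
  | insert a s ha ih =>
    simp only [Finset.prod_insert ha]
    exact ((hf a (Finset.mem_insert_self _ _)).mul
      (ih fun b hb => hf b (Finset.mem_insert_of_mem hb))).mono_le fun x => by simp

theorem comp_clm {U : Type*} [NormedAddCommGroup U] [NormedSpace ℝ U] (L : U →L[ℝ] V)
    (hL : ‖L‖ ≤ 1) (hf : Controlled N wt f) :
    Controlled N (fun x => wt (L x)) fun i x => f i (L x) := by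
  obtain ⟨h1, C, hC, h⟩ := hf
  exact ⟨fun i => (h1 i).comp L.contDiff, C, hC, fun i x =>
    (h i (L x)).comp_clm_of_le_one L hL (h1 i) zero_le_one⟩

theorem reindex {ι' : Type*} (r : ι' → ι) (hf : Controlled N wt f) :
    Controlled N wt fun i x => f (r i) x :=
  ⟨fun i => hf.1 (r i), hf.2.imp fun _ h => ⟨h.1, fun i x => h.2 (r i) x⟩⟩

theorem fderiv (hf : Controlled (N + 1) wt f) :
    Controlled N wt fun i x => _root_.fderiv ℝ (f i) x := by
  obtain ⟨h1, C, hC, h⟩ := hf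
  exact ⟨fun i => (h1 i).fderiv_right (by exact_mod_cast le_rfl), C, hC, fun i x => by
    simpa using (h i x).fderiv⟩

/-- Composition with a map whose derivatives of positive order are bounded by `ρ ≥ 1`. -/
theorem comp {U : Type*} [NormedAddCommGroup U] [NormedSpace ℝ U] {g : ι → U → V} {ρ : U → ℝ}
    (hf : Controlled N (fun _ => 1) f) (hg : ∀ i, ContDiff ℝ N (g i)) {K : ℝ} (hK : 1 ≤ K)
    (hρ : ∀ x, 1 ≤ ρ x)
    (hgb : ∀ i x j, 1 ≤ j → j ≤ N → ‖iteratedFDeriv ℝ j (g i) x‖ ≤ (K * ρ x) ^ j) :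
    Controlled N (fun x => ρ x ^ N) fun i x => f i (g i x) := by
  obtain ⟨h1, C, hC, h⟩ := hf
  refine ⟨fun i => (h1 i).comp (hg i), K ^ N * (N.factorial * C), by positivity, fun i x => ?_⟩
  have hK1 : 1 ≤ K * ρ x := one_le_mul_of_one_le_of_one_le hK (hρ x)
  have h2 : JetBound N 1 C (f i) (g i x) := by simpa using h i (g i x)
  have h3 := JetBound.comp (h1 i) (hg i) h2 (hgb i x) (zero_le_one.trans hK1)
  refine ((JetBound.absorb (κ := 1) hK1 zero_le_one (by rwa [mul_one]))).mono zero_le_one le_rfl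
    (le_of_eq ?_)
  ring

end Controlled

theorem iteratedDeriv_exp_neg (n : ℕ) :
    iteratedDeriv n (fun x => Real.exp (-x)) = fun x => (-1) ^ n * Real.exp (-x) := by
  induction n with
  | zero => simp
  | succ n ih =>
    rw [iteratedDeriv_succ, ih]
    ext x
    have := ((hasDerivAt_id x).neg.exp).const_mul ((-1 : ℝ) ^ n)
    refine (this.congr_deriv ?_).deriv
    simp
    ring

/-- A function `exp (-q)` is bounded by the exponential of a lower bound of `q`; each derivative
costs a factor of the size of the derivatives of `q`. -/
theorem Controlled.exp_neg {N : ℕ} {q : ι → V → ℝ} {ρ g : V → ℝ} (hq : Controlled N ρ q)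
    (hρ : ∀ x, 1 ≤ ρ x) (hg : ∀ i x, g x ≤ q i x) :
    Controlled N (fun x => ρ x ^ N * Real.exp (-g x)) fun i x => Real.exp (-q i x) := by
  obtain ⟨h1, C, hC, h⟩ := hq
  have hexp : ContDiff ℝ N fun x : ℝ => Real.exp (-x) := by fun_prop
  refine ⟨fun i => hexp.comp (h1 i), (1 + C) ^ N * N.factorial, by positivity, fun i x => ?_⟩
  have hρx := hρ x
  have hD1 : 1 ≤ (1 + C) * ρ x := one_le_mul_of_one_le_of_one_le (by linarith) hρx
  have hout : JetBound N 1 (Real.exp (-q i x)) (fun x : ℝ => Real.exp (-x)) (q i x) := fun j _ => by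
    rw [norm_iteratedFDeriv_eq_norm_iteratedDeriv, iteratedDeriv_exp_neg]
    simp
  have h3 := JetBound.comp (f := q i) hexp (h1 i) hout (D := (1 + C) * ρ x)
    (fun j hj hjN => by
      have h2 := h i x j hjN
      rw [one_pow, mul_one] at h2
      calc _ ≤ C * ρ x := h2
        _ ≤ (1 + C) * ρ x := by nlinarith
        _ ≤ _ := le_self_pow₀ hD1 (Nat.one_le_iff_ne_zero.mp hj)) (by positivity)
  refine (JetBound.absorb (κ := 1) hD1 zero_le_one (by rwa [mul_one])).mono zero_le_one le_rfl ?_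
  calc _ = (1 + C) ^ N * N.factorial * (ρ x ^ N * Real.exp (-q i x)) := by rw [mul_pow]; ring
    _ ≤ (1 + C) ^ N * N.factorial * (ρ x ^ N * Real.exp (-g x)) := by
      have := hg i x
      have h0 : 0 ≤ ρ x := by linarith
      gcongr

/-- The power `-1/2` of functions bounded from below: its derivative is `-½ u³ Df`, where `u` is
the power itself. -/
theorem Controlled.rpow_neg_half {f : ι → V → ℝ} (hf : ∀ N, Controlled N (fun _ => 1) f) {c : ℝ}
    (hc : 0 < c) (hfc : ∀ i x, c ≤ f i x) (N : ℕ) :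
    Controlled N (fun _ => 1) fun i x => f i x ^ (-(1 : ℝ) / 2) := by
  have hpos : ∀ i x, 0 < f i x := fun i x => hc.trans_le (hfc i x)
  have hsm : ∀ N : ℕ, ∀ i, ContDiff ℝ N fun x => f i x ^ (-(1 : ℝ) / 2) := fun N i =>
    ((hf N).1 i).rpow_const_of_ne fun x => (hpos i x).ne'
  have hb : ∀ i x, ‖f i x ^ (-(1 : ℝ) / 2)‖ ≤ c ^ (-(1 : ℝ) / 2) := fun i x => by
    rw [Real.norm_of_nonneg (Real.rpow_nonneg (hpos i x).le _)]
    exact Real.rpow_le_rpow_of_nonpos hc (hfc i x) (by norm_num)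
  have hc0 : 0 ≤ c ^ (-(1 : ℝ) / 2) := Real.rpow_nonneg hc.le _
  induction N with
  | zero =>
    refine ⟨hsm 0, _, hc0, fun i x j hj => ?_⟩
    obtain rfl : j = 0 := by omega
    simpa using hb i x
  | succ N ih =>
    have hD : ∀ i x, _root_.fderiv ℝ (fun x => f i x ^ (-(1 : ℝ) / 2)) x =
        ((-(1 : ℝ) / 2) * (f i x ^ (-(1 : ℝ) / 2) * (f i x ^ (-(1 : ℝ) / 2) *
          f i x ^ (-(1 : ℝ) / 2)))) • _root_.fderiv ℝ (f i) x := fun i x => by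
      have h1 := ((((hf 1).1 i).differentiable one_ne_zero x).hasFDerivAt.rpow_const
        (p := -(1 : ℝ) / 2) (Or.inl (hpos i x).ne')).fderiv
      rw [h1, ← Real.rpow_add (hpos i x), ← Real.rpow_add (hpos i x),
        show -(1 : ℝ) / 2 + (-(1 : ℝ) / 2 + -(1 : ℝ) / 2) = -(1 : ℝ) / 2 - 1 by norm_num]
    have h3 := (((ih.mul (ih.mul ih)).const_mul (-(1 : ℝ) / 2)).smul (hf (N + 1)).fderiv).mono_le
      (wt' := fun _ => 1) fun x => by simp
    obtain ⟨_, C, hC, h⟩ := h3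
    refine ⟨hsm (N + 1), max C (c ^ (-(1 : ℝ) / 2)), le_max_of_le_left hC, fun i x =>
      JetBound.of_fderiv ((hb i x).trans (by simp)) ?_⟩
    rw [show _root_.fderiv ℝ (fun x => f i x ^ (-(1 : ℝ) / 2)) = _ from funext (hD i)]
    exact (h i x).mono zero_le_one le_rfl (by simp)

theorem Controlled.integral {ι V : Type} [NormedAddCommGroup V] [NormedSpace ℝ V]
    [FiniteDimensional ℝ V] {N : ℕ} {wt : V → ℝ} {f : ι → ℝ → V → ℝ} {K : ℝ} (hwt : ∀ x, wt x ≤ K)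
    (hf : Controlled N wt fun q : ι × Set.Icc (0 : ℝ) 1 => f q.1 q.2)
    (hc : ∀ i x, Continuous fun θ => f i θ x) :
    Controlled N wt fun i x => ∫ θ in Set.Ioo (0 : ℝ) 1, f i θ x := by
  obtain ⟨h1, C, hC, h⟩ := hf
  have key : ∀ i, (fun x => ∫ θ in Set.Ioo (0 : ℝ) 1, f i θ x) =
      fun x => ∫ θ in Set.Ioo (0 : ℝ) 1, f i (Set.projIcc 0 1 zero_le_one θ) x := fun i => by
    ext x
    refine setIntegral_congr_fun measurableSet_Ioo fun θ hθ => ?_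
    simp only [Set.projIcc_of_mem zero_le_one (Set.Ioo_subset_Icc_self hθ)]
  have main := fun i => contDiff_integral_of_dominated
    (μ := volume.restrict (Set.Ioo (0 : ℝ) 1)) (bound := fun _ => C * K)
    (f := fun x θ => f i (Set.projIcc 0 1 zero_le_one θ) x)
    (fun θ => h1 (i, Set.projIcc 0 1 zero_le_one θ))
    (fun x => ((hc i x).comp (continuous_subtype_val.comp
      continuous_projIcc)).aestronglyMeasurable)
    (integrable_const _) (fun j hj x θ => by
      have := h (i, Set.projIcc 0 1 zero_le_one θ) x j hj
      rw [one_pow, mul_one] at this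
      exact this.trans (mul_le_mul_of_nonneg_left (hwt x) hC))
  refine ⟨fun i => (congrArg (ContDiff ℝ N) (key i)).mpr (main i).1, C, hC, fun i x j hj => ?_⟩
  simp only [key i]
  refine ((main i).2 j hj x (fun _ => C * wt x * 1 ^ j) (integrable_const _)
    fun θ => h (i, Set.projIcc 0 1 zero_le_one θ) x j hj).trans ?_
  simp

end Controlled

/-! ### Uniform bounds for the profiles of the parametrix and of its error -/

theorem Controlled.det {ι V : Type*} [NormedAddCommGroup V] [NormedSpace ℝ V] {n N : ℕ}
    {M : ι → V → Matrix (Fin n) (Fin n) ℝ}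
    (h : ∀ j k, Controlled N (fun _ => 1) fun i x => M i x j k) :
    Controlled N (fun _ => 1) fun i x => (M i x).det := by
  simp only [Matrix.det_apply']
  exact Controlled.sum _ fun σ _ => (Controlled.prod _ fun j _ => h (σ j) j).const_mul _

/-- The determinant of a symmetric matrix bounded from below by `l` is at least `l ^ n`. -/
theorem pow_le_det {n : ℕ} {M : Matrix (Fin n) (Fin n) ℝ} (hs : M.IsSymm) {l : ℝ} (hl : 0 ≤ l)
    (h : ∀ ξ : EuclideanSpace ℝ (Fin n), l * ‖ξ‖ ^ 2 ≤ ∑ i, ∑ j, M i j * ξ i * ξ j) :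
    l ^ n ≤ M.det := by
  have hM : M.IsHermitian := by
    rw [Matrix.IsHermitian, Matrix.conjTranspose_eq_transpose_of_trivial, hs.eq]
  rw [hM.det_eq_prod_eigenvalues]
  have h1 : ∀ i, l ≤ hM.eigenvalues i := fun i => by
    have h2 := h (hM.eigenvectorBasis i)
    rw [hM.eigenvectorBasis.orthonormal.1 i, one_pow, mul_one] at h2
    rw [hM.eigenvalues_eq i]
    refine h2.trans (le_of_eq ?_)
    simp only [dotProduct, Matrix.mulVec, Finset.mul_sum, Pi.star_apply, star_trivial,
      RCLike.re_to_real]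
    exact Finset.sum_congr rfl fun a _ => Finset.sum_congr rfl fun b _ => by ring
  have h3 := Finset.prod_le_prod (s := Finset.univ) (fun i _ => hl) fun i _ => h1 i
  simpa using h3

namespace Coefficients

open SpaceTime

variable {d : ℕ}

/-- A family of coefficients, indexed by `ι` and depending on a real parameter, that satisfies the
assumptions on symmetry, ellipticity and smoothness, the last one jointly in the space-time point
and in the parameter, with constants that do not depend on the index. -/
structure UniformlyRegular {ι : Type*} (𝒜 : ι → ℝ → Coefficients d) : Prop where
  symm : ∀ i τ z, ((𝒜 i τ).a z).IsSymm
  elliptic : ∃ l₀ l₁ : ℝ, 0 < l₀ ∧ 0 < l₁ ∧ ∀ i τ z (ξ : EuclideanSpace ℝ (Fin d)),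
    l₀ * ‖ξ‖ ^ 2 ≤ ∑ j, ∑ k, (𝒜 i τ).a z j k * ξ j * ξ k ∧
      ∑ j, ∑ k, (𝒜 i τ).a z j k * ξ j * ξ k ≤ l₁ * ‖ξ‖ ^ 2
  a_controlled : ∀ j k N, Controlled N (fun _ => 1)
    fun i (x : SpaceTime d × ℝ) => (𝒜 i x.2).a x.1 j k
  b_controlled : ∀ j N, Controlled N (fun _ => 1) fun i (x : SpaceTime d × ℝ) => (𝒜 i x.2).b x.1 j
  c_controlled : ∀ N, Controlled N (fun _ => 1) fun i (x : SpaceTime d × ℝ) => (𝒜 i x.2).c x.1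

theorem sum_mul_self_eq_theta {A : Coefficients d} {w : SpaceTime d}
    (hdet : IsUnit (A.a w).det) (ξ : EuclideanSpace ℝ (Fin d)) {l : ℝ}
    (h : ∀ ξ : EuclideanSpace ℝ (Fin d), 0 ≤ ∑ j, ∑ k, A.a w j k * ξ j * ξ k)
    (hl : 0 < l) (h' : ∑ j, ∑ k, A.a w j k * ξ j * ξ k ≤ l * ‖ξ‖ ^ 2) (hs : (A.a w).IsSymm) :
    ‖ξ‖ ^ 2 / l ≤ A.theta w ξ := by
  -- The quadratic form is nonnegative at `a⁻¹ ξ - ξ / l`.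
  let y : EuclideanSpace ℝ (Fin d) := WithLp.toLp 2 fun i => A.invMul w ξ i
  have h1 := h (y - l⁻¹ • ξ)
  have hy : ∀ i, y i = A.invMul w ξ i := fun _ => rfl
  have h2 : ∀ i, ∑ j, A.a w i j * A.invMul w ξ j = ξ i := fun i => by
    have : (A.a w).mulVec ((A.a w)⁻¹.mulVec ξ.ofLp) = ξ.ofLp := by
      rw [Matrix.mulVec_mulVec, Matrix.mul_nonsing_inv _ hdet, Matrix.one_mulVec]
    exact congrFun this i
  have h3 : ∑ j, ∑ k, A.a w j k * ξ j * A.invMul w ξ k = ‖ξ‖ ^ 2 := by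
    rw [EuclideanSpace.real_norm_sq_eq]
    refine Finset.sum_congr rfl fun i _ => ?_
    rw [sq]
    nth_rewrite 3 [← h2 i]
    rw [Finset.mul_sum]
    exact Finset.sum_congr rfl fun j _ => by ring
  have h4 : ∑ j, ∑ k, A.a w j k * A.invMul w ξ j * ξ k = ‖ξ‖ ^ 2 := by
    rw [← h3, Finset.sum_comm]
    refine Finset.sum_congr rfl fun i _ => Finset.sum_congr rfl fun j _ => ?_
    rw [hs.apply i j]
    ring
  have h5 : ∑ j, ∑ k, A.a w j k * (y - l⁻¹ • ξ) j * (y - l⁻¹ • ξ) k =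
      A.theta w ξ - l⁻¹ * ‖ξ‖ ^ 2 - l⁻¹ * ‖ξ‖ ^ 2 +
        l⁻¹ ^ 2 * ∑ j, ∑ k, A.a w j k * ξ j * ξ k := by
    nth_rewrite 1 [← h4]
    rw [← h3, ← sum_mul_invMul hdet]
    simp only [Finset.mul_sum, ← Finset.sum_sub_distrib, ← Finset.sum_add_distrib]
    refine Finset.sum_congr rfl fun i _ => Finset.sum_congr rfl fun j _ => ?_
    simp only [PiLp.sub_apply, PiLp.smul_apply, smul_eq_mul, hy]
    ring
  rw [h5] at h1
  have h6 : l⁻¹ ^ 2 * ∑ j, ∑ k, A.a w j k * ξ j * ξ k ≤ l⁻¹ * ‖ξ‖ ^ 2 := by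
    calc _ ≤ l⁻¹ ^ 2 * (l * ‖ξ‖ ^ 2) := mul_le_mul_of_nonneg_left h' (by positivity)
      _ = _ := by field_simp
  rw [div_eq_inv_mul]
  linarith

theorem fderiv_slice {F : Type*} [NormedAddCommGroup F] [NormedSpace ℝ F]
    {f : SpaceTime d × ℝ → F} (hf : ContDiff ℝ 1 f) (w : SpaceTime d) (τ : ℝ) (p : SpaceTime d) :
    fderiv ℝ (fun z => f (z, τ)) w p = fderiv ℝ f (w, τ) (p, 0) := by
  have h1 : HasFDerivAt (fun z : SpaceTime d => (z, τ))
      (ContinuousLinearMap.inl ℝ (SpaceTime d) ℝ) w := hasFDerivAt_prodMk_left w τ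
  have h2 := ((hf.differentiable one_ne_zero (w, τ)).hasFDerivAt.comp w h1).fderiv
  rw [Function.comp_def] at h2
  rw [h2]
  simp

variable {ι : Type}

/-- Evaluation along the segment from `w` to the displaced point. -/
theorem _root_.Controlled.comp_shift {F : Type*} [NormedAddCommGroup F] [NormedSpace ℝ F] {N : ℕ}
    {f : ι → SpaceTime d × ℝ → F} (hf : Controlled N (fun _ => 1) f) :
    Controlled N (fun x : SpaceTime d × (SpaceTime d × ℝ) => (1 + ‖x.1‖) ^ N)
      fun (q : ι × Set.Icc (0 : ℝ) 1) x =>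
        f q.1 (x.2.1 + ((q.2 : ℝ) * x.1.2) • x.1, x.2.2) := by
  let S : SpaceTime d × (SpaceTime d × ℝ) →L[ℝ] SpaceTime d × ℝ :=
    (ContinuousLinearMap.inl ℝ _ _).comp (ContinuousLinearMap.fst ℝ _ _)
  let T : SpaceTime d × (SpaceTime d × ℝ) →L[ℝ] ℝ :=
    (ContinuousLinearMap.snd ℝ _ ℝ).comp (ContinuousLinearMap.fst ℝ _ _)
  let L : SpaceTime d × (SpaceTime d × ℝ) →L[ℝ] SpaceTime d × ℝ := ContinuousLinearMap.snd ℝ _ _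
  have hS : ∀ x, ‖S x‖ = ‖x.1‖ := fun x => by
    have : S x = (x.1, 0) := rfl
    rw [this, Prod.norm_def]
    simp
  have hT : ∀ (θ : Set.Icc (0 : ℝ) 1) x, ‖((θ : ℝ) • T) x‖ ≤ ‖x.1‖ := fun θ x => by
    rw [_root_.smul_apply, norm_smul, Real.norm_of_nonneg θ.2.1]
    exact (mul_le_of_le_one_left (norm_nonneg _) θ.2.2).trans (norm_snd_le x.1)
  have e : ∀ q : ι × Set.Icc (0 : ℝ) 1, (fun x : SpaceTime d × (SpaceTime d × ℝ) =>
      (x.2.1 + ((q.2 : ℝ) * x.1.2) • x.1, x.2.2)) = fun x => L x + ((q.2 : ℝ) • T) x • S x :=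
    fun q => by
      ext1 x
      refine Prod.ext ?_ ?_ <;> simp [L, S, T]
  have h := Controlled.comp (hf.reindex (Prod.fst : ι × Set.Icc (0 : ℝ) 1 → ι))
    (g := fun q x => L x + ((q.2 : ℝ) • T) x • S x) (ρ := fun x => 1 + ‖x.1‖) (K := 2 ^ N + 1)
    (fun q => L.contDiff.add ((((q.2 : ℝ) • T).contDiff).smul S.contDiff))
    (by have : (0 : ℝ) ≤ 2 ^ N := by positivity
        linarith) (fun x => by linarith [norm_nonneg x.1])
    (fun q x j hj hjN => norm_iteratedFDeriv_add_smul_le L S ((q.2 : ℝ) • T)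
      (ContinuousLinearMap.norm_snd_le ..)
      (ContinuousLinearMap.opNorm_le_bound _ zero_le_one fun x => by
        rw [one_mul, hS]; exact norm_fst_le x)
      (ContinuousLinearMap.opNorm_le_bound _ zero_le_one fun x => by
        rw [one_mul]; exact (hT q.2 x).trans (norm_fst_le x))
      (norm_nonneg _) (hS x).le (hT q.2 x) hj hjN)
  refine Eq.mp (congrArg (Controlled N _) ?_) h
  ext1 q
  ext1 x
  exact congrArg (f q.1) (congrFun (e q) x).symm

/-- Functions of the displacement, the base point and the parameter that are bounded, with their
derivatives, by a polynomial in the displacement times the Gaussian weight. -/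
theorem _root_.Controlled.absorb_pow {N m : ℕ} {a : ℝ} (ha : 0 < a)
    {f : ι → SpaceTime d × (SpaceTime d × ℝ) → ℝ}
    (hf : Controlled N (fun x => (1 + ‖x.1‖) ^ m * gaussWeight a x.1) f) :
    Controlled N (fun x => gaussWeight (a / 2) x.1) f := by
  obtain ⟨C, hC, h⟩ := exists_one_add_pow_mul_gaussWeight_le d m (half_pos ha)
  refine hf.mono ⟨C, hC.le, fun x => ?_⟩
  have e : gaussWeight a x.1 = gaussWeight (a / 2) x.1 * gaussWeight (a / 2) x.1 := by
    unfold gaussWeight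
    rw [← Real.exp_add]
    ring_nf
  rw [e, ← mul_assoc]
  exact mul_le_mul_of_nonneg_right (h x.1) (gaussWeight_pos _ _).le

theorem _root_.Controlled.clm_fst {N : ℕ} (L : SpaceTime d →L[ℝ] ℝ) :
    Controlled N (fun x : SpaceTime d × (SpaceTime d × ℝ) => 1 + ‖x.1‖)
      fun (_ : ι) x => L x.1 := by
  refine ⟨fun _ => L.contDiff.comp contDiff_fst, ‖L‖, norm_nonneg _, fun _ x => ?_⟩
  refine JetBound.comp_fst (g := fun p => L p) L.contDiff zero_le_one
    (JetBound.clm (x := x.1) L zero_le_one ?_ ?_)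
  · refine (L.le_opNorm _).trans (mul_le_mul_of_nonneg_left ?_ (norm_nonneg _))
    exact le_add_of_nonneg_left zero_le_one
  · rw [mul_one]
    exact le_mul_of_one_le_right (norm_nonneg _) (by linarith [norm_nonneg x.1])

namespace UniformlyRegular

variable {𝒜 : ι → ℝ → Coefficients d}

theorem exists_le_det (h : UniformlyRegular 𝒜) : ∃ c : ℝ, 0 < c ∧ ∀ i τ z,
    c ≤ ((𝒜 i τ).a z).det := by
  obtain ⟨l₀, l₁, h0, h1, hl⟩ := h.elliptic
  exact ⟨l₀ ^ d, by positivity, fun i τ z => pow_le_det (h.symm i τ z) h0.le fun ξ => (hl i τ z ξ).1⟩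

theorem isUnit_det (h : UniformlyRegular 𝒜) (i : ι) (τ : ℝ) (z : SpaceTime d) :
    IsUnit ((𝒜 i τ).a z).det := by
  obtain ⟨c, hc, hdet⟩ := h.exists_le_det
  exact (hc.trans_le (hdet i τ z)).ne'.isUnit

theorem controlled_rpow_det (h : UniformlyRegular 𝒜) (N : ℕ) :
    Controlled N (fun _ => 1) fun i (x : SpaceTime d × ℝ) =>
      ((𝒜 i x.2).a x.1).det ^ (-(1 : ℝ) / 2) := by
  obtain ⟨c, hc, hdet⟩ := h.exists_le_det
  exact Controlled.rpow_neg_half (fun N => Controlled.det fun j k => h.a_controlled j k N) hc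
    (fun i x => hdet i x.2 x.1) N

theorem controlled_inv (h : UniformlyRegular 𝒜) (j k : Fin d) (N : ℕ) :
    Controlled N (fun _ => 1) fun i (x : SpaceTime d × ℝ) => ((𝒜 i x.2).a x.1)⁻¹ j k := by
  obtain ⟨c, hc, hdet⟩ := h.exists_le_det
  have h1 := (h.controlled_rpow_det N).mul (h.controlled_rpow_det N)
  have h2 : Controlled N (fun _ => 1) fun i (x : SpaceTime d × ℝ) =>
      ((𝒜 i x.2).a x.1).adjugate j k := by
    simp only [Matrix.adjugate_apply]
    refine Controlled.det fun a b => ?_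
    simp only [Matrix.updateRow_apply]
    split_ifs
    · exact Controlled.const _
    · exact h.a_controlled a b N
  refine Controlled.mono_le (wt' := fun _ => 1) ?_ fun x => le_rfl
  have h3 := (h1.mul h2).mono_le (wt' := fun _ => 1) fun x => by simp
  have e : (fun i (x : SpaceTime d × ℝ) => ((𝒜 i x.2).a x.1)⁻¹ j k) = fun i x =>
      ((𝒜 i x.2).a x.1).det ^ (-(1 : ℝ) / 2) * ((𝒜 i x.2).a x.1).det ^ (-(1 : ℝ) / 2) *
        ((𝒜 i x.2).a x.1).adjugate j k := by
    ext i x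
    have hp : 0 < ((𝒜 i x.2).a x.1).det := hc.trans_le (hdet i x.2 x.1)
    rw [← Real.rpow_add hp, Matrix.inv_def, Ring.inverse_eq_inv', Matrix.smul_apply, smul_eq_mul]
    congr 1
    norm_num [Real.rpow_neg_one]
  rw [e]
  exact h3

theorem controlled_snd {N : ℕ} {f : ι → SpaceTime d × ℝ → ℝ} (hf : Controlled N (fun _ => 1) f) :
    Controlled N (fun _ => 1) fun i (x : SpaceTime d × (SpaceTime d × ℝ)) => f i x.2 :=
  hf.comp_clm (ContinuousLinearMap.snd ℝ (SpaceTime d) (SpaceTime d × ℝ))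
    (ContinuousLinearMap.norm_snd_le ..)

theorem controlled_coord (N : ℕ) (j : Fin d) :
    Controlled N (fun x => 1 + ‖x.1‖)
      fun (_ : ι) (x : SpaceTime d × (SpaceTime d × ℝ)) => x.1.1 j :=
  Controlled.clm_fst ((EuclideanSpace.proj j).comp (ContinuousLinearMap.fst ℝ _ ℝ))

theorem controlled_invMul (h : UniformlyRegular 𝒜) (j : Fin d) (N : ℕ) :
    Controlled N (fun x => 1 + ‖x.1‖)
      fun i (x : SpaceTime d × (SpaceTime d × ℝ)) => (𝒜 i x.2.2).invMul x.2.1 x.1.1 j :=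
  Controlled.sum _ fun k _ => ((controlled_snd (h.controlled_inv j k N)).mul
    (controlled_coord N k)).mono_le fun x => by rw [one_mul]

theorem controlled_exponent (h : UniformlyRegular 𝒜) (N : ℕ) :
    Controlled N (fun x => (1 + ‖x.1‖) ^ 2) fun i (x : SpaceTime d × (SpaceTime d × ℝ)) =>
      (𝒜 i x.2.2).theta x.2.1 x.1.1 / 4 + x.1.2 ^ 2 := by
  simp only [theta_eq_sum_invMul, div_eq_inv_mul, sq]
  refine Controlled.add (Controlled.const_mul _ (Controlled.sum _ fun j _ =>
    (controlled_coord N j).mul (h.controlled_invMul j N))) ?_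
  have := Controlled.clm_fst (ι := ι) (N := N) (ContinuousLinearMap.snd ℝ (EuclideanSpace ℝ (Fin d)) ℝ)
  exact this.mul this

/-- The profile of the parametrix decays like a Gaussian. -/
theorem controlled_parametrixProfile_aux (h : UniformlyRegular 𝒜) : ∃ a : ℝ, 0 < a ∧ ∀ N,
    Controlled N (fun x => (1 + ‖x.1‖) ^ (2 * N) * gaussWeight a x.1)
      fun i (x : SpaceTime d × (SpaceTime d × ℝ)) =>
        (𝒜 i x.2.2).parametrixProfile x.1 x.2.1 := by
  obtain ⟨l₀, l₁, h0, h1, hl⟩ := h.elliptic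
  refine ⟨min (1 / (4 * l₁)) 1, by positivity, fun N => ?_⟩
  have hexp := (h.controlled_exponent N).exp_neg
    (g := fun x => min (1 / (4 * l₁)) 1 * (‖x.1.1‖ ^ 2 + x.1.2 ^ 2))
    (fun x => one_le_pow₀ (by linarith [norm_nonneg x.1])) (fun i x => by
      have h2 := sum_mul_self_eq_theta (h.isUnit_det i x.2.2 x.2.1) x.1.1
        (fun ξ => le_trans (by positivity) (hl i x.2.2 x.2.1 ξ).1) h1
        (hl i x.2.2 x.2.1 x.1.1).2 (h.symm i x.2.2 x.2.1)
      rw [mul_add]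
      refine add_le_add ?_ ?_
      · calc _ ≤ 1 / (4 * l₁) * ‖x.1.1‖ ^ 2 :=
            mul_le_mul_of_nonneg_right (min_le_left _ _) (by positivity)
          _ = ‖x.1.1‖ ^ 2 / l₁ / 4 := by field_simp
          _ ≤ _ := by linarith
      · exact mul_le_of_le_one_left (by positivity) (min_le_right _ _))
  refine (((controlled_snd (h.controlled_rpow_det N)).const_mul
    ((4 * Real.pi) ^ (-(d : ℝ) / 2))).mul hexp).mono_le fun x => le_of_eq ?_
  rw [one_mul, ← pow_mul]
  rfl

theorem controlled_comp_shift {N : ℕ} {f : ι → SpaceTime d × ℝ → ℝ}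
    (hf : Controlled N (fun _ => 1) f) :
    Controlled N (fun x => (1 + ‖x.1‖) ^ N)
      fun i (x : SpaceTime d × (SpaceTime d × ℝ)) => f i (shift x.2.1 x.1, x.2.2) := by
  have := hf.comp_shift.reindex fun i : ι => (i, (⟨1, by simp⟩ : Set.Icc (0 : ℝ) 1))
  simpa [shift] using this

/-- The profiles of the parametrix and of its error are uniformly bounded, with all derivatives, by a
Gaussian: up to this factor they are polynomials in the displacement with bounded coefficients. -/
theorem exists_controlled_profiles (h : UniformlyRegular 𝒜) : ∃ a : ℝ, 0 < a ∧ ∀ N,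
    Controlled N (fun x => gaussWeight a x.1) (fun i (x : SpaceTime d × (SpaceTime d × ℝ)) =>
        (𝒜 i x.2.2).parametrixProfile x.1 x.2.1) ∧
    Controlled N (fun x => gaussWeight a x.1) (fun i (x : SpaceTime d × (SpaceTime d × ℝ)) =>
        (𝒜 i x.2.2).errorProfile x.1 x.2.1) := by
  obtain ⟨a, ha, hg⟩ := h.controlled_parametrixProfile_aux
  refine ⟨a / 2, half_pos ha, fun N => ⟨(hg N).absorb_pow ha, ?_⟩⟩
  have hone : ∀ x : SpaceTime d × (SpaceTime d × ℝ), 1 ≤ 1 + ‖x.1‖ := fun x => by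
    linarith [norm_nonneg x.1]
  refine Controlled.add (Controlled.sub (Controlled.sum _ fun j _ => Controlled.sum _ fun k _ => ?_)
    (Controlled.sum _ fun j _ => ?_)) ?_
  · have hq : Controlled N (fun x => (1 + ‖x.1‖) ^ 2)
        fun i (x : SpaceTime d × (SpaceTime d × ℝ)) =>
          (𝒜 i x.2.2).invMul x.2.1 x.1.1 j * (𝒜 i x.2.2).invMul x.2.1 x.1.1 k / 4
            - ((𝒜 i x.2.2).a x.2.1)⁻¹ j k / 2 := by
      simp only [div_eq_inv_mul]
      refine Controlled.sub ((((h.controlled_invMul j N).mul (h.controlled_invMul k N)).const_mul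
        _).mono_le fun x => (sq (1 + ‖x.1‖)).ge) (((controlled_snd (h.controlled_inv j k N)).const_mul
        _).mono_le fun x => one_le_pow₀ (hone x))
    have hprof := (hq.mul (hg N)).reindex (Prod.fst : ι × Set.Icc (0 : ℝ) 1 → ι)
    have hfst : Controlled N (fun x => 1 + ‖x.1‖) fun (_ : ι × Set.Icc (0 : ℝ) 1)
        (x : SpaceTime d × (SpaceTime d × ℝ)) => ((x.1, 0) : SpaceTime d × ℝ) := by
      let J : SpaceTime d × (SpaceTime d × ℝ) →L[ℝ] SpaceTime d × ℝ :=
        (ContinuousLinearMap.inl ℝ _ _).comp (ContinuousLinearMap.fst ℝ _ _)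
      have hJ : ∀ x, ‖J x‖ = ‖x.1‖ := fun x => by
        have : J x = (x.1, 0) := rfl
        rw [this, Prod.norm_def]
        simp
      refine ⟨fun _ => J.contDiff, 1, zero_le_one, fun _ x => JetBound.clm J zero_le_one ?_ ?_⟩
      · rw [hJ]
        linarith
      · refine ContinuousLinearMap.opNorm_le_bound _ (by positivity) fun y => ?_
        rw [hJ]
        refine (norm_fst_le y).trans (le_mul_of_one_le_left (norm_nonneg _) ?_)
        linarith [norm_nonneg x.1]
    have hder := ((h.a_controlled j k (N + 1)).fderiv.comp_shift).bilin
      (ContinuousLinearMap.id ℝ (SpaceTime d × ℝ →L[ℝ] ℝ)) ContinuousLinearMap.norm_id_le hfst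
    have hall := (hder.mul hprof).mono_le
      (wt' := fun x => (1 + ‖x.1‖) ^ (N + 1 + 2 + 2 * N) * gaussWeight a x.1)
      fun x => le_of_eq (by ring)
    obtain ⟨K, hK, hKb⟩ := exists_one_add_pow_mul_gaussWeight_le d 0 (half_pos ha)
    -- The difference quotient of the coefficient is an average of derivatives along the segment.
    have hint := Controlled.integral (K := K) (fun x => by simpa using hKb x.1)
      (f := fun i θ (x : SpaceTime d × (SpaceTime d × ℝ)) =>
        fderiv ℝ (fun x : SpaceTime d × ℝ => (𝒜 i x.2).a x.1 j k)
        (x.2.1 + (θ * x.1.2) • x.1, x.2.2) (x.1, 0) * (((𝒜 i x.2.2).invMul x.2.1 x.1.1 j *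
          (𝒜 i x.2.2).invMul x.2.1 x.1.1 k / 4 - ((𝒜 i x.2.2).a x.2.1)⁻¹ j k / 2) *
          (𝒜 i x.2.2).parametrixProfile x.1 x.2.1)) (hall.absorb_pow ha)
      (fun i x => by
        refine Continuous.mul (Continuous.clm_apply ?_ continuous_const) continuous_const
        exact (((h.a_controlled j k 1).1 i).continuous_fderiv one_ne_zero).comp (by fun_prop))
    refine Eq.mp ?_ hint
    congr 1
    ext i x
    rw [integral_mul_const, slope]
    congr 1
    refine integral_congr_ae (Filter.Eventually.of_forall fun θ => ?_)
    exact (fderiv_slice ((h.a_controlled j k 1).1 i) _ _ _).symm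
  · have hb := ((controlled_comp_shift (h.b_controlled j N)).mul
      (((h.controlled_invMul j N).const_mul 2⁻¹).mul (hg N))).mono_le
      (wt' := fun x => (1 + ‖x.1‖) ^ (N + 1 + 2 * N) * gaussWeight a x.1)
      (fun x => le_of_eq (by ring))
    simp only [← div_eq_inv_mul] at hb
    exact hb.absorb_pow ha
  · have hs := Controlled.clm_fst (ι := ι) (N := N)
      (ContinuousLinearMap.snd ℝ (EuclideanSpace ℝ (Fin d)) ℝ)
    have hc := ((controlled_comp_shift (h.c_controlled N)).mul (hs.mul (hg N))).mono_le
      (wt' := fun x => (1 + ‖x.1‖) ^ (N + 1 + 2 * N) * gaussWeight a x.1)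
      (fun x => le_of_eq (by ring))
    exact hc.absorb_pow ha

end UniformlyRegular

end Coefficients

/-! ### Summation of the parametrix series -/

theorem exists_jetBound_of_hasCompactSupport {V F : Type*} [NormedAddCommGroup V]
    [NormedSpace ℝ V] [NormedAddCommGroup F] [NormedSpace ℝ F] {N : ℕ} {f : V → F}
    (hf : ContDiff ℝ N f) (hs : HasCompactSupport f) : ∃ C, 0 ≤ C ∧ ∀ x, JetBound N 1 C f x := by
  have h : ∀ j : ℕ, ∃ C, j ≤ N → ∀ x, ‖iteratedFDeriv ℝ j f x‖ ≤ C := fun j => by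
    by_cases hj : j ≤ N
    · obtain ⟨C, hC⟩ := (hs.iteratedFDeriv j).exists_bound_of_continuous
        (hf.continuous_iteratedFDeriv (by exact_mod_cast hj))
      exact ⟨C, fun _ => hC⟩
    · exact ⟨0, fun h => absurd h hj⟩
  choose C hC using h
  refine ⟨∑ j ∈ Finset.range (N + 1), |C j|, by positivity, fun x j hj => ?_⟩
  rw [one_pow, mul_one]
  exact ((hC j hj x).trans (le_abs_self _)).trans (Finset.single_le_sum (f := fun j => |C j|)
    (fun _ _ => abs_nonneg _) (Finset.mem_range.mpr (Nat.lt_succ_of_le hj)))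

/-- A smooth function with bounded derivatives that is the identity on `[-1, 1]`. -/
theorem exists_truncated_id : ∃ u : ℝ → ℝ, (∀ N : ℕ, ContDiff ℝ N u) ∧
    (∀ N : ℕ, ∃ C, 1 ≤ C ∧ ∀ s, JetBound N 1 C u s) ∧ ∀ s, |s| ≤ 1 → u s = s := by
  let b : ContDiffBump (0 : ℝ) := ⟨1, 2, one_pos, one_lt_two⟩
  have hsm : ∀ N : ℕ, ContDiff ℝ N fun s => s * b s := fun N => contDiff_id.mul b.contDiff
  refine ⟨fun s => s * b s, hsm, fun N => ?_, fun s hs => ?_⟩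
  · obtain ⟨C, hC, h⟩ := exists_jetBound_of_hasCompactSupport (hsm N)
      (b.hasCompactSupport.mul_left (f := fun s : ℝ => s))
    exact ⟨max C 1, le_max_right _ _, fun s => (h s).mono zero_le_one le_rfl (le_max_left _ _)⟩
  · have : b s = 1 := b.one_of_mem_closedBall (by simpa [Metric.mem_closedBall, dist_zero_right] using hs)
    simp [this]

theorem JetBound.pow {V : Type*} [NormedAddCommGroup V] [NormedSpace ℝ V] {N : ℕ} {κ C : ℝ}
    {u : V → ℝ} {x : V} (hκ : 0 ≤ κ) (hu : ContDiff ℝ N u) (h : JetBound N κ C u x) (ν : ℕ) :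
    JetBound N κ ((2 ^ N * C) ^ ν) (fun y => u y ^ ν) x := by
  induction ν with
  | zero => simpa using JetBound.const (x := x) (1 : ℝ) hκ (le_of_eq (by simp) : ‖(1 : ℝ)‖ ≤ 1)
  | succ ν ih =>
    simp only [pow_succ]
    exact (ih.mul hκ (hu.pow ν) hu h).mono hκ le_rfl (le_of_eq (by ring))

theorem tendsto_integral_sin_pow :
    Filter.Tendsto (fun ν : ℕ => ∫ θ in Set.Ioo 0 (Real.pi / 2),
      |2 * (Real.cos θ ^ 0 * Real.sin θ ^ ν)|) Filter.atTop (nhds 0) := by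
  have hpi := Real.pi_pos
  have h := tendsto_integral_of_dominated_convergence
    (μ := volume.restrict (Set.Ioo 0 (Real.pi / 2)))
    (F := fun (ν : ℕ) θ => |2 * (Real.cos θ ^ 0 * Real.sin θ ^ ν)|) (f := fun _ => 0)
    (fun _ => 2) (fun ν => Continuous.aestronglyMeasurable (by fun_prop)) (integrable_const _)
    (fun ν => Filter.Eventually.of_forall fun θ => by
      rw [Real.norm_eq_abs, abs_abs, pow_zero, one_mul, abs_mul, abs_pow, abs_two]
      have := pow_le_one₀ (n := ν) (abs_nonneg _) (Real.abs_sin_le_one θ)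
      linarith)
    ((ae_restrict_mem measurableSet_Ioo).mono fun θ hθ => by
      have h0 : 0 ≤ Real.sin θ := (Real.sin_pos_of_pos_of_lt_pi hθ.1 (by linarith [hθ.2])).le
      have h1 : Real.sin θ < 1 := by
        rw [← Real.sin_pi_div_two]
        exact Real.sin_lt_sin_of_lt_of_le_pi_div_two (by linarith [hθ.1]) le_rfl hθ.2
      have := (((tendsto_pow_atTop_nhds_zero_of_lt_one h0 h1).const_mul 1).const_mul 2).abs
      simpa using this)
  simpa using h

theorem integral_cos_mul_sin_pow_le (ν : ℕ) :
    ∫ θ in Set.Ioo 0 (Real.pi / 2), |2 * (Real.cos θ ^ 1 * Real.sin θ ^ ν)| ≤ Real.pi := by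
  have hpi := Real.pi_pos
  calc _ ≤ ∫ _ in Set.Ioo 0 (Real.pi / 2), (2 : ℝ) := by
        refine integral_mono_of_nonneg (Filter.Eventually.of_forall fun θ => abs_nonneg _)
          (integrable_const _) (Filter.Eventually.of_forall fun θ => ?_)
        simp only [abs_mul, abs_pow, abs_two, pow_one]
        have h1 := pow_le_one₀ (n := ν) (abs_nonneg _) (Real.abs_sin_le_one θ)
        have h2 := mul_le_one₀ (Real.abs_cos_le_one θ) (by positivity) h1
        linarith
    _ = Real.pi := by
        simp only [integral_const, measureReal_restrict_apply_univ, Real.volume_real_Ioo, smul_eq_mul]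
        rw [max_eq_left (by linarith)]
        ring

theorem summable_of_ratio_tendsto_zero {E I : ℕ → ℝ} {k : ℝ}
    (hI : Filter.Tendsto I Filter.atTop (nhds 0)) (h : ∀ ν, E (ν + 1) = k * I ν * E ν) (r : ℝ) :
    Summable fun ν => r ^ ν * E ν := by
  have h1 : Filter.Tendsto (fun ν => |r * (k * I ν)|) Filter.atTop (nhds 0) := by
    simpa using ((hI.const_mul k).const_mul r).abs
  refine summable_of_ratio_norm_eventually_le (r := 1 / 2) (by norm_num) ?_
  filter_upwards [h1.eventually_le_const (show (0 : ℝ) < 1 / 2 by norm_num)] with ν hν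
  have e : r ^ (ν + 1) * E (ν + 1) = (r * (k * I ν)) * (r ^ ν * E ν) := by
    rw [h]
    ring
  rw [e, norm_mul, Real.norm_eq_abs (r * _)]
  exact mul_le_mul_of_nonneg_right hν (norm_nonneg _)

namespace Coefficients

open SpaceTime

variable {d : ℕ} {ι : Type} {𝒜 : ι → ℝ → Coefficients d}

namespace UniformlyRegular

/-- The constants in the bounds for the profiles of the terms of the parametrix series decay
faster than geometrically. -/
theorem exists_term_bounds (h : UniformlyRegular 𝒜) : ∃ a : ℝ, 0 < a ∧ ∀ N : ℕ, ∃ T : ℕ → ℝ,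
    (∀ r : ℝ, Summable fun ν => r ^ ν * T ν) ∧ ∀ ν i,
      ContDiff ℝ N (fun x : SpaceTime d × (SpaceTime d × ℝ) =>
        (𝒜 i x.2.2).termProfile ν x.1 x.2.1) ∧
      ∀ x, JetBound N (1 + ‖x.1‖) (T ν * gaussWeight a x.1)
        (fun x : SpaceTime d × (SpaceTime d × ℝ) => (𝒜 i x.2.2).termProfile ν x.1 x.2.1) x := by
  obtain ⟨a, ha, hprof⟩ := h.exists_controlled_profiles
  refine ⟨a, ha, fun N => ?_⟩
  obtain ⟨⟨hg, A₀, hA₀, hgb⟩, he, A₁, hA₁, heb⟩ := hprof N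
  obtain ⟨K, hK, hcomp⟩ := exists_compose_const d N ha
  have hone : ∀ x : SpaceTime d × (SpaceTime d × ℝ), 1 ≤ 1 + ‖x.1‖ := fun x => by
    linarith [norm_nonneg x.1]
  let I : ℕ → ℝ := fun ν => ∫ θ in Set.Ioo 0 (Real.pi / 2),
    |2 * (Real.cos θ ^ 0 * Real.sin θ ^ ν)|
  -- The constants for the iterated errors: each composition contributes the factor `K A₁ I_ν`.
  let E : ℕ → ℝ := fun ν => Nat.rec A₁ (fun ν e => K * A₁ * I ν * e) ν
  have hI0 : ∀ ν, 0 ≤ I ν := fun ν => integral_nonneg fun θ => abs_nonneg _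
  have hE0 : ∀ ν, 0 ≤ E ν := fun ν => by
    induction ν with
    | zero => exact hA₁
    | succ ν ih => exact mul_nonneg (mul_nonneg (by positivity) (hI0 ν)) ih
  have hEb : ∀ ν i, ContDiff ℝ N (fun x : SpaceTime d × (SpaceTime d × ℝ) =>
        (𝒜 i x.2.2).errorIterProfile ν x.1 x.2.1) ∧
      ∀ x, JetBound N (1 + ‖x.1‖) (E ν * gaussWeight a x.1)
        (fun x : SpaceTime d × (SpaceTime d × ℝ) =>
          (𝒜 i x.2.2).errorIterProfile ν x.1 x.2.1) x := fun ν i => by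
    induction ν with
    | zero => exact ⟨he i, fun x => (heb i x).mono zero_le_one (hone x) le_rfl⟩
    | succ ν ih =>
      obtain ⟨h1, h2⟩ := hcomp (he i) ih.1 (heb i) ih.2
        (c := fun θ => 2 * (Real.cos θ ^ 0 * Real.sin θ ^ ν)) (by fun_prop)
      refine ⟨h1, fun x => (h2 x).mono (zero_le_one.trans (hone x)) le_rfl (le_of_eq ?_)⟩
      change K * A₁ * E ν * I ν * _ = K * A₁ * I ν * E ν * _
      ring
  let T : ℕ → ℝ := fun ν => Nat.casesOn ν A₀ fun ν => K * A₀ * E ν * Real.pi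
  refine ⟨T, fun r => ?_, fun ν i => ?_⟩
  · rw [← summable_nat_add_iff 1]
    refine ((summable_of_ratio_tendsto_zero (E := E) (k := K * A₁) tendsto_integral_sin_pow
      (fun ν => rfl) r).mul_left (r * K * A₀ * Real.pi)).congr fun ν => ?_
    change _ = r ^ (ν + 1) * (K * A₀ * E ν * Real.pi)
    ring
  · cases ν with
    | zero => exact ⟨hg i, fun x => (hgb i x).mono zero_le_one (hone x) le_rfl⟩
    | succ ν =>
      obtain ⟨h1, h2⟩ := hcomp (hg i) (hEb ν i).1 (hgb i) (hEb ν i).2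
        (c := fun θ => 2 * (Real.cos θ ^ 1 * Real.sin θ ^ ν)) (by fun_prop)
      refine ⟨h1, fun x => (h2 x).mono (zero_le_one.trans (hone x)) le_rfl ?_⟩
      have h3 := hE0 ν
      exact mul_le_mul_of_nonneg_right (mul_le_mul_of_nonneg_left
        (integral_cos_mul_sin_pow_le ν) (by positivity)) (gaussWeight_pos _ _).le

theorem contDiff_a (h : UniformlyRegular 𝒜) (i : ι) (τ : ℝ) (j k : Fin d) :
    ContDiff ℝ 1 fun z => (𝒜 i τ).a z j k :=
  ((h.a_controlled j k 1).1 i).comp (contDiff_id.prodMk contDiff_const)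

/-- In parabolic coordinates the fundamental solution is a smooth function of Gaussian decay, up to
the time one. -/
theorem exists_heatKernel_profile (h : UniformlyRegular 𝒜) : ∃ a : ℝ, 0 < a ∧
    ∃ H : ι → SpaceTime d × (SpaceTime d × ℝ) → ℝ,
      (∀ N, Controlled N (fun x => gaussWeight a x.1) H) ∧
      ∀ i τ w (p : SpaceTime d), 0 < p.2 → p.2 ≤ 1 →
        (𝒜 i τ).heatKernel (shift w p) w = Real.exp (p.2 ^ 2) / p.2 ^ d * H i (p, (w, τ)) := by
  obtain ⟨a, ha, hT⟩ := h.exists_term_bounds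
  obtain ⟨u, hu, hub, hu1⟩ := exists_truncated_id
  -- The term of order `ν + 2` carries the factor `s ^ ν`, which is truncated at large `s`.
  refine ⟨a / 2, half_pos ha, fun i x => ∑' ν, u x.1.2 ^ ν * (𝒜 i x.2.2).termProfile ν x.1 x.2.1,
    fun N => ?_, fun i τ w p hp0 hp1 => ?_⟩
  · obtain ⟨T, hsum, hterm⟩ := hT N
    obtain ⟨C, hC, hCb⟩ := hub N
    obtain ⟨M, hM, hMb⟩ := exists_one_add_pow_mul_gaussWeight_le d N (half_pos ha)
    have hhalf : ∀ p : SpaceTime d, gaussWeight a p = gaussWeight (a / 2) p * gaussWeight (a / 2) p :=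
      fun p => by
        unfold gaussWeight
        rw [← Real.exp_add]
        ring_nf
    have hle : ∀ p : SpaceTime d, gaussWeight (a / 2) p ≤ 1 := fun p =>
      Real.exp_le_one_iff.mpr (by have : 0 ≤ a / 2 * (‖p.1‖ ^ 2 + p.2 ^ 2) := by positivity
                                  linarith)
    let π₂ : SpaceTime d × (SpaceTime d × ℝ) →L[ℝ] ℝ :=
      (ContinuousLinearMap.snd ℝ _ ℝ).comp (ContinuousLinearMap.fst ℝ _ _)
    have hπ₂ : ‖π₂‖ ≤ 1 := ContinuousLinearMap.opNorm_le_bound _ zero_le_one fun x => by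
      rw [one_mul]
      exact (norm_snd_le x.1).trans (norm_fst_le x)
    have huc : ContDiff ℝ N fun x : SpaceTime d × (SpaceTime d × ℝ) => u x.1.2 :=
      (hu N).comp π₂.contDiff
    let v : ℕ → ℝ := fun ν => 2 ^ N * ((2 ^ N * C) ^ ν * T ν) * M
    have hv : Summable v := ((hsum (2 ^ N * C)).mul_left (2 ^ N)).mul_right M
    have hb : ∀ i ν x, JetBound N 1 (v ν * gaussWeight (a / 2) x.1)
        (fun x : SpaceTime d × (SpaceTime d × ℝ) =>
          u x.1.2 ^ ν * (𝒜 i x.2.2).termProfile ν x.1 x.2.1) x := fun i ν x => by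
      obtain ⟨h1, h2⟩ := hterm ν i
      have hone : 1 ≤ 1 + ‖x.1‖ := by linarith [norm_nonneg x.1]
      have h3 : JetBound N 1 C (fun x : SpaceTime d × (SpaceTime d × ℝ) => u x.1.2) x :=
        (hCb x.1.2).comp_clm_of_le_one (x := x) π₂ hπ₂ (hu N) zero_le_one
      have h4 := (h3.pow zero_le_one huc ν).mono zero_le_one hone le_rfl
      have h5 := h4.mul (zero_le_one.trans hone) (huc.pow ν) h1 (h2 x)
      have hT0 : 0 ≤ T ν := nonneg_of_mul_nonneg_left (h2 x).nonneg (gaussWeight_pos _ _)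
      refine (JetBound.absorb (κ := 1) hone zero_le_one (by rwa [mul_one])).mono zero_le_one le_rfl ?_
      rw [hhalf]
      have hg := gaussWeight_pos (a / 2) x.1
      calc _ = 2 ^ N * ((2 ^ N * C) ^ ν * T ν) * ((1 + ‖x.1‖) ^ N * gaussWeight (a / 2) x.1) *
            gaussWeight (a / 2) x.1 := by ring
        _ ≤ 2 ^ N * ((2 ^ N * C) ^ ν * T ν) * M * gaussWeight (a / 2) x.1 := by
            gcongr
            exact hMb x.1
    have hv0 : ∀ i : ι, ∀ ν, 0 ≤ v ν := fun i ν => nonneg_of_mul_nonneg_left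
      (hb i ν 0).nonneg (gaussWeight_pos _ _)
    have hsm : ∀ i ν, ContDiff ℝ N (fun x : SpaceTime d × (SpaceTime d × ℝ) =>
          u x.1.2 ^ ν * (𝒜 i x.2.2).termProfile ν x.1 x.2.1) := fun i ν =>
      (huc.pow ν).mul (hterm ν i).1
    have main := fun i => contDiff_tsum_of_jetBound (hsm i) hv fun ν x =>
      (hb i ν x).mono zero_le_one le_rfl (mul_le_of_le_one_right (hv0 i ν) (hle x.1))
    refine ⟨fun i => (main i).1, |∑' ν, v ν|, abs_nonneg _, fun i x => ?_⟩
    refine ((main i).2 x 1 _ (hv.mul_right _) fun ν => hb i ν x).mono zero_le_one le_rfl ?_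
    rw [tsum_mul_right]
    exact mul_le_mul_of_nonneg_right (le_abs_self _) (gaussWeight_pos _ _).le
  · have hs := isScaled_parametrixTerm (fun w => h.symm i τ w) (fun w => h.isUnit_det i τ w)
      (h.contDiff_a i τ)
    rw [heatKernel, ← tsum_mul_left]
    refine tsum_congr fun ν => ?_
    rw [hs ν w p hp0, hu1 p.2 (by rw [abs_of_pos hp0]; exact hp1), pow_add p.2 ν, pow_add p.2 d]
    field_simp

end UniformlyRegular

end Coefficients

/-! ### From parabolic to Cartesian coordinates -/

/-- A function that vanishes on a half space, is regular on the complementary open half space, and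
whose derivatives are there quadratically small at the boundary, is regular everywhere. -/
theorem contDiff_of_flat {V : Type} [NormedAddCommGroup V] [NormedSpace ℝ V] (T : V →L[ℝ] ℝ)
    {B : ℝ} (N : ℕ) : ∀ {F : Type} [NormedAddCommGroup F] [NormedSpace ℝ F] {f : V → F},
      (∀ x, T x ≤ 0 → f x = 0) → (∀ x, 0 < T x → ContDiffAt ℝ N f x) →
      (∀ x, 0 < T x → ∀ j ≤ N, ‖iteratedFDeriv ℝ j f x‖ ≤ B * T x ^ 2) →
      ContDiff ℝ N f ∧ ∀ x, T x ≤ 0 → ∀ j ≤ N, iteratedFDeriv ℝ j f x = 0 := by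
  have hO : ∀ {F : Type} [NormedAddCommGroup F] [NormedSpace ℝ F] {f : V → F},
      (∀ x, T x ≤ 0 → f x = 0) → (∀ x, 0 < T x → ‖f x‖ ≤ B * T x ^ 2) → ∀ x, T x ≤ 0 →
      HasFDerivAt f (0 : V →L[ℝ] F) x := fun {F} _ _ {f} h0 hb x hx => by
    refine Asymptotics.IsBigO.hasFDerivAt (n := 2) ?_ one_lt_two
    refine Asymptotics.IsBigO.of_bound (|B| * ‖T‖ ^ 2) (Filter.Eventually.of_forall fun y => ?_)
    rw [norm_pow, norm_norm, mul_assoc, ← mul_pow]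
    by_cases hy : T y ≤ 0
    · rw [h0 y hy, norm_zero]
      positivity
    · push Not at hy
      refine (hb y hy).trans (mul_le_mul (le_abs_self B) ?_ (by positivity) (abs_nonneg _))
      refine pow_le_pow_left₀ hy.le ?_ 2
      calc T y ≤ T y - T x := by linarith
        _ = T (y - x) := (map_sub _ _ _).symm
        _ ≤ ‖T (y - x)‖ := le_abs_self _
        _ ≤ _ := T.le_opNorm _
  induction N with
  | zero =>
    intro F _ _ f h0 hd hb
    have hb' : ∀ x, 0 < T x → ‖f x‖ ≤ B * T x ^ 2 := fun x hx => by simpa using hb x hx 0 le_rfl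
    refine ⟨contDiff_zero.mpr (continuous_iff_continuousAt.mpr fun x => ?_), fun x hx j hj => ?_⟩
    · rcases le_or_gt (T x) 0 with hx | hx
      · exact (hO h0 hb' x hx).continuousAt
      · exact (hd x hx).continuousAt
    · obtain rfl : j = 0 := by omega
      rw [← norm_eq_zero, norm_iteratedFDeriv_zero, h0 x hx, norm_zero]
  | succ N ih =>
    intro F _ _ f h0 hd hb
    have hb' : ∀ x, 0 < T x → ‖f x‖ ≤ B * T x ^ 2 := fun x hx => by
      simpa using hb x hx 0 (Nat.zero_le _)
    have h1 := fun x hx => (hO h0 hb' x hx).fderiv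
    obtain ⟨h2, h3⟩ := ih (f := fderiv ℝ f) h1
      (fun x hx => (hd x hx).fderiv_right (by push_cast; exact le_rfl))
      (fun x hx j hj => by
        rw [norm_iteratedFDeriv_fderiv]
        exact hb x hx (j + 1) (Nat.succ_le_succ hj))
    refine ⟨?_, fun x hx j hj => ?_⟩
    · rw [show ((N + 1 : ℕ) : WithTop ℕ∞) = (N : WithTop ℕ∞) + 1 by push_cast; rfl,
        contDiff_succ_iff_fderiv]
      refine ⟨fun x => ?_, by simp, h2⟩
      rcases le_or_gt (T x) 0 with hx | hx
      · exact (hO h0 hb' x hx).differentiableAt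
      · exact (hd x hx).differentiableAt (by simp)
    · match j with
      | 0 => rw [← norm_eq_zero, norm_iteratedFDeriv_zero, h0 x hx, norm_zero]
      | j + 1 =>
        rw [← norm_eq_zero, ← norm_iteratedFDeriv_fderiv, h3 x hx j (Nat.succ_le_succ_iff.mp hj),
          norm_zero]

/-- Smooth functions with bounded derivatives that coincide with `√t` and `1 / √t` near `t = 1`. -/
theorem exists_local_sqrt : ∃ r v : ℝ → ℝ,
    (∀ N : ℕ, ContDiff ℝ N r ∧ ∃ C, 0 ≤ C ∧ ∀ t, JetBound N 1 C r t) ∧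
    (∀ N : ℕ, ContDiff ℝ N v ∧ ∃ C, 0 ≤ C ∧ ∀ t, JetBound N 1 C v t) ∧
    ∀ᶠ t in nhds (1 : ℝ), r t = Real.sqrt t ∧ v t = (Real.sqrt t)⁻¹ := by
  let b : ContDiffBump (1 : ℝ) := ⟨1 / 4, 1 / 2, by norm_num, by norm_num⟩
  have hsm : ∀ N : ℕ, ContDiff ℝ N fun s => b s * (s - 1) := fun N =>
    b.contDiff.mul (contDiff_id.sub contDiff_const)
  have hcon : ∀ N : ℕ, Controlled N (fun _ => 1) fun (_ : Unit) s => 1 + b s * (s - 1) := fun N => by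
    refine (Controlled.const 1).add ⟨fun _ => hsm N, ?_⟩
    obtain ⟨C, hC, h⟩ := exists_jetBound_of_hasCompactSupport (hsm N) b.hasCompactSupport.mul_right
    exact ⟨C, hC, fun _ x => by simpa using h x⟩
  have hlow : ∀ (_ : Unit) (s : ℝ), 1 / 2 ≤ 1 + b s * (s - 1) := fun _ s => by
    by_cases hs : s ∈ Metric.ball (1 : ℝ) (1 / 2)
    · rw [Metric.mem_ball, Real.dist_eq, abs_lt] at hs
      have h0 : 0 ≤ b s := b.nonneg
      have h1 : b s ≤ 1 := b.le_one
      nlinarith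
    · have : b s = 0 := by
        rw [← Function.notMem_support, b.support_eq]
        exact hs
      rw [this]
      norm_num
  have hv := Controlled.rpow_neg_half hcon (by norm_num) hlow
  have hone : ∀ {N : ℕ} {f : Unit → ℝ → ℝ}, Controlled N (fun _ => 1) f →
      ContDiff ℝ N (f ()) ∧ ∃ C, 0 ≤ C ∧ ∀ t, JetBound N 1 C (f ()) t := fun h =>
    ⟨h.1 (), h.2.imp fun C hC => ⟨hC.1, fun t => by simpa using hC.2 () t⟩⟩
  refine ⟨fun s => (1 + b s * (s - 1)) * (1 + b s * (s - 1)) ^ (-(1 : ℝ) / 2),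
    fun s => (1 + b s * (s - 1)) ^ (-(1 : ℝ) / 2),
    fun N => hone (((hcon N).mul (hv N)).mono_le fun x => by simp), fun N => hone (hv N), ?_⟩
  filter_upwards [Metric.closedBall_mem_nhds (1 : ℝ) (show (0 : ℝ) < 1 / 4 by norm_num)] with t ht
  have hb1 : b t = 1 := b.one_of_mem_closedBall ht
  rw [Metric.mem_closedBall, Real.dist_eq, abs_le] at ht
  have ht0 : 0 < t := by linarith
  have e : 1 + b t * (t - 1) = t := by rw [hb1]; ring
  have e2 : t ^ (-(1 : ℝ) / 2) = (Real.sqrt t)⁻¹ := by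
    rw [Real.sqrt_eq_rpow, ← Real.rpow_neg ht0.le]
    norm_num
  rw [e, e2]
  refine ⟨?_, rfl⟩
  nth_rewrite 1 [← Real.mul_self_sqrt ht0.le]
  field_simp

namespace SpaceTime

variable {d : ℕ}

/-- The kernel in Cartesian coordinates with the profile `h` in parabolic coordinates and the
multiplier `m`: `m(x, t) s^{-d} h(x / s, s, ·)`, where `s = √t`; it vanishes for `t ≤ 0`. -/
def unscale (m : SpaceTime d → ℝ) (h : SpaceTime d × (SpaceTime d × ℝ) → ℝ)
    (x : SpaceTime d × (SpaceTime d × ℝ)) : ℝ :=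
  if 0 < x.1.2 then
    m x.1 * ((Real.sqrt x.1.2 ^ d)⁻¹ *
      h (((Real.sqrt x.1.2)⁻¹ • x.1.1, Real.sqrt x.1.2), x.2))
  else 0

/-- The map `(x, t) ↦ (x / √t, s √t)` near the time `t = 1`, where `r` and `v` stand for the square
root and its inverse; the base point and the parameter are carried along. -/
def localCoord (r v : ℝ → ℝ) (s : ℝ) (x : SpaceTime d × (SpaceTime d × ℝ)) :
    SpaceTime d × (SpaceTime d × ℝ) := ((v x.1.2 • x.1.1, s * r x.1.2), x.2)

theorem jetBound_localCoord {r v : ℝ → ℝ} {N : ℕ} {C : ℝ} (hr : ContDiff ℝ N r)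
    (hv : ContDiff ℝ N v) (hrb : ∀ t, JetBound N 1 C r t) (hvb : ∀ t, JetBound N 1 C v t) {s : ℝ}
    (hs : 0 ≤ s) (x : SpaceTime d × (SpaceTime d × ℝ)) : ContDiff ℝ N (localCoord (d := d) r v s) ∧
    ∀ i, 1 ≤ i → i ≤ N → ‖iteratedFDeriv ℝ i (localCoord r v s) x‖ ≤
      2 ^ N * (C * (1 + ‖x.1.1‖)) + s * C + 1 := by
  let π₁ : SpaceTime d × (SpaceTime d × ℝ) →L[ℝ] EuclideanSpace ℝ (Fin d) :=
    (ContinuousLinearMap.fst ℝ _ ℝ).comp (ContinuousLinearMap.fst ℝ _ _)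
  let π₂ : SpaceTime d × (SpaceTime d × ℝ) →L[ℝ] ℝ :=
    (ContinuousLinearMap.snd ℝ _ ℝ).comp (ContinuousLinearMap.fst ℝ _ _)
  let π₃ : SpaceTime d × (SpaceTime d × ℝ) →L[ℝ] SpaceTime d × ℝ := ContinuousLinearMap.snd ℝ _ _
  have hπ₁ : ‖π₁‖ ≤ 1 := ContinuousLinearMap.opNorm_le_bound _ zero_le_one fun x => by
    rw [one_mul]
    exact (norm_fst_le x.1).trans (norm_fst_le x)
  have hπ₂ : ‖π₂‖ ≤ 1 := ContinuousLinearMap.opNorm_le_bound _ zero_le_one fun x => by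
    rw [one_mul]
    exact (norm_snd_le x.1).trans (norm_fst_le x)
  have c1 : ContDiff ℝ N fun x : SpaceTime d × (SpaceTime d × ℝ) => v x.1.2 := hv.comp π₂.contDiff
  have c2 : ContDiff ℝ N fun x : SpaceTime d × (SpaceTime d × ℝ) => r x.1.2 := hr.comp π₂.contDiff
  have c3 : ContDiff ℝ N fun x : SpaceTime d × (SpaceTime d × ℝ) => x.1.1 := π₁.contDiff
  have j1 : JetBound N 1 C (fun x : SpaceTime d × (SpaceTime d × ℝ) => v x.1.2) x :=
    (hvb x.1.2).comp_clm_of_le_one (x := x) π₂ hπ₂ hv zero_le_one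
  have j2 : JetBound N 1 C (fun x : SpaceTime d × (SpaceTime d × ℝ) => r x.1.2) x :=
    (hrb x.1.2).comp_clm_of_le_one (x := x) π₂ hπ₂ hr zero_le_one
  have j3 : JetBound N 1 (1 + ‖x.1.1‖) (fun x : SpaceTime d × (SpaceTime d × ℝ) => x.1.1) x :=
    JetBound.clm (x := x) π₁ zero_le_one (le_add_of_nonneg_left zero_le_one)
      (hπ₁.trans (by rw [mul_one]; linarith [norm_nonneg x.1.1]))
  have j4 : JetBound N 1 (2 ^ N * (C * (1 + ‖x.1.1‖)))
      (fun x : SpaceTime d × (SpaceTime d × ℝ) => v x.1.2 • x.1.1) x :=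
    JetBound.smul zero_le_one c1 c3 j1 j3
  have j5 := j2.const_mul s c2
  rw [abs_of_nonneg hs] at j5
  have c4 : ContDiff ℝ N fun x : SpaceTime d × (SpaceTime d × ℝ) => v x.1.2 • x.1.1 := c1.smul c3
  have c5 : ContDiff ℝ N fun x : SpaceTime d × (SpaceTime d × ℝ) => s * r x.1.2 :=
    contDiff_const.mul c2
  have j6 := JetBound.prodMk c4 c5 j4 j5
  have c6 := c4.prodMk c5
  refine ⟨c6.prodMk π₃.contDiff, fun i hi hiN => ?_⟩
  have e : localCoord r v s = (fun x => ContinuousLinearMap.inl ℝ (SpaceTime d) (SpaceTime d × ℝ)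
      (v x.1.2 • x.1.1, s * r x.1.2)) + fun x =>
      (ContinuousLinearMap.inr ℝ (SpaceTime d) (SpaceTime d × ℝ)).comp π₃ x := by
    ext1 x
    refine Prod.ext ?_ ?_ <;> simp [localCoord, π₃]
  have hi' : (i : WithTop ℕ∞) ≤ N := by exact_mod_cast hiN
  have c7 : ContDiff ℝ i fun x : SpaceTime d × (SpaceTime d × ℝ) =>
      ContinuousLinearMap.inl ℝ (SpaceTime d) (SpaceTime d × ℝ) (v x.1.2 • x.1.1, s * r x.1.2) :=
    (ContinuousLinearMap.contDiff _).comp (c6.of_le hi')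
  rw [e, iteratedFDeriv_add_apply c7.contDiffAt (ContinuousLinearMap.contDiff _).contDiffAt]
  refine (norm_add_le _ _).trans (add_le_add ?_ ?_)
  · refine ((j6.clm_comp (ContinuousLinearMap.inl ℝ (SpaceTime d) (SpaceTime d × ℝ)) c6) i
      hiN).trans ?_
    rw [one_pow, mul_one]
    exact mul_le_of_le_one_left ((norm_nonneg _).trans j6.norm_le)
      (ContinuousLinearMap.norm_inl_le_one ..)
  · refine (norm_iteratedFDeriv_clm_le _ x hi).trans ((ContinuousLinearMap.opNorm_comp_le _ _).trans ?_)
    exact mul_le_one₀ (ContinuousLinearMap.norm_inr_le_one ..) (norm_nonneg _)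
      (ContinuousLinearMap.norm_snd_le ..)

theorem parNorm_le_mul (x : SpaceTime d) {s : ℝ} (hs : 0 < s) (h : x.2 = s ^ 2) :
    parNorm x ≤ s * (1 + ‖s⁻¹ • x.1‖) := by
  rw [parNorm, h, abs_of_nonneg (sq_nonneg s), Real.sqrt_sq hs.le, norm_smul, norm_inv,
    Real.norm_of_nonneg hs.le, mul_add, mul_inv_cancel_left₀ hs.ne']
  exact max_le (by linarith) (by linarith [norm_nonneg x.1])

/-- The bounds on `unscale m h` on one scale: after a parabolic dilation, the point has time one,
where the parabolic coordinates are smooth. -/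
theorem exists_jetBound_unscale_aux (d N : ℕ) : ∃ K : ℝ, 0 ≤ K ∧
    ∀ {h : SpaceTime d × (SpaceTime d × ℝ) → ℝ} {m : SpaceTime d → ℝ} {A M s : ℝ}
      {x : SpaceTime d × (SpaceTime d × ℝ)}, ContDiff ℝ N h → ContDiff ℝ N m → 0 < s →
      x.1.2 = s ^ 2 → JetBound N 1 A h ((s⁻¹ • x.1.1, s), x.2) → JetBound N 1 M m x.1 →
      ContDiffAt ℝ N (unscale m h) x ∧
      JetBound N 1 (K * ((1 + ‖s⁻¹ • x.1.1‖) ^ N * (1 + s) ^ (3 * N) / s ^ (2 * N + d)) * A * M)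
        (unscale m h) x := by
  obtain ⟨r, v, hr, hv, hrv⟩ := exists_local_sqrt
  obtain ⟨hr, Cr, hCr, hrb⟩ := hr N
  obtain ⟨hv, Cv, hCv, hvb⟩ := hv N
  set C := max Cr Cv
  have hC : 0 ≤ C := le_max_of_le_left hCr
  have hrb' : ∀ t, JetBound N 1 C r t := fun t => (hrb t).mono zero_le_one le_rfl (le_max_left _ _)
  have hvb' : ∀ t, JetBound N 1 C v t := fun t => (hvb t).mono zero_le_one le_rfl (le_max_right _ _)
  set D₀ := 2 ^ N * C + C + 1
  have hD₀ : 1 ≤ D₀ := by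
    have : 0 ≤ 2 ^ N * C + C := by positivity
    linarith
  refine ⟨2 ^ N * (2 ^ N * ((2 ^ N * C) ^ d * N.factorial)) * D₀ ^ N, by positivity,
    fun {h m A M s x} hh hm hs hx hA hM => ?_⟩
  set ρ := ‖s⁻¹ • x.1.1‖
  have hρ : 0 ≤ ρ := norm_nonneg _
  have hA0 := hA.nonneg
  have hM0 := hM.nonneg
  -- The dilation to the time one; its norm is at most `l`, the price of a derivative.
  let Λ : SpaceTime d × (SpaceTime d × ℝ) →L[ℝ] SpaceTime d × (SpaceTime d × ℝ) :=
    ((dilate s⁻¹).comp (ContinuousLinearMap.fst ℝ _ _)).prod (ContinuousLinearMap.snd ℝ _ _)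
  have hΛ : ∀ y, Λ y = ((s⁻¹ • y.1.1, s⁻¹ ^ 2 * y.1.2), y.2) := fun _ => rfl
  set l := (1 + s) ^ 2 / s ^ 2
  have hl1 : 1 ≤ l := by
    rw [one_le_div (by positivity)]
    nlinarith
  have hls : s⁻¹ ≤ l := by
    rw [inv_eq_one_div, div_le_div_iff₀ hs (by positivity)]
    nlinarith [mul_pos hs hs, pow_pos hs 3]
  have hls2 : s⁻¹ ^ 2 ≤ l := by
    rw [inv_pow, inv_eq_one_div, div_le_div_iff_of_pos_right (by positivity)]
    nlinarith
  have hΛl : ‖Λ‖ ≤ l := by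
    refine ContinuousLinearMap.opNorm_le_bound _ (zero_le_one.trans hl1) fun y => ?_
    have y1 : ‖y.1.1‖ ≤ ‖y‖ := (norm_fst_le y.1).trans (norm_fst_le y)
    have y2 : ‖y.1.2‖ ≤ ‖y‖ := (norm_snd_le y.1).trans (norm_fst_le y)
    rw [hΛ, Prod.norm_def, Prod.norm_def]
    refine max_le (max_le ?_ ?_) ?_
    · simp only [norm_smul, norm_inv, Real.norm_of_nonneg hs.le]
      exact mul_le_mul hls y1 (norm_nonneg _) (zero_le_one.trans hl1)
    · simp only [norm_mul, norm_pow, norm_inv, Real.norm_of_nonneg hs.le]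
      exact mul_le_mul hls2 y2 (norm_nonneg _) (zero_le_one.trans hl1)
    · exact (norm_snd_le y).trans (le_mul_of_one_le_left (norm_nonneg _) hl1)
  set z := Λ x
  have hz : z = ((s⁻¹ • x.1.1, 1), x.2) := by
    rw [show z = _ from hΛ x, hx]
    congr 2
    field_simp
  have hrv1 := hrv.self_of_nhds
  rw [Real.sqrt_one, inv_one] at hrv1
  have hzloc : localCoord r v s z = ((s⁻¹ • x.1.1, s), x.2) := by
    rw [hz, localCoord]
    simp only [hrv1.1, hrv1.2, one_smul, mul_one]
  obtain ⟨hloc, hlocb⟩ := jetBound_localCoord hr hv hrb' hvb' hs.le z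
  set D := D₀ * ((1 + ρ) * (1 + s))
  have hD1 : 1 ≤ D := one_le_mul_of_one_le_of_one_le hD₀
    (one_le_mul_of_one_le_of_one_le (by linarith) (by linarith))
  have hlocD : ∀ i, 1 ≤ i → i ≤ N → ‖iteratedFDeriv ℝ i (localCoord r v s) z‖ ≤ D ^ i :=
    fun i hi hiN => by
      refine (hlocb i hi hiN).trans (le_trans ?_ (le_self_pow₀ hD1 (Nat.one_le_iff_ne_zero.mp hi)))
      have : ‖z.1.1‖ = ρ := by rw [hz]
      rw [this]
      have e1 : 0 ≤ 2 ^ N * C := by positivity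
      have e2 : 1 + ρ ≤ (1 + ρ) * (1 + s) := le_mul_of_one_le_right (by linarith) (by linarith)
      have e3 : s ≤ (1 + ρ) * (1 + s) := by nlinarith
      have e4 : 1 ≤ (1 + ρ) * (1 + s) :=
        one_le_mul_of_one_le_of_one_le (by linarith) (by linarith)
      calc 2 ^ N * (C * (1 + ρ)) + s * C + 1
          = 2 ^ N * C * (1 + ρ) + C * s + 1 := by ring
        _ ≤ 2 ^ N * C * ((1 + ρ) * (1 + s)) + C * ((1 + ρ) * (1 + s)) + (1 + ρ) * (1 + s) := by
            gcongr
        _ = D := by ring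
  have j1 : JetBound N D (N.factorial * A) (fun y => h (localCoord r v s y)) z :=
    JetBound.comp hh hloc (by rwa [hzloc]) hlocD (zero_le_one.trans hD1)
  let π₂ : SpaceTime d × (SpaceTime d × ℝ) →L[ℝ] ℝ :=
    (ContinuousLinearMap.snd ℝ _ ℝ).comp (ContinuousLinearMap.fst ℝ _ _)
  have hπ₂ : ‖π₂‖ ≤ 1 := ContinuousLinearMap.opNorm_le_bound _ zero_le_one fun x => by
    rw [one_mul]
    exact (norm_snd_le x.1).trans (norm_fst_le x)
  have c2 : ContDiff ℝ N fun y : SpaceTime d × (SpaceTime d × ℝ) => v y.1.2 := hv.comp π₂.contDiff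
  have j2 : JetBound N 1 C (fun y : SpaceTime d × (SpaceTime d × ℝ) => v y.1.2) z :=
    (hvb' z.1.2).comp_clm_of_le_one (x := z) π₂ hπ₂ hv zero_le_one
  have j3 := (j2.pow zero_le_one c2 d).mono zero_le_one hD1 le_rfl
  have c1 : ContDiff ℝ N fun y => h (localCoord r v s y) := hh.comp hloc
  have j4 := JetBound.mul (zero_le_one.trans hD1) (c2.pow d) c1 j3 j1
  have c4 := (c2.pow d).mul c1
  have j5 := JetBound.comp_affine (x := x) Λ 0 c4 (by simpa using j4)
  have c5 := c4.comp (Λ.contDiff.add (contDiff_const (c := 0)))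
  have j6 := j5.mono (by positivity) (mul_le_mul_of_nonneg_right hΛl (zero_le_one.trans hD1)) le_rfl
  have hlD : 1 ≤ l * D := one_le_mul_of_one_le_of_one_le hl1 hD1
  have j7 : JetBound N 1 M (fun y : SpaceTime d × (SpaceTime d × ℝ) => m y.1) x :=
    JetBound.comp_fst hm zero_le_one hM
  have c7 : ContDiff ℝ N fun y : SpaceTime d × (SpaceTime d × ℝ) => m y.1 := hm.comp contDiff_fst
  have j8 := JetBound.mul (zero_le_one.trans hlD) c7 c5 (j7.mono zero_le_one hlD le_rfl) j6
  have j9 := (JetBound.absorb (κ := 1) hlD zero_le_one (by rwa [mul_one])).const_mul (s ^ d)⁻¹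
    (c7.mul c5)
  have hev : unscale m h =ᶠ[nhds x] fun y => (s ^ d)⁻¹ * (m y.1 *
      ((fun y : SpaceTime d × (SpaceTime d × ℝ) => v y.1.2 ^ d * h (localCoord r v s y))
        (Λ y + 0))) := by
    have hcont : Filter.Tendsto (fun y : SpaceTime d × (SpaceTime d × ℝ) => s⁻¹ ^ 2 * y.1.2)
        (nhds x) (nhds 1) := by
      have : Continuous fun y : SpaceTime d × (SpaceTime d × ℝ) => s⁻¹ ^ 2 * y.1.2 := by fun_prop
      refine this.tendsto' x 1 ?_
      rw [hx]
      field_simp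
    filter_upwards [hcont.eventually hrv, hcont.eventually_const_lt one_pos] with y hy hy0
    have hy1 : 0 < y.1.2 := pos_of_mul_pos_right hy0 (by positivity)
    have hsq : Real.sqrt (s⁻¹ ^ 2 * y.1.2) = s⁻¹ * Real.sqrt y.1.2 := by
      rw [Real.sqrt_mul (sq_nonneg _), Real.sqrt_sq (by positivity)]
    rw [hsq] at hy
    have hyp : 0 < Real.sqrt y.1.2 := Real.sqrt_pos.mpr hy1
    simp only [unscale, hy1, if_true, add_zero, hΛ, localCoord, hy.1, hy.2, smul_smul]
    have e1 : (s⁻¹ * Real.sqrt y.1.2)⁻¹ * s⁻¹ = (Real.sqrt y.1.2)⁻¹ := by field_simp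
    have e2 : s * (s⁻¹ * Real.sqrt y.1.2) = Real.sqrt y.1.2 := by field_simp
    rw [e1, e2, mul_inv, inv_inv, mul_pow, inv_pow]
    field_simp
  refine ⟨((contDiff_const.mul (c7.mul c5)).contDiffAt).congr_of_eventuallyEq hev,
    (j9.congr hev).mono zero_le_one le_rfl (le_of_eq ?_)⟩
  rw [abs_of_nonneg (by positivity)]
  simp only [D, l, mul_pow, div_pow, ← pow_mul, pow_add]
  field_simp
  ring

/-- A kernel whose profile has Gaussian decay is regular once it is multiplied by a function that
vanishes to a high order at the origin. -/
theorem exists_unscale_const (d N : ℕ) {a : ℝ} (ha : 0 < a) : ∃ K : ℝ, 0 ≤ K ∧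
    ∀ {h : SpaceTime d × (SpaceTime d × ℝ) → ℝ} {m : SpaceTime d → ℝ} {A M : ℝ}, ContDiff ℝ N h →
      ContDiff ℝ N m → (∀ x, JetBound N 1 (A * gaussWeight a x.1) h x) →
      (∀ y, JetBound N 1 (M * parNorm y ^ (2 * N + d + 4)) m y) →
      ContDiff ℝ N (unscale m h) ∧ ∀ x, JetBound N 1 (K * A * M) (unscale m h) x := by
  obtain ⟨K, hK, hunscale⟩ := exists_jetBound_unscale_aux d N
  obtain ⟨G, hG, hGb⟩ := exists_one_add_pow_mul_gaussWeight_le d (N + 3 * N + (2 * N + d + 4) + 4) ha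
  refine ⟨K * G, by positivity, fun {h m A M} hh hm hA hM => ?_⟩
  have hA0 : 0 ≤ A := nonneg_of_mul_nonneg_left (hA 0).nonneg (gaussWeight_pos _ _)
  have hM0 : 0 ≤ M := by
    have h1 := (hM (0, 1)).nonneg
    have h2 : parNorm ((0, 1) : SpaceTime d) = 1 := by simp [parNorm]
    rwa [h2, one_pow, mul_one] at h1
  have hpos : ∀ x : SpaceTime d × (SpaceTime d × ℝ), 0 < x.1.2 → ContDiffAt ℝ N (unscale m h) x ∧
      JetBound N 1 (K * G * A * M) (unscale m h) x ∧
      JetBound N 1 (K * G * A * M * x.1.2 ^ 2) (unscale m h) x := fun x hx => by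
    set s := Real.sqrt x.1.2
    have hs : 0 < s := Real.sqrt_pos.mpr hx
    have hxs : x.1.2 = s ^ 2 := (Real.sq_sqrt hx.le).symm
    obtain ⟨h1, h2⟩ := hunscale hh hm hs hxs (hA _) (hM x.1)
    set p : SpaceTime d := (s⁻¹ • x.1.1, s)
    have hn1 : 1 + ‖s⁻¹ • x.1.1‖ ≤ 1 + ‖p‖ := by linarith [norm_fst_le p]
    have hn2 : s ≤ ‖p‖ := (le_abs_self s).trans (norm_snd_le p)
    have hp0 : 0 ≤ ‖p‖ := norm_nonneg p
    have hg := gaussWeight_pos a p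
    have hpar := parNorm_le_mul x.1 hs hxs
    have hpar0 := parNorm_nonneg x.1
    -- The order of vanishing of the multiplier beats the singularity, with `s⁴ = t²` to spare.
    have key : (1 + ‖s⁻¹ • x.1.1‖) ^ N * (1 + s) ^ (3 * N) / s ^ (2 * N + d) *
        (gaussWeight a p * parNorm x.1 ^ (2 * N + d + 4)) ≤
        s ^ 4 * ((1 + ‖p‖) ^ (N + 3 * N + (2 * N + d + 4)) * gaussWeight a p) := by
      calc _ ≤ (1 + ‖p‖) ^ N * (1 + ‖p‖) ^ (3 * N) / s ^ (2 * N + d) *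
            (gaussWeight a p * (s * (1 + ‖p‖)) ^ (2 * N + d + 4)) := by
            gcongr
            exact hpar.trans (by gcongr)
        _ = _ := by
            rw [mul_pow, pow_add s (2 * N + d) 4]
            field_simp
            ring
    have hKAM : 0 ≤ K * A * M := by positivity
    have e : K * ((1 + ‖s⁻¹ • x.1.1‖) ^ N * (1 + s) ^ (3 * N) / s ^ (2 * N + d)) *
        (A * gaussWeight a p) * (M * parNorm x.1 ^ (2 * N + d + 4)) =
        K * A * M * ((1 + ‖s⁻¹ • x.1.1‖) ^ N * (1 + s) ^ (3 * N) / s ^ (2 * N + d) *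
        (gaussWeight a p * parNorm x.1 ^ (2 * N + d + 4))) := by ring
    refine ⟨h1, h2.mono zero_le_one le_rfl ?_, h2.mono zero_le_one le_rfl ?_⟩
    · rw [e]
      calc _ ≤ K * A * M * (s ^ 4 * ((1 + ‖p‖) ^ (N + 3 * N + (2 * N + d + 4)) *
            gaussWeight a p)) := mul_le_mul_of_nonneg_left key hKAM
        _ ≤ K * A * M * ((1 + ‖p‖) ^ 4 * ((1 + ‖p‖) ^ (N + 3 * N + (2 * N + d + 4)) *
            gaussWeight a p)) := by
            gcongr
            linarith
        _ = K * A * M * ((1 + ‖p‖) ^ (N + 3 * N + (2 * N + d + 4) + 4) * gaussWeight a p) := by ring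
        _ ≤ K * A * M * G := mul_le_mul_of_nonneg_left (hGb p) hKAM
        _ = _ := by ring
    · rw [e, hxs]
      calc _ ≤ K * A * M * (s ^ 4 * ((1 + ‖p‖) ^ (N + 3 * N + (2 * N + d + 4)) *
            gaussWeight a p)) := mul_le_mul_of_nonneg_left key hKAM
        _ ≤ K * A * M * (s ^ 4 * ((1 + ‖p‖) ^ (N + 3 * N + (2 * N + d + 4) + 4) *
            gaussWeight a p)) :=
            mul_le_mul_of_nonneg_left (mul_le_mul_of_nonneg_left (mul_le_mul_of_nonneg_right
              (pow_le_pow_right₀ (by linarith) (by omega)) hg.le) (by positivity)) hKAM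
        _ ≤ K * A * M * (s ^ 4 * G) := by
            gcongr
            exact hGb p
        _ = _ := by ring
  let T : SpaceTime d × (SpaceTime d × ℝ) →L[ℝ] ℝ :=
    (ContinuousLinearMap.snd ℝ _ ℝ).comp (ContinuousLinearMap.fst ℝ _ _)
  obtain ⟨h1, h2⟩ := contDiff_of_flat T (B := K * G * A * M) N (f := unscale m h)
    (fun x hx => if_neg (not_lt.mpr hx)) (fun x hx => (hpos x hx).1)
    (fun x hx j hj => by
      have h3 := (hpos x hx).2.2 j hj
      rw [one_pow, mul_one] at h3
      exact h3)
  refine ⟨h1, fun x j hj => ?_⟩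
  rcases le_or_gt x.1.2 0 with hx | hx
  · rw [h2 x hx j hj, norm_zero]
    positivity
  · exact (hpos x hx).2.1 j hj

end SpaceTime

/-! ### The multipliers -/

theorem summable_pi_prod {d : ℕ} {f : ℤ → ℝ} (hf : Summable f) (h0 : ∀ n, 0 ≤ f n) :
    Summable fun k : Fin d → ℤ => ∏ i, f (k i) := by
  classical
  refine summable_of_sum_le (c := ∏ _ : Fin d, ∑' n, f n)
    (fun k => Finset.prod_nonneg fun i _ => h0 _) fun u => ?_
  have hu : u ⊆ Fintype.piFinset fun i : Fin d => u.image fun k => k i := fun k hk => by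
    rw [Fintype.mem_piFinset]
    exact fun i => Finset.mem_image_of_mem _ hk
  refine (Finset.sum_le_sum_of_subset_of_nonneg hu fun k _ _ =>
    Finset.prod_nonneg fun i _ => h0 _).trans ?_
  rw [← Finset.prod_univ_sum]
  exact Finset.prod_le_prod (fun i _ => Finset.sum_nonneg fun n _ => h0 n) fun i _ =>
    hf.sum_le_tsum _ fun n _ => h0 n

theorem abs_le_norm_latticePoint {d : ℕ} (k : Fin d → ℤ) (i : Fin d) :
    |(k i : ℝ)| ≤ ‖latticePoint k‖ := by
  have := PiLp.norm_apply_le (latticePoint k) i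
  simpa [latticePoint] using this

theorem summable_lattice (d : ℕ) :
    Summable fun k : Fin d → ℤ => ((1 + ‖latticePoint k‖) ^ (2 * d))⁻¹ := by
  have h1 : Summable fun n : ℤ => ((1 + |(n : ℝ)|) ^ 2)⁻¹ := by
    have h2 : Summable fun n : ℕ => ((1 + (n : ℝ)) ^ 2)⁻¹ := by
      have := (summable_nat_add_iff 1).mpr (Real.summable_nat_pow_inv.mpr one_lt_two)
      refine this.congr fun n => ?_
      push_cast
      rw [add_comm]
    refine Summable.of_nat_of_neg (by simpa using h2) (by simpa using h2)
  refine Summable.of_nonneg_of_le (fun k => by positivity) (fun k => ?_)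
    (summable_pi_prod (d := d) h1 fun n => by positivity)
  rw [Finset.prod_inv_distrib]
  refine inv_anti₀ (Finset.prod_pos fun i _ => by positivity) ?_
  calc ∏ i, (1 + |(k i : ℝ)|) ^ 2 ≤ ∏ _ : Fin d, (1 + ‖latticePoint k‖) ^ 2 :=
        Finset.prod_le_prod (fun i _ => by positivity) fun i _ => by
          gcongr
          exact abs_le_norm_latticePoint k i
    _ = _ := by simp [← pow_mul]

/-- The time cutoff times the exponential, extended smoothly to nonpositive times. -/
theorem IsTimeCutoff.exists_extension {κ : ℝ → ℝ} (hκ : IsTimeCutoff κ) : ∃ g : ℝ → ℝ,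
    (∀ N : ℕ, ContDiff ℝ N g ∧ ∃ C, 0 ≤ C ∧ ∀ t, JetBound N 1 C g t) ∧
      ∀ t, 0 < t → g t = Real.exp t * κ t := by
  let b : ContDiffBump (0 : ℝ) := ⟨1 / 2, 1, by norm_num, by norm_num⟩
  let g : ℝ → ℝ := fun t => Real.exp t * if 0 < t then κ t else b t
  have hb : ∀ t : ℝ, |t| ≤ 1 / 2 → b t = 1 := fun t ht =>
    b.one_of_mem_closedBall (by
      rw [Metric.mem_closedBall, dist_zero_right]
      exact ht)
  have hsm : ∀ N : ℕ, ContDiff ℝ N g := fun N => by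
    refine Real.contDiff_exp.mul (contDiff_iff_contDiffAt.mpr fun t => ?_)
    rcases lt_or_ge 0 t with ht | ht
    · have h1 : ContDiffAt ℝ N κ t :=
        ((hκ.smooth.contDiffAt (Ioi_mem_nhds ht)).of_le (by exact_mod_cast le_top))
      refine h1.congr_of_eventuallyEq ?_
      filter_upwards [Ioi_mem_nhds ht] with r hr
      exact if_pos hr
    · refine (b.contDiff (n := N)).contDiffAt.congr_of_eventuallyEq ?_
      filter_upwards [Iio_mem_nhds (show t < 1 / 2 by linarith)] with r hr
      by_cases hr0 : 0 < r
      · rw [if_pos hr0, hκ.eq_one r ⟨hr0, hr⟩, hb r (by rw [abs_of_pos hr0]; exact le_of_lt hr)]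
      · rw [if_neg hr0]
  have hsupp : HasCompactSupport g := by
    refine HasCompactSupport.of_support_subset_isCompact (isCompact_closedBall (0 : ℝ) 1)
      fun t ht => ?_
    rw [Metric.mem_closedBall, dist_zero_right, Real.norm_eq_abs]
    by_contra hc
    refine ht ?_
    push Not at hc
    simp only [g]
    by_cases h0 : 0 < t
    · rw [if_pos h0, hκ.eq_zero t (Or.inr (by rwa [abs_of_pos h0] at hc)), mul_zero]
    · have : b t = 0 := b.zero_of_le_dist (by simpa using hc.le)
      rw [if_neg h0, this, mul_zero]
  exact ⟨g, fun N => ⟨hsm N, exists_jetBound_of_hasCompactSupport (hsm N) hsupp⟩,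
    fun t ht => by simp only [g, if_pos ht]⟩

namespace IsSpaceCutoff

variable {d : ℕ} {φ : EuclideanSpace ℝ (Fin d) → ℝ}

theorem eq_zero (hφ : IsSpaceCutoff φ) {x : EuclideanSpace ℝ (Fin d)} (hx : 1 + 1 / 10 ≤ ‖x‖) :
    φ x = 0 := by
  by_contra h
  have := hφ.support (subset_tsupport φ h)
  rw [Metric.mem_ball, dist_zero_right] at this
  linarith

theorem iteratedFDeriv_eq_zero (hφ : IsSpaceCutoff φ) (j : ℕ) {x : EuclideanSpace ℝ (Fin d)}
    (hx : 1 + 1 / 10 ≤ ‖x‖) : iteratedFDeriv ℝ j φ x = 0 := by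
  by_contra h
  have := hφ.support (support_iteratedFDeriv_subset j h)
  rw [Metric.mem_ball, dist_zero_right] at this
  linarith

theorem hasCompactSupport (hφ : IsSpaceCutoff φ) : HasCompactSupport φ :=
  HasCompactSupport.of_support_subset_isCompact (isCompact_closedBall 0 (1 + 1 / 10))
    ((subset_tsupport φ).trans (hφ.support.trans Metric.ball_subset_closedBall))

/-- The derivatives vanish to every order at the lattice points other than the origin, uniformly. -/
theorem exists_flat_const (hφ : IsSpaceCutoff φ) (n : ℕ) : ∀ j : ℕ, ∃ C : ℝ, 0 ≤ C ∧
    ∀ k : Fin d → ℤ, k ≠ 0 → ∀ x, ‖iteratedFDeriv ℝ j φ (x + latticePoint k)‖ ≤ C * ‖x‖ ^ n := by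
  induction n with
  | zero =>
    intro j
    have hj : ContDiff ℝ j φ := hφ.smooth.of_le (by exact_mod_cast le_top)
    obtain ⟨C, hC, h⟩ := exists_jetBound_of_hasCompactSupport hj hφ.hasCompactSupport
    exact ⟨C, hC, fun k _ x => by simpa using h (x + latticePoint k) j le_rfl⟩
  | succ n ih =>
    intro j
    obtain ⟨C, hC, h⟩ := ih (j + 1)
    refine ⟨C, hC, fun k hk x => ?_⟩
    have hd : Differentiable ℝ (iteratedFDeriv ℝ j φ) :=
      hφ.smooth.differentiable_iteratedFDeriv (by exact_mod_cast WithTop.coe_lt_top j)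
    have h1 := Convex.norm_image_sub_le_of_norm_fderiv_le (𝕜 := ℝ) (f := iteratedFDeriv ℝ j φ)
      (C := C * ‖x‖ ^ n) (s := Metric.closedBall (latticePoint k) ‖x‖) (x := latticePoint k)
      (y := x + latticePoint k) (fun y _ => hd y) (fun y hy => by
        rw [norm_fderiv_iteratedFDeriv]
        have h2 := h k hk (y - latticePoint k)
        rw [sub_add_cancel] at h2
        refine h2.trans (mul_le_mul_of_nonneg_left (pow_le_pow_left₀ (norm_nonneg _) ?_ n) hC)
        rwa [Metric.mem_closedBall, dist_eq_norm] at hy)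
      (convex_closedBall _ _) (Metric.mem_closedBall_self (norm_nonneg _))
      (by rw [Metric.mem_closedBall, dist_eq_norm, add_sub_cancel_right])
    rw [hφ.flat k hk j, sub_zero, add_sub_cancel_right] at h1
    refine h1.trans (le_of_eq ?_)
    ring

theorem exists_jetBound_translate (hφ : IsSpaceCutoff φ) (N Q P : ℕ) (hQP : Q ≤ P) :
    ∃ C : ℝ, 0 ≤ C ∧ ∀ k : Fin d → ℤ, k ≠ 0 → ∀ x,
      JetBound N 1 (C * ((1 + ‖latticePoint k‖) ^ Q)⁻¹ * ‖x‖ ^ P)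
        (fun x => φ (x + latticePoint k)) x := by
  choose C₀ hC₀ h₀ using hφ.exists_flat_const 0
  choose C₁ hC₁ h₁ using hφ.exists_flat_const P
  refine ⟨(∑ j ∈ Finset.range (N + 1), (C₀ j + C₁ j)) * 4 ^ Q,
    mul_nonneg (Finset.sum_nonneg fun j _ => add_nonneg (hC₀ j) (hC₁ j)) (by positivity),
    fun k hk x j hj => ?_⟩
  have hsum : C₀ j + C₁ j ≤ ∑ j ∈ Finset.range (N + 1), (C₀ j + C₁ j) :=
    Finset.single_le_sum (f := fun j => C₀ j + C₁ j) (fun j _ => add_nonneg (hC₀ j) (hC₁ j))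
      (Finset.mem_range.mpr (Nat.lt_succ_of_le hj))
  have hS := (add_nonneg (hC₀ j) (hC₁ j)).trans hsum
  rw [one_pow, mul_one, iteratedFDeriv_comp_add_right]
  have hk0 : 0 < 1 + ‖latticePoint k‖ := by positivity
  by_cases hx : 1 + 1 / 10 ≤ ‖x + latticePoint k‖
  · rw [hφ.iteratedFDeriv_eq_zero j hx, norm_zero]
    positivity
  push Not at hx
  have hkx : ‖latticePoint k‖ ≤ ‖x‖ + (1 + 1 / 10) := by
    have := norm_sub_le (x + latticePoint k) x
    rw [add_sub_cancel_left] at this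
    linarith
  -- If `x` is large, then `k` is at most of the size of `x`; if `x` is small, then `k` is bounded.
  rcases le_or_gt 1 ‖x‖ with h1 | h1
  · have h2 : (1 + ‖latticePoint k‖) ^ Q ≤ 4 ^ Q * ‖x‖ ^ P := by
      calc _ ≤ (4 * ‖x‖) ^ Q := by
            gcongr
            linarith
        _ = 4 ^ Q * ‖x‖ ^ Q := mul_pow _ _ _
        _ ≤ _ := mul_le_mul_of_nonneg_left (pow_le_pow_right₀ h1 hQP) (by positivity)
    have h3 : 1 ≤ 4 ^ Q * ‖x‖ ^ P * ((1 + ‖latticePoint k‖) ^ Q)⁻¹ := by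
      rw [← div_eq_mul_inv, one_le_div (by positivity)]
      exact h2
    calc _ ≤ C₀ j := by simpa using h₀ j k hk x
      _ ≤ (∑ j ∈ Finset.range (N + 1), (C₀ j + C₁ j)) * 1 := by linarith [hC₁ j]
      _ ≤ (∑ j ∈ Finset.range (N + 1), (C₀ j + C₁ j)) *
          (4 ^ Q * ‖x‖ ^ P * ((1 + ‖latticePoint k‖) ^ Q)⁻¹) := mul_le_mul_of_nonneg_left h3 hS
      _ = _ := by ring
  · have h3 : 1 ≤ 4 ^ Q * ((1 + ‖latticePoint k‖) ^ Q)⁻¹ := by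
      rw [← div_eq_mul_inv, one_le_div (by positivity)]
      gcongr
      linarith
    calc _ ≤ C₁ j * ‖x‖ ^ P := h₁ j k hk x
      _ ≤ (∑ j ∈ Finset.range (N + 1), (C₀ j + C₁ j)) * 1 * ‖x‖ ^ P := by
          gcongr
          linarith [hC₀ j]
      _ ≤ (∑ j ∈ Finset.range (N + 1), (C₀ j + C₁ j)) *
          (4 ^ Q * ((1 + ‖latticePoint k‖) ^ Q)⁻¹) * ‖x‖ ^ P := by gcongr
      _ = _ := by ring

end IsSpaceCutoff

namespace SpaceTime

variable {d : ℕ}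

theorem hasCompactSupport_of_parNorm {f : SpaceTime d → ℝ} (h : ∀ y, 2 < parNorm y → f y = 0) :
    HasCompactSupport f := by
  refine HasCompactSupport.of_support_subset_isCompact (isCompact_closedBall (0 : SpaceTime d) 4)
    fun y hy => ?_
  have h1 : parNorm y ≤ 2 := not_lt.mp fun hc => hy (h y hc)
  rw [parNorm, max_le_iff] at h1
  rw [Metric.mem_closedBall, dist_zero_right, Prod.norm_def, max_le_iff, Real.norm_eq_abs]
  refine ⟨by linarith, ?_⟩
  have := (Real.sqrt_le_left (by norm_num)).mp h1.2
  linarith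

/-- A smooth function on space-time that equals one on a neighbourhood of the parabolic unit ball
and vanishes outside the one of radius two. -/
theorem exists_parabolic_cutoff (d : ℕ) : ∃ θ : SpaceTime d → ℝ, (∀ N : ℕ, ContDiff ℝ N θ) ∧
    (∀ y, parNorm y ≤ 5 / 4 → θ y = 1) ∧ ∀ y, 2 ≤ parNorm y → θ y = 0 := by
  let b₁ : ContDiffBump (0 : EuclideanSpace ℝ (Fin d)) := ⟨3 / 2, 2, by norm_num, by norm_num⟩
  let b₂ : ContDiffBump (0 : ℝ) := ⟨2, 4, by norm_num, by norm_num⟩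
  refine ⟨fun y => b₁ y.1 * b₂ y.2, fun N => (b₁.contDiff.comp contDiff_fst).mul
    (b₂.contDiff.comp contDiff_snd), fun y hy => ?_, fun y hy => ?_⟩
  · rw [parNorm, max_le_iff] at hy
    have h2 := (Real.sqrt_le_left (by norm_num)).mp hy.2
    have e1 : b₁ y.1 = 1 := b₁.one_of_mem_closedBall (by
      rw [Metric.mem_closedBall, dist_zero_right]
      exact hy.1.trans (by norm_num [b₁]))
    have e2 : b₂ y.2 = 1 := b₂.one_of_mem_closedBall (by
      rw [Metric.mem_closedBall, dist_zero_right, Real.norm_eq_abs]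
      exact h2.trans (by norm_num [b₂]))
    simp only [e1, e2, one_mul]
  · rw [parNorm, le_max_iff] at hy
    rcases hy with hy | hy
    · have : b₁ y.1 = 0 := b₁.zero_of_le_dist (by simpa using hy)
      simp only [this, zero_mul]
    · have h3 : (4 : ℝ) ≤ |y.2| := by
        rw [Real.le_sqrt' (by norm_num)] at hy
        linarith
      have : b₂ y.2 = 0 := b₂.zero_of_le_dist (by simpa using h3)
      simp only [this, mul_zero]

/-- A bounded function that vanishes near the origin is bounded by a power of the size of its
argument. -/
theorem _root_.JetBound.mul_parNorm_pow {N : ℕ} {M : ℝ} {m : SpaceTime d → ℝ} (P : ℕ)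
    (hM : ∀ y, JetBound N 1 M m y) (h0 : ∀ y, parNorm y ≤ 5 / 8 → m y = 0) (y : SpaceTime d) :
    JetBound N 1 (2 ^ P * M * parNorm y ^ P) m y := by
  have hM0 := (hM y).nonneg
  have hp := parNorm_nonneg y
  rcases lt_or_ge (parNorm y) (1 / 2) with h | h
  · have hev : m =ᶠ[nhds y] fun _ => 0 := by
      filter_upwards [continuous_parNorm.continuousAt.eventually_lt_const h] with x hx
      exact h0 x (by linarith)
    refine (JetBound.const (x := y) (0 : ℝ) zero_le_one ?_).congr hev
    rw [norm_zero]
    positivity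
  · refine (hM y).mono zero_le_one le_rfl ?_
    have : 1 ≤ (2 * parNorm y) ^ P := one_le_pow₀ (by linarith)
    rw [mul_pow] at this
    calc M = M * 1 := (mul_one M).symm
      _ ≤ M * (2 ^ P * parNorm y ^ P) := mul_le_mul_of_nonneg_left this hM0
      _ = _ := by ring

theorem norm_dilate_le {r : ℝ} (h0 : 0 ≤ r) (h1 : r ≤ 1) : ‖dilate (d := d) r‖ ≤ 1 := by
  refine ContinuousLinearMap.opNorm_le_bound _ zero_le_one fun y => ?_
  rw [one_mul, dilate_apply, Prod.norm_def]
  refine max_le ?_ ?_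
  · rw [norm_smul, Real.norm_of_nonneg h0]
    exact (mul_le_of_le_one_left (norm_nonneg _) h1).trans (norm_fst_le y)
  · rw [norm_mul, norm_pow, Real.norm_of_nonneg h0]
    exact (mul_le_of_le_one_left (norm_nonneg _) (pow_le_one₀ h0 h1)).trans (norm_snd_le y)

/-- The multipliers of the dyadic pieces: a function supported in a dyadic annulus times the cutoffs
on the scale `ε`; the exponential compensates the factor `exp (-a s²)` of the profiles. -/
theorem exists_dyadic_multiplier {φ : EuclideanSpace ℝ (Fin d) → ℝ}
    (hφ : IsSpaceCutoff φ) {g : ℝ → ℝ}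
    (hg : ∀ N : ℕ, ContDiff ℝ N g ∧ ∃ C, 0 ≤ C ∧ ∀ t, JetBound N 1 C g t)
    {χ : SpaceTime d → ℝ} (hχ : ∀ N : ℕ, ContDiff ℝ N χ) (hχ2 : ∀ y, 2 < parNorm y → χ y = 0)
    (hχ1 : ∀ y, parNorm y ≤ 5 / 8 → χ y = 0) (a : ℝ) (N P : ℕ) :
    ∃ M : ℝ, 0 ≤ M ∧ ∀ ε : ℝ, 0 ≤ ε → ε ≤ 1 →
      ContDiff ℝ N (fun y : SpaceTime d =>
        Real.exp (a * y.2) * χ y * (g (ε ^ 2 * y.2) * φ (ε • y.1))) ∧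
      ∀ y, JetBound N 1 (M * parNorm y ^ P) (fun y : SpaceTime d =>
        Real.exp (a * y.2) * χ y * (g (ε ^ 2 * y.2) * φ (ε • y.1))) y := by
  have hφN : ContDiff ℝ N φ := hφ.smooth.of_le (by exact_mod_cast le_top)
  obtain ⟨hgN, Cg, hCg, hgb⟩ := hg N
  obtain ⟨Cφ, hCφ, hφb⟩ := exists_jetBound_of_hasCompactSupport hφN hφ.hasCompactSupport
  have hexp : ContDiff ℝ N fun y : SpaceTime d => Real.exp (a * y.2) :=
    Real.contDiff_exp.comp (contDiff_const.mul contDiff_snd)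
  have h1 : ContDiff ℝ N fun y : SpaceTime d => Real.exp (a * y.2) * χ y := hexp.mul (hχ N)
  obtain ⟨Cχ, hCχ, hχb⟩ := exists_jetBound_of_hasCompactSupport h1
    (hasCompactSupport_of_parNorm fun y hy => by rw [hχ2 y hy, mul_zero])
  have h2 : ContDiff ℝ N fun y : SpaceTime d => g y.2 * φ y.1 :=
    (hgN.comp contDiff_snd).mul (hφN.comp contDiff_fst)
  have h2b : ∀ y : SpaceTime d, JetBound N 1 (2 ^ N * (Cg * Cφ)) (fun y => g y.2 * φ y.1) y :=
    fun y => JetBound.mul zero_le_one (hgN.comp contDiff_snd) (hφN.comp contDiff_fst)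
      (JetBound.comp_snd hgN zero_le_one (hgb y.2)) (JetBound.comp_fst hφN zero_le_one (hφb y.1))
  refine ⟨2 ^ P * (2 ^ N * (Cχ * (2 ^ N * (Cg * Cφ)))), by positivity, fun ε h0 hε => ?_⟩
  have h3 : ContDiff ℝ N fun y : SpaceTime d => g (ε ^ 2 * y.2) * φ (ε • y.1) :=
    h2.comp (dilate ε).contDiff
  have h3b : ∀ y : SpaceTime d, JetBound N 1 (2 ^ N * (Cg * Cφ))
      (fun y => g (ε ^ 2 * y.2) * φ (ε • y.1)) y := fun y =>
    (h2b (dilate ε y)).comp_clm_of_le_one (dilate ε) (norm_dilate_le h0 hε) h2 zero_le_one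
  exact ⟨h1.mul h3, JetBound.mul_parNorm_pow P
    (fun y => JetBound.mul zero_le_one h1 h3 (hχb y) (h3b y)) fun y hy => by
      rw [hχ1 y hy, mul_zero, zero_mul]⟩

/-- The multipliers of the kernels with pole at the translates of the base point. -/
theorem exists_lattice_multiplier {φ : EuclideanSpace ℝ (Fin d) → ℝ}
    (hφ : IsSpaceCutoff φ) {g : ℝ → ℝ}
    (hg : ∀ N : ℕ, ContDiff ℝ N g ∧ ∃ C, 0 ≤ C ∧ ∀ t, JetBound N 1 C g t) (N Q P : ℕ)
    (hQP : Q ≤ P) :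
    ∃ M : ℝ, 0 ≤ M ∧ ∀ k : Fin d → ℤ, k ≠ 0 →
      ContDiff ℝ N (fun y : SpaceTime d => g y.2 * φ (y.1 + latticePoint k)) ∧
      ∀ y, JetBound N 1 (M * ((1 + ‖latticePoint k‖) ^ Q)⁻¹ * parNorm y ^ P)
        (fun y : SpaceTime d => g y.2 * φ (y.1 + latticePoint k)) y := by
  have hφN : ContDiff ℝ N φ := hφ.smooth.of_le (by exact_mod_cast le_top)
  obtain ⟨hgN, Cg, hCg, hgb⟩ := hg N
  obtain ⟨Cφ, hCφ, hφb⟩ := hφ.exists_jetBound_translate N Q P hQP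
  refine ⟨2 ^ N * (Cg * Cφ), by positivity, fun k hk => ?_⟩
  have hφk : ContDiff ℝ N fun x => φ (x + latticePoint k) :=
    hφN.comp (contDiff_id.add contDiff_const)
  have c1 : ContDiff ℝ N fun y : SpaceTime d => g y.2 := hgN.comp contDiff_snd
  have c2 : ContDiff ℝ N fun y : SpaceTime d => φ (y.1 + latticePoint k) := hφk.comp contDiff_fst
  refine ⟨c1.mul c2, fun y => ?_⟩
  have j1 : JetBound N 1 Cg (fun y : SpaceTime d => g y.2) y :=
    JetBound.comp_snd hgN zero_le_one (hgb y.2)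
  have j2 : JetBound N 1 (Cφ * ((1 + ‖latticePoint k‖) ^ Q)⁻¹ * ‖y.1‖ ^ P)
      (fun y : SpaceTime d => φ (y.1 + latticePoint k)) y :=
    JetBound.comp_fst hφk zero_le_one (hφb k hk y.1)
  refine (JetBound.mul zero_le_one c1 c2 j1 j2).mono zero_le_one le_rfl ?_
  have h1 : ‖y.1‖ ≤ parNorm y := le_max_left _ _
  calc _ = 2 ^ N * (Cg * Cφ) * ((1 + ‖latticePoint k‖) ^ Q)⁻¹ * ‖y.1‖ ^ P := by ring
    _ ≤ _ := by gcongr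

end SpaceTime

/-! ### The decomposition of the truncated kernel -/

namespace Coefficients

open SpaceTime

variable {d : ℕ}

theorem heatKernel_eq_zero (A : Coefficients d) {z w : SpaceTime d} (h : z.2 ≤ w.2) :
    A.heatKernel z w = 0 := by
  have h1 : ∀ ν, A.parametrixTerm ν z w = 0 := fun ν => by
    match ν with
    | 0 => exact A.parametrix_eq_zero h
    | ν + 1 =>
      have : A.parametrixTerm (ν + 1) z w = ∫ _ in w.2..z.2, (0 : ℝ) :=
        intervalIntegral.integral_congr fun σ hσ => by
          rw [Set.uIcc_of_ge h] at hσ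
          have h2 : ∀ η, A.parametrix z (η, σ) = 0 := fun η => A.parametrix_eq_zero hσ.1
          simp only [h2, zero_mul, integral_zero]
      rw [this, intervalIntegral.integral_zero]
  unfold heatKernel
  simp only [h1, tsum_zero]

/-- The kernel truncated in time and multiplied by a function of the displacement has the profile
of the fundamental solution. -/
theorem unscale_eq {A : Coefficients d} {κ g : ℝ → ℝ} (hκ : IsTimeCutoff κ)
    (hg : ∀ t, 0 < t → g t = Real.exp t * κ t) {h : SpaceTime d × (SpaceTime d × ℝ) → ℝ} {τ : ℝ}
    (hA : ∀ w (p : SpaceTime d), 0 < p.2 → p.2 ≤ 1 →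
      A.heatKernel (shift w p) w = Real.exp (p.2 ^ 2) / p.2 ^ d * h (p, (w, τ)))
    (ψ : SpaceTime d → ℝ) (z w : SpaceTime d) :
    unscale (fun y => g y.2 * ψ y) h (z - w, (w, τ)) =
      κ (z.2 - w.2) * ψ (z - w) * A.heatKernel z w := by
  unfold unscale
  simp only [Prod.snd_sub, Prod.fst_sub]
  by_cases ht : 0 < z.2 - w.2
  · rw [if_pos ht, hg _ ht]
    rcases le_or_gt (z.2 - w.2) 1 with h1 | h1
    · have hs : 0 < Real.sqrt (z.2 - w.2) := Real.sqrt_pos.mpr ht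
      have hs2 : Real.sqrt (z.2 - w.2) ^ 2 = z.2 - w.2 := Real.sq_sqrt ht.le
      have hz : shift w ((Real.sqrt (z.2 - w.2))⁻¹ • (z.1 - w.1), Real.sqrt (z.2 - w.2)) = z := by
        refine Prod.ext ?_ ?_
        · change w.1 + Real.sqrt (z.2 - w.2) • ((Real.sqrt (z.2 - w.2))⁻¹ • (z.1 - w.1)) = z.1
          rw [smul_smul, mul_inv_cancel₀ hs.ne', one_smul, add_sub_cancel]
        · change w.2 + Real.sqrt (z.2 - w.2) * Real.sqrt (z.2 - w.2) = z.2
          rw [Real.mul_self_sqrt ht.le, add_sub_cancel]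
      have key := hA w ((Real.sqrt (z.2 - w.2))⁻¹ • (z.1 - w.1), Real.sqrt (z.2 - w.2)) hs
        (Real.sqrt_le_one.mpr h1)
      rw [hz] at key
      rw [key]
      simp only [hs2]
      ring
    · rw [hκ.eq_zero _ (Or.inr h1)]
      simp
  · rw [if_neg ht, A.heatKernel_eq_zero (by linarith), mul_zero]

end Coefficients

namespace SpaceTime

variable {d : ℕ}

theorem unscale_eq_zero {m : SpaceTime d → ℝ} {h : SpaceTime d × (SpaceTime d × ℝ) → ℝ}
    {x : SpaceTime d × (SpaceTime d × ℝ)} (hm : 0 < x.1.2 → m x.1 = 0) : unscale m h x = 0 := by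
  unfold unscale
  split_ifs with h0
  · rw [hm h0, zero_mul]
  · rfl

theorem unscale_of_pos {m : SpaceTime d → ℝ} {h : SpaceTime d × (SpaceTime d × ℝ) → ℝ}
    {y : SpaceTime d} {v : SpaceTime d × ℝ} (hy : 0 < y.2) : unscale m h (y, v) =
      m y * ((Real.sqrt y.2 ^ d)⁻¹ * h (((Real.sqrt y.2)⁻¹ • y.1, Real.sqrt y.2), v)) :=
  if_pos hy

/-- The behaviour of the kernels under parabolic dilations: the piece of a kernel cut out by `χ` on
the scale `1 / r` is a kernel of the same form after dilation, with multiplier and profile evaluated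
on the scale `1 / r`. The factor `exp (a t)` of the multiplier is compensated in the profile. -/
theorem unscale_dilate {g : ℝ → ℝ} {φ : EuclideanSpace ℝ (Fin d) → ℝ} (χ : SpaceTime d → ℝ)
    (H : SpaceTime d × (SpaceTime d × ℝ) → ℝ) (a : ℝ) {r : ℝ} (hr : 0 < r) (y : SpaceTime d)
    (v : SpaceTime d × ℝ) :
    r ^ d * unscale
        (fun y => Real.exp (a * y.2) * χ y * (g (r⁻¹ ^ 2 * y.2) * φ (r⁻¹ • y.1)))
        (fun x => Real.exp (-(a * x.1.2 ^ 2)) * H ((x.1.1, r⁻¹ * x.1.2), x.2)) (dilate r y, v) =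
      χ (dilate r y) * unscale (fun y => g y.2 * φ y.1) H (y, v) := by
  by_cases ht : 0 < y.2
  · have h1 : 0 < r ^ 2 * y.2 := by positivity
    have hs : 0 < Real.sqrt y.2 := Real.sqrt_pos.mpr ht
    have h2 : Real.sqrt (r ^ 2 * y.2) = r * Real.sqrt y.2 := by
      rw [Real.sqrt_mul (by positivity), Real.sqrt_sq hr.le]
    have h3 : r⁻¹ ^ 2 * (r ^ 2 * y.2) = y.2 := by field_simp
    have h4 : r⁻¹ • r • y.1 = y.1 := by rw [smul_smul, inv_mul_cancel₀ hr.ne', one_smul]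
    have h5 : (r * Real.sqrt y.2)⁻¹ • r • y.1 = (Real.sqrt y.2)⁻¹ • y.1 := by
      rw [smul_smul]
      congr 1
      field_simp
    have h6 : r⁻¹ * (r * Real.sqrt y.2) = Real.sqrt y.2 := by field_simp
    have h7 : (r * Real.sqrt y.2) ^ 2 = r ^ 2 * y.2 := by rw [mul_pow, Real.sq_sqrt ht.le]
    rw [unscale_of_pos ht, unscale_of_pos (y := dilate r y) h1]
    simp only [dilate_apply]
    rw [h2, h3, h4, h5, h6, h7, mul_pow, Real.exp_neg]
    field_simp
  · have h1 : ¬0 < r ^ 2 * y.2 := by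
      push Not at ht ⊢
      exact mul_nonpos_of_nonneg_of_nonpos (by positivity) ht
    rw [unscale_eq_zero (x := (dilate r y, v)) fun h => absurd h h1,
      unscale_eq_zero (x := (y, v)) fun h => absurd h ht, mul_zero, mul_zero]

/-- The profiles on the scale `ε` are uniformly controlled after multiplication by a Gaussian in the
square root of the time. -/
theorem _root_.Controlled.rescale_time {ι : Type} {N : ℕ} {a : ℝ} (ha : 0 < a)
    {H : ι → SpaceTime d × (SpaceTime d × ℝ) → ℝ}
    (hH : Controlled N (fun x => gaussWeight a x.1) H) :
    Controlled N (fun x => gaussWeight (a / 2) x.1)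
      fun (q : ι × Set.Icc (0 : ℝ) 1) (x : SpaceTime d × (SpaceTime d × ℝ)) =>
        Real.exp (-(a * x.1.2 ^ 2)) * H q.1 ((x.1.1, q.2 * x.1.2), x.2) := by
  have h1 : Controlled N (fun x => Real.exp (-(a * ‖x.1.1‖ ^ 2)))
      fun (q : ι × Set.Icc (0 : ℝ) 1) (x : SpaceTime d × (SpaceTime d × ℝ)) =>
        H q.1 ((x.1.1, q.2 * x.1.2), x.2) := by
    obtain ⟨hsm, C, hC, hb⟩ := hH
    let S : ℝ → SpaceTime d →L[ℝ] SpaceTime d := fun ε =>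
      (ContinuousLinearMap.fst ℝ _ _).prod (ε • ContinuousLinearMap.snd ℝ _ _)
    let T : ℝ → SpaceTime d × (SpaceTime d × ℝ) →L[ℝ] SpaceTime d × (SpaceTime d × ℝ) := fun ε =>
      (S ε).prodMap (ContinuousLinearMap.id ℝ _)
    have hS : ∀ ε ∈ Set.Icc (0 : ℝ) 1, ∀ p, ‖S ε p‖ ≤ ‖p‖ := fun ε hε p => by
      have e : S ε p = (p.1, ε * p.2) := rfl
      rw [e, Prod.norm_def]
      refine max_le (norm_fst_le p) ?_
      rw [norm_mul, Real.norm_of_nonneg hε.1]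
      exact (mul_le_of_le_one_left (norm_nonneg _) hε.2).trans (norm_snd_le p)
    have hT : ∀ ε ∈ Set.Icc (0 : ℝ) 1, ‖T ε‖ ≤ 1 := fun ε hε =>
      ContinuousLinearMap.opNorm_le_bound _ zero_le_one fun x => by
        have e : T ε x = (S ε x.1, x.2) := rfl
        rw [one_mul, e, Prod.norm_def]
        exact max_le ((hS ε hε x.1).trans (norm_fst_le x)) (norm_snd_le x)
    refine ⟨fun q => (hsm q.1).comp (T q.2).contDiff, C, hC, fun q x => ?_⟩
    refine ((hb q.1 (T q.2 x)).comp_clm_of_le_one (T q.2) (hT _ q.2.2) (hsm q.1)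
      zero_le_one).mono zero_le_one le_rfl (mul_le_mul_of_nonneg_left ?_ hC)
    refine Real.exp_le_exp.mpr (neg_le_neg (mul_le_mul_of_nonneg_left ?_ ha.le))
    exact le_add_of_nonneg_right (sq_nonneg _)
  have h2 : Controlled N (fun x => (1 + ‖x.1‖) * (1 + ‖x.1‖))
      fun (_ : ι × Set.Icc (0 : ℝ) 1) (x : SpaceTime d × (SpaceTime d × ℝ)) =>
        a * x.1.2 ^ 2 := by
    have := (Controlled.clm_fst (ι := ι × Set.Icc (0 : ℝ) 1) (N := N)
      (ContinuousLinearMap.snd ℝ (EuclideanSpace ℝ (Fin d)) ℝ))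
    simpa only [sq, ContinuousLinearMap.coe_snd'] using (this.mul this).const_mul a
  have h3 := h2.exp_neg (g := fun x => a * x.1.2 ^ 2)
    (fun x => by nlinarith [norm_nonneg x.1]) fun _ _ => le_rfl
  refine Controlled.absorb_pow (m := 2 * N) ha ((h3.mul h1).mono_le fun x => le_of_eq ?_)
  rw [← sq, ← pow_mul, mul_assoc, ← Real.exp_add, gaussWeight]
  congr 2
  ring

theorem hasSum_telescope {θ : SpaceTime d → ℝ} (hθ : ∀ y, 2 ≤ parNorm y → θ y = 0)
    {y : SpaceTime d} (hy : y ≠ 0) :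
    HasSum (fun n : ℕ => θ (dilate (2 ^ n) y) - θ (dilate 2 (dilate (2 ^ n) y))) (θ y) := by
  have hp : 0 < parNorm y := by
    rcases (parNorm_nonneg y).lt_or_eq with h | h
    · exact h
    · exfalso
      have h1 : ‖y.1‖ ≤ 0 := (le_max_left _ _).trans h.symm.le
      have h2 : Real.sqrt |y.2| ≤ 0 := (le_max_right _ _).trans h.symm.le
      rw [Real.sqrt_le_left le_rfl] at h2
      exact hy (Prod.ext (norm_le_zero_iff.mp h1) (abs_nonpos_iff.mp (by simpa using h2)))
  have hd : ∀ n : ℕ, dilate (d := d) 2 (dilate (2 ^ n) y) = dilate (2 ^ (n + 1)) y := fun n => by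
    refine Prod.ext ?_ ?_
    · simp only [dilate_apply, smul_smul]
      rw [pow_succ']
    · simp only [dilate_apply]
      ring
  obtain ⟨m, hm⟩ := pow_unbounded_of_one_lt (2 / parNorm y) (one_lt_two (α := ℝ))
  have hz : ∀ n, m ≤ n → θ (dilate (2 ^ n) y) = 0 := fun n hn => hθ _ (by
    rw [parNorm_dilate (by positivity)]
    rw [div_lt_iff₀ hp] at hm
    exact hm.le.trans (mul_le_mul_of_nonneg_right (pow_le_pow_right₀ one_le_two hn) hp.le))
  have h1 := hasSum_sum_of_ne_finset_zero (L := SummationFilter.unconditional ℕ)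
    (f := fun n : ℕ => θ (dilate (2 ^ n) y) - θ (dilate 2 (dilate (2 ^ n) y)))
    (s := Finset.range m) fun n hn => by
      rw [Finset.mem_range, not_lt] at hn
      rw [hd, hz n hn, hz (n + 1) (hn.trans (Nat.le_succ n)), sub_zero]
  simp only [hd] at h1 ⊢
  rw [Finset.sum_range_sub' (fun n => θ (dilate (2 ^ n) y)), hz m le_rfl, sub_zero] at h1
  have h2 : dilate (d := d) (2 ^ 0) y = y := by simp
  rwa [h2] at h1

/-- The pieces of the kernel with pole at the base point, in dyadic annuli. -/
theorem exists_dyadic_pieces {ι : Type} {φ : EuclideanSpace ℝ (Fin d) → ℝ}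
    (hφ : IsSpaceCutoff φ) {κ g : ℝ → ℝ} (hκ : IsTimeCutoff κ)
    (hg : ∀ N : ℕ, ContDiff ℝ N g ∧ ∃ C, 0 ≤ C ∧ ∀ t, JetBound N 1 C g t)
    (hgκ : ∀ t, 0 < t → g t = Real.exp t * κ t) {a : ℝ} (ha : 0 < a)
    {H : ι → SpaceTime d × (SpaceTime d × ℝ) → ℝ}
    (N : ℕ) (hH : Controlled N (fun x => gaussWeight a x.1) H) :
    ∃ B : ℝ, 0 ≤ B ∧ ∃ G : ι → ℕ → SpaceTime d × (SpaceTime d × ℝ) → ℝ,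
      (∀ i n, ContDiff ℝ N (G i n) ∧ (∀ x, JetBound N 1 B (G i n) x) ∧
        ∀ x, 2 < parNorm x.1 → G i n x = 0) ∧
      ∀ i (y : SpaceTime d) v, y ≠ 0 →
        HasSum (fun n => (2 ^ n) ^ d * G i n (dilate (2 ^ n) y, v))
          (unscale (fun y => g y.2 * φ y.1) (H i) (y, v)) := by
  obtain ⟨θ, hθ, hθ1, hθ2⟩ := exists_parabolic_cutoff d
  let χ : SpaceTime d → ℝ := fun y => θ y - θ (dilate 2 y)
  have hχ : ∀ N : ℕ, ContDiff ℝ N χ := fun N => (hθ N).sub ((hθ N).comp (dilate 2).contDiff)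
  have hp : ∀ y : SpaceTime d, parNorm (dilate 2 y) = 2 * parNorm y := fun y =>
    parNorm_dilate zero_le_two y
  have hχ2 : ∀ y, 2 < parNorm y → χ y = 0 := fun y hy => by
    simp only [χ]
    rw [hθ2 y hy.le, hθ2 _ (by rw [hp]; linarith), sub_zero]
  have hχ1 : ∀ y, parNorm y ≤ 5 / 8 → χ y = 0 := fun y hy => by
    simp only [χ]
    rw [hθ1 y (by linarith), hθ1 _ (by rw [hp]; linarith), sub_self]
  obtain ⟨M, hM, hmult⟩ := exists_dyadic_multiplier hφ hg hχ hχ2 hχ1 a N (2 * N + d + 4)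
  obtain ⟨hHs, C, hC, hHb⟩ := hH.rescale_time ha
  obtain ⟨K, hK, hun⟩ := exists_unscale_const d N (half_pos ha)
  have hε : ∀ n : ℕ, ((2 : ℝ) ^ n)⁻¹ ∈ Set.Icc (0 : ℝ) 1 := fun n =>
    ⟨by positivity, inv_le_one_of_one_le₀ (one_le_pow₀ one_le_two)⟩
  refine ⟨K * C * M, by positivity, fun i n => unscale
    (fun y => Real.exp (a * y.2) * χ y *
      (g (((2 : ℝ) ^ n)⁻¹ ^ 2 * y.2) * φ (((2 : ℝ) ^ n)⁻¹ • y.1)))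
    (fun x => Real.exp (-(a * x.1.2 ^ 2)) * H i ((x.1.1, ((2 : ℝ) ^ n)⁻¹ * x.1.2), x.2)),
    fun i n => ?_, fun i y v hy => ?_⟩
  · have h1 := hmult _ (hε n).1 (hε n).2
    have h2 := hun (hHs (i, ⟨_, hε n⟩)) h1.1 (hHb (i, ⟨_, hε n⟩)) h1.2
    refine ⟨h2.1, h2.2, fun x hx => unscale_eq_zero fun _ => ?_⟩
    rw [hχ2 _ hx, mul_zero, zero_mul]
  · simp only [unscale_dilate (g := g) (φ := φ) χ (H i) a (pow_pos (zero_lt_two' ℝ) _)]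
    have h1 := (hasSum_telescope hθ2 hy).mul_right
      (unscale (fun y => g y.2 * φ y.1) (H i) (y, v))
    -- On the support of the cutoffs the parabolic cutoff equals one.
    have h2 : θ y * unscale (fun y => g y.2 * φ y.1) (H i) (y, v) =
        unscale (fun y => g y.2 * φ y.1) (H i) (y, v) := by
      by_cases hs : parNorm y ≤ 5 / 4
      · rw [hθ1 y hs, one_mul]
      · have : unscale (fun y => g y.2 * φ y.1) (H i) (y, v) = 0 := unscale_eq_zero fun ht => by
          simp only at ht ⊢
          by_cases h3 : 1 + 1 / 10 ≤ ‖y.1‖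
          · rw [hφ.eq_zero h3, mul_zero]
          · by_cases h4 : 1 < y.2
            · rw [hgκ _ ht, hκ.eq_zero _ (Or.inr h4), mul_zero, zero_mul]
            · refine absurd ?_ hs
              push Not at h3 h4
              refine max_le (by linarith) ?_
              rw [abs_of_pos ht]
              exact (Real.sqrt_le_one.mpr h4).trans (by norm_num)
        rw [this, mul_zero]
    rwa [h2] at h1

/-- The sum of the kernels with pole at the translates of the base point by nonzero lattice points;
it is regular, since the cutoff in space vanishes to infinite order at these poles. -/
theorem exists_lattice_piece {ι : Type} {φ : EuclideanSpace ℝ (Fin d) → ℝ}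
    (hφ : IsSpaceCutoff φ) {κ g : ℝ → ℝ} (hκ : IsTimeCutoff κ)
    (hg : ∀ N : ℕ, ContDiff ℝ N g ∧ ∃ C, 0 ≤ C ∧ ∀ t, JetBound N 1 C g t)
    (hgκ : ∀ t, 0 < t → g t = Real.exp t * κ t) {a : ℝ} (ha : 0 < a)
    {H : ι → SpaceTime d × (SpaceTime d × ℝ) → ℝ}
    (N : ℕ) (hN : d ≤ 2 * N + 4) (hH : Controlled N (fun x => gaussWeight a x.1) H) :
    ∃ B : ℝ, 0 ≤ B ∧ ∃ G : ι → SpaceTime d × (SpaceTime d × ℝ) → ℝ,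
      (∀ i, ContDiff ℝ N (G i) ∧ (∀ x, JetBound N 1 B (G i) x) ∧
        ∀ x, 2 < parNorm x.1 → G i x = 0) ∧
      ∀ i (y w : SpaceTime d) τ,
        HasSum (fun k : Fin d → ℤ => if k = 0 then 0 else
          unscale (fun y => g y.2 * φ (y.1 + latticePoint k)) (H i)
            (y - (latticePoint k, 0), (w + (latticePoint k, 0), τ))) (G i (y, (w, τ))) := by
  obtain ⟨M, hM, hmult⟩ := exists_lattice_multiplier hφ hg N (2 * d) (2 * N + d + 4) (by omega)
  obtain ⟨hHs, C, hC, hHb⟩ := hH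
  obtain ⟨K, hK, hun⟩ := exists_unscale_const d N ha
  let b : (Fin d → ℤ) → SpaceTime d × (SpaceTime d × ℝ) := fun k =>
    ((-latticePoint k, 0), ((latticePoint k, 0), 0))
  let f : ι → (Fin d → ℤ) → SpaceTime d × (SpaceTime d × ℝ) → ℝ := fun i k x =>
    if k = 0 then 0 else unscale (fun y => g y.2 * φ (y.1 + latticePoint k)) (H i) (x + b k)
  let v : (Fin d → ℤ) → ℝ := fun k => K * C * (M * ((1 + ‖latticePoint k‖) ^ (2 * d))⁻¹)
  have hv : Summable v := ((summable_lattice d).mul_left M).mul_left (K * C)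
  have hv0 : ∀ k, 0 ≤ v k := fun k => by positivity
  have hf : ∀ i k, ContDiff ℝ N (f i k) ∧ ∀ x, JetBound N 1 (v k) (f i k) x := fun i k => by
    by_cases hk : k = 0
    · have e : f i k = fun _ => 0 := funext fun x => if_pos hk
      rw [e]
      refine ⟨contDiff_const, fun x => JetBound.const (0 : ℝ) zero_le_one ?_⟩
      rw [norm_zero]
      exact hv0 k
    · have e : f i k = fun x =>
          unscale (fun y => g y.2 * φ (y.1 + latticePoint k)) (H i) (x + b k) :=
        funext fun x => if_neg hk
      have h1 := hmult k hk
      have h2 := hun (hHs i) h1.1 (hHb i) h1.2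
      rw [e]
      refine ⟨h2.1.comp (contDiff_id.add contDiff_const), fun x => ?_⟩
      exact JetBound.comp_affine_of_le_one (x := x)
        (ContinuousLinearMap.id ℝ (SpaceTime d × (SpaceTime d × ℝ))) (b k)
        (ContinuousLinearMap.norm_id_le) h2.1 zero_le_one (h2.2 _)
  have hsummable : ∀ i x, Summable fun k => f i k x := fun i x =>
    Summable.of_norm_bounded hv fun k => ((hf i k).2 x).norm_le
  refine ⟨∑' k, v k, tsum_nonneg hv0, fun i x => ∑' k, f i k x, fun i => ?_, fun i y w τ => ?_⟩
  · have h1 := contDiff_tsum_of_jetBound (fun k => (hf i k).1) hv fun k => (hf i k).2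
    refine ⟨h1.1, fun x => h1.2 x 1 v hv fun k => (hf i k).2 x, fun x hx => ?_⟩
    have h2 : ∀ k, f i k x = 0 := fun k => by
      by_cases hk : k = 0
      · exact if_pos hk
      · refine (if_neg hk).trans (unscale_eq_zero fun ht => ?_)
        have e1 : (x + b k).1.1 + latticePoint k = x.1.1 := neg_add_cancel_right _ _
        have e2 : (x + b k).1.2 = x.1.2 := add_zero _
        rw [e2] at ht
        rw [e1, e2]
        rcases lt_max_iff.mp hx with h3 | h3
        · rw [hφ.eq_zero (by linarith), mul_zero]
        · rw [abs_of_pos ht, Real.lt_sqrt zero_le_two] at h3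
          rw [hgκ _ ht, hκ.eq_zero _ (Or.inr (by linarith)), mul_zero, zero_mul]
    simp only [h2, tsum_zero]
  · have h1 := (hsummable i (y, (w, τ))).hasSum
    refine (congrArg (fun f => HasSum f _) (funext fun k => ?_)).mp h1
    have e : ((y, (w, τ)) : SpaceTime d × (SpaceTime d × ℝ)) + b k =
        (y - (latticePoint k, 0), (w + (latticePoint k, 0), τ)) :=
      Prod.ext (Prod.ext (sub_eq_add_neg _ _).symm ((add_zero _).trans (sub_zero _).symm))
        (Prod.ext rfl (add_zero τ))
    simp only [f, e]

end SpaceTime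

namespace Coefficients.UniformlyRegular

open SpaceTime Coefficients

variable {d : ℕ} {ι : Type} {𝒜 : ι → ℝ → Coefficients d}

/-- The truncated kernels are sums of kernels on the dyadic scales, whose profiles depend smoothly
on the displacement, the base point and the parameter, with uniform bounds. -/
theorem exists_kernel_pieces (h : UniformlyRegular 𝒜) {κ : ℝ → ℝ} (hκ : IsTimeCutoff κ)
    {φ : EuclideanSpace ℝ (Fin d) → ℝ} (hφ : IsSpaceCutoff φ) (N : ℕ) :
    ∃ B : ℝ, 0 ≤ B ∧ ∃ F : ι → ℕ → SpaceTime d × (SpaceTime d × ℝ) → ℝ,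
      (∀ i n, ContDiff ℝ N (F i n) ∧ (∀ x, JetBound N 1 B (F i n) x) ∧
        ∀ x, 2 < parNorm x.1 → F i n x = 0) ∧
      ∀ i τ z w, z ≠ w →
        HasSum (fun n => (2 ^ n) ^ d * F i n (dilate (2 ^ n) (z - w), (w, τ)))
          ((𝒜 i τ).truncatedKernel κ φ z w) := by
  obtain ⟨g, hg, hgκ⟩ := hκ.exists_extension
  obtain ⟨a, ha, H, hH, hΓ⟩ := h.exists_heatKernel_profile
  -- With `N + d` derivatives the bounds of the lattice sum are summable.
  obtain ⟨B₁, hB₁, G, hG, hGsum⟩ := exists_dyadic_pieces hφ hκ hg hgκ ha (N + d) (hH (N + d))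
  obtain ⟨B₂, hB₂, T, hT, hTsum⟩ :=
    exists_lattice_piece hφ hκ hg hgκ ha (N + d) (by omega) (hH (N + d))
  have hle : ((N : ℕ) : WithTop ℕ∞) ≤ ((N + d : ℕ) : WithTop ℕ∞) := by
    exact_mod_cast Nat.le_add_right N d
  -- The kernels with pole at nonzero lattice translates are added to the piece on the scale one.
  refine ⟨B₁ + B₂, by positivity, fun i n x => G i n x + if n = 0 then T i x else 0,
    fun i n => ?_, fun i τ z w hzw => ?_⟩
  · obtain ⟨g1, g2, g3⟩ := hG i n
    obtain ⟨t1, t2, t3⟩ := hT i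
    by_cases hn : n = 0
    · simp only [if_pos hn]
      refine ⟨(g1.add t1).of_le hle, fun x => ?_, fun x hx => by rw [g3 x hx, t3 x hx, add_zero]⟩
      exact ((g2 x).add g1 t1 (t2 x)).of_le (Nat.le_add_right N d)
    · simp only [if_neg hn, add_zero]
      exact ⟨g1.of_le hle, fun x => ((g2 x).mono zero_le_one le_rfl (by linarith)).of_le
        (Nat.le_add_right N d), g3⟩
  · have h1 := hGsum i (z - w) (w, τ) (sub_ne_zero.mpr hzw)
    have h2 : HasSum (fun n : ℕ => ((2 : ℝ) ^ n) ^ d *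
        if n = 0 then T i (dilate (2 ^ n) (z - w), (w, τ)) else 0) (T i (z - w, (w, τ))) := by
      have h3 := hasSum_ite_eq (0 : ℕ) (T i (z - w, (w, τ)))
      refine (congrArg (fun f => HasSum f (T i (z - w, (w, τ)))) (funext fun n => ?_)).mp h3
      by_cases hn : n = 0
      · subst hn
        have h4 : dilate (d := d) (2 ^ 0) (z - w) = z - w := Prod.ext (by simp) (by simp)
        rw [if_pos rfl, if_pos rfl, h4, pow_zero, one_pow, one_mul]
      · simp [hn]
    have h3 := h1.add h2
    simp only [← mul_add] at h3
    refine (congrArg (HasSum _) ?_).mp h3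
    have h4 := (hasSum_ite_eq (0 : Fin d → ℤ)
      (unscale (fun y => g y.2 * φ y.1) (H i) (z - w, (w, τ)))).add (hTsum i (z - w) w τ)
    rw [← h4.tsum_eq]
    refine tsum_congr fun k => ?_
    have key := unscale_eq hκ hgκ (hΓ i τ) (fun y => φ (y.1 + latticePoint k)) z
      (w + (latticePoint k, 0))
    have e1 : z.2 - (w + (latticePoint k, 0)).2 = z.2 - w.2 := by
      rw [Prod.snd_add, add_zero]
    have e2 : (z - (w + (latticePoint k, 0))).1 + latticePoint k = z.1 - w.1 := by
      rw [Prod.fst_sub, Prod.fst_add, ← sub_sub, sub_add_cancel]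
    have e3 : w + (latticePoint k, 0) = (w.1 + latticePoint k, w.2) :=
      Prod.ext rfl (add_zero w.2)
    rw [e1, e2, e3, ← e3, ← sub_sub] at key
    rw [← e3, ← key]
    by_cases hk : k = 0
    · have h5 : ((latticePoint k, 0) : SpaceTime d) = 0 := by
        rw [hk]
        exact Prod.ext (by ext i; simp [latticePoint]) rfl
      have h6 : latticePoint k = 0 := congrArg Prod.fst h5
      rw [if_pos hk, if_pos hk, add_zero, h5, sub_zero, add_zero]
      simp only [h6, add_zero]
    · rw [if_neg hk, if_neg hk, zero_add]

end Coefficients.UniformlyRegular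

/-! ### Families of coefficients -/

theorem Controlled.of_bounds {ι V F : Type*} [NormedAddCommGroup V] [NormedSpace ℝ V]
    [NormedAddCommGroup F] [NormedSpace ℝ F] {f : ι → V → F} (hf : ∀ i, ContDiff ℝ ∞ (f i))
    (hb : ∀ m : ℕ, ∃ C : ℝ, ∀ i x, ‖iteratedFDeriv ℝ m (f i) x‖ ≤ C) (N : ℕ) :
    Controlled N (fun _ => 1) f := by
  choose C hC using hb
  refine ⟨fun i => (hf i).of_le (by exact_mod_cast le_top), ∑ j ∈ Finset.range (N + 1), |C j|,
    by positivity, fun i x j hj => ?_⟩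
  rw [one_pow, mul_one, mul_one]
  exact ((hC j i x).trans (le_abs_self _)).trans (Finset.single_le_sum (f := fun j => |C j|)
    (fun j _ => abs_nonneg _) (Finset.mem_range.mpr (Nat.lt_succ_of_le hj)))

theorem Controlled.comp_fst {ι V U F : Type*} [NormedAddCommGroup V] [NormedSpace ℝ V]
    [NormedAddCommGroup U] [NormedSpace ℝ U] [NormedAddCommGroup F] [NormedSpace ℝ F]
    {f : ι → V → F} {N : ℕ} (hf : Controlled N (fun _ => 1) f) :
    Controlled N (fun _ => 1) fun i (x : V × U) => f i x.1 := by
  obtain ⟨h1, C, hC, h⟩ := hf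
  exact ⟨fun i => (h1 i).comp contDiff_fst, C, hC, fun i x =>
    JetBound.comp_fst (h1 i) zero_le_one (h i x.1)⟩

theorem SmoothBounded.controlled {d : ℕ} {f : SpaceTime d → ℝ} (hf : SmoothBounded f) {ι : Type*}
    (N : ℕ) : Controlled N (fun _ => 1) fun (_ : ι) => f :=
  Controlled.of_bounds (fun _ => hf.1) (fun m => (hf.2 m).imp fun _ h _ => h) N

/-- The families are Lipschitz in the parameter, together with all derivatives in space-time. -/
theorem IsC1Family.exists_jetBound_sub {d : ℕ} {f : ℝ → SpaceTime d → ℝ} (hf : IsC1Family f)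
    (N : ℕ) : ∃ C : ℝ, 0 ≤ C ∧ ∀ l ∈ Set.Icc (0 : ℝ) 1, ∀ m ∈ Set.Icc (0 : ℝ) 1,
      ∀ z, JetBound N 1 (C * |l - m|) (fun z => f l z - f m z) z := by
  let g : Set.Icc (0 : ℝ) 1 → SpaceTime d → ℝ := fun l z =>
    derivWithin (fun r => f r z) (Set.Icc 0 1) l
  obtain ⟨hg, C, hC, hgb⟩ : Controlled N (fun _ => 1) g := Controlled.of_bounds (f := g)
    (fun l => hf.smooth l l.2) (fun m => (hf.bounded m).imp fun _ h l => h l l.2) N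
  have hcont : ∀ z, ContinuousOn (derivWithin (fun r => f r z) (Set.Icc 0 1)) (Set.Icc 0 1) :=
    fun z => (hf.contDiffOn z).continuousOn_derivWithin (uniqueDiffOn_Icc one_pos) le_rfl
  have main : ∀ l ∈ Set.Icc (0 : ℝ) 1, ∀ m ∈ Set.Icc (0 : ℝ) 1, m ≤ l →
      ∀ z, JetBound N 1 (C * |l - m|) (fun z => f l z - f m z) z := fun l hl m hm hml z => by
    have hsub : Set.Icc m l ⊆ Set.Icc 0 1 := Set.Icc_subset_Icc hm.1 hl.2
    have e : (fun z => f l z - f m z) = fun z =>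
        ∫ r in Set.Ioc m l, g (Set.projIcc 0 1 zero_le_one r) z := funext fun z => by
      rw [← intervalIntegral.integral_eq_sub_of_hasDerivAt_of_le hml
        ((hf.contDiffOn z).continuousOn.mono hsub) (fun r hr =>
          (((hf.contDiffOn z).differentiableOn one_ne_zero) r
            (hsub (Set.Ioo_subset_Icc_self hr))).hasDerivWithinAt.hasDerivAt
              (Icc_mem_nhds (hm.1.trans_lt hr.1) (hr.2.trans_le hl.2)))
        (((hcont z).mono (by rwa [Set.uIcc_of_le hml])).intervalIntegrable),
        intervalIntegral.integral_of_le hml]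
      refine setIntegral_congr_fun measurableSet_Ioc fun r hr => ?_
      simp only [g, Set.projIcc_of_mem zero_le_one (hsub (Set.Ioc_subset_Icc_self hr))]
    have h1 := contDiff_integral_of_dominated (μ := volume.restrict (Set.Ioc m l))
      (bound := fun _ => C) (f := fun z r => g (Set.projIcc 0 1 zero_le_one r) z)
      (fun r => hg _) (fun z => ((hcont z).domRestrict.comp
        continuous_projIcc).aestronglyMeasurable) (integrable_const _)
      (fun j hj x r => by simpa using hgb (Set.projIcc 0 1 zero_le_one r) x j hj)
    intro j hj
    rw [e]
    refine (h1.2 j hj z (fun _ => C) (integrable_const _) fun r => by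
      simpa using hgb (Set.projIcc 0 1 zero_le_one r) z j hj).trans (le_of_eq ?_)
    rw [setIntegral_const, smul_eq_mul, measureReal_def, Real.volume_Ioc,
      ENNReal.toReal_ofReal (by linarith), abs_of_nonneg (by linarith)]
    ring
  refine ⟨C, hC, fun l hl m hm z => ?_⟩
  rcases le_total m l with h | h
  · exact main l hl m hm h z
  · have h1 := main m hm l hl h z
    intro j hj
    have e : (fun z => f l z - f m z) = -fun z => f m z - f l z := by
      ext z
      simp
    rw [e, iteratedFDeriv_neg, Pi.neg_apply, norm_neg, abs_sub_comm]
    exact h1 j hj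

theorem IsC1Family.controlled {d : ℕ} {f : ℝ → SpaceTime d → ℝ} (hf : IsC1Family f)
    (hs : ∀ l ∈ Set.Icc (0 : ℝ) 1, SmoothBounded (f l)) (N : ℕ) :
    Controlled N (fun _ => 1) fun l : Set.Icc (0 : ℝ) 1 => f l := by
  obtain ⟨C, hC, h⟩ := hf.exists_jetBound_sub N
  have hsm : ∀ l ∈ Set.Icc (0 : ℝ) 1, ContDiff ℝ N (f l) := fun l hl =>
    (hs l hl).1.of_le (by exact_mod_cast le_top)
  have h0 : (0 : ℝ) ∈ Set.Icc (0 : ℝ) 1 := ⟨le_rfl, zero_le_one⟩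
  have h1 : Controlled N (fun _ => 1) fun (l : Set.Icc (0 : ℝ) 1) z => f l z - f 0 z := by
    refine ⟨fun l => (hsm l l.2).sub (hsm 0 h0), C, hC, fun l z => ?_⟩
    refine (h l l.2 0 h0 z).mono zero_le_one le_rfl (mul_le_mul_of_nonneg_left ?_ hC)
    rw [sub_zero, abs_of_nonneg l.2.1]
    exact l.2.2
  simpa using h1.add ((hs 0 h0).controlled N)

theorem IsC1Family.controlled_quotient {d : ℕ} {f : ℝ → SpaceTime d → ℝ} (hf : IsC1Family f)
    (hs : ∀ l ∈ Set.Icc (0 : ℝ) 1, SmoothBounded (f l)) (N : ℕ) :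
    Controlled N (fun _ => 1) fun (q : Set.Icc (0 : ℝ) 1 × Set.Icc (0 : ℝ) 1) z =>
      |(q.1 - q.2 : ℝ)|⁻¹ * (f q.1 z - f q.2 z) := by
  obtain ⟨C, hC, h⟩ := hf.exists_jetBound_sub N
  have hsm : ∀ l ∈ Set.Icc (0 : ℝ) 1, ContDiff ℝ N (f l) := fun l hl =>
    (hs l hl).1.of_le (by exact_mod_cast le_top)
  have hq := fun q : Set.Icc (0 : ℝ) 1 × Set.Icc (0 : ℝ) 1 => (hsm q.1 q.1.2).sub (hsm q.2 q.2.2)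
  refine ⟨fun q => contDiff_const.mul (hq q), C, hC, fun q z => ?_⟩
  refine ((h q.1 q.1.2 q.2 q.2.2 z).const_mul |(q.1 - q.2 : ℝ)|⁻¹ (hq q)).mono zero_le_one le_rfl ?_
  rw [abs_inv, abs_abs, mul_one, mul_left_comm]
  exact mul_le_of_le_one_right hC (inv_mul_le_one)

theorem abs_sum_mul_mul_le {d : ℕ} {M : Matrix (Fin d) (Fin d) ℝ} {C : ℝ} (hM : ∀ i j, |M i j| ≤ C)
    (ξ : EuclideanSpace ℝ (Fin d)) :
    |∑ i, ∑ j, M i j * ξ i * ξ j| ≤ (d : ℝ) ^ 2 * C * ‖ξ‖ ^ 2 := by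
  have h1 : ∀ i j, |M i j * ξ i * ξ j| ≤ C * ‖ξ‖ ^ 2 := fun i j => by
    have hi := PiLp.norm_apply_le ξ i
    have hj := PiLp.norm_apply_le ξ j
    rw [Real.norm_eq_abs] at hi hj
    rw [abs_mul, abs_mul, mul_assoc, sq]
    exact mul_le_mul (hM i j) (mul_le_mul hi hj (abs_nonneg _) (norm_nonneg _)) (by positivity)
      ((abs_nonneg _).trans (hM i j))
  calc _ ≤ ∑ i, ∑ j, |M i j * ξ i * ξ j| := (Finset.abs_sum_le_sum_abs _ _).trans
        (Finset.sum_le_sum fun i _ => Finset.abs_sum_le_sum_abs _ _)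
    _ ≤ ∑ _ : Fin d, ∑ _ : Fin d, C * ‖ξ‖ ^ 2 :=
        Finset.sum_le_sum fun i _ => Finset.sum_le_sum fun j _ => h1 i j
    _ = _ := by
        simp only [Finset.sum_const, Finset.card_univ, Fintype.card_fin, nsmul_eq_mul]
        ring

namespace Coefficients

variable {d : ℕ}

theorem Regular.uniformlyRegular {A : Coefficients d} (hA : A.Regular) :
    UniformlyRegular fun (_ : Unit) (_ : ℝ) => A where
  symm _ _ := hA.symm
  elliptic := by
    obtain ⟨l₀, l₁, h0, h1, h⟩ := hA.elliptic
    exact ⟨l₀, l₁, h0, h1, fun _ _ => h⟩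
  a_controlled j k N := ((hA.a_smooth j k).controlled N).comp_fst
  b_controlled j N := ((hA.b_smooth j).controlled N).comp_fst
  c_controlled N := (hA.c_smooth.controlled N).comp_fst

section Family

variable {A : ℝ → Coefficients d}

theorem IsC1.exists_abs_sub_le (hA : IsC1 A) : ∃ C : ℝ, 0 ≤ C ∧ ∀ l ∈ Set.Icc (0 : ℝ) 1,
    ∀ m ∈ Set.Icc (0 : ℝ) 1, ∀ z i j, |(A l).a z i j - (A m).a z i j| ≤ C * |l - m| := by
  choose C hC h using fun i j => (hA.a_family i j).exists_jetBound_sub 0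
  refine ⟨∑ i, ∑ j, C i j, Finset.sum_nonneg fun i _ => Finset.sum_nonneg fun j _ => hC i j,
    fun l hl m hm z i j => ((h i j l hl m hm z).norm_le).trans
      (mul_le_mul_of_nonneg_right ?_ (abs_nonneg _))⟩
  exact (Finset.single_le_sum (f := C i) (fun j _ => hC i j) (Finset.mem_univ j)).trans
    (Finset.single_le_sum (f := fun i => ∑ j, C i j)
      (fun i _ => Finset.sum_nonneg fun j _ => hC i j) (Finset.mem_univ i))

/-- By compactness of the interval of parameters, a continuous family of elliptic operators is
uniformly elliptic. -/
theorem IsC1.exists_ellipticity (hA : IsC1 A) (hr : ∀ l ∈ Set.Icc (0 : ℝ) 1, (A l).Regular) :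
    ∃ c : ℝ, 0 < c ∧ ∀ l ∈ Set.Icc (0 : ℝ) 1, ∀ z (ξ : EuclideanSpace ℝ (Fin d)),
      c * ‖ξ‖ ^ 2 ≤ ∑ i, ∑ j, (A l).a z i j * ξ i * ξ j := by
  obtain ⟨C, hC, hCb⟩ := hA.exists_abs_sub_le
  refine isCompact_Icc.induction_on (p := fun s => ∃ c : ℝ, 0 < c ∧
    ∀ l ∈ s, ∀ z (ξ : EuclideanSpace ℝ (Fin d)),
      c * ‖ξ‖ ^ 2 ≤ ∑ i, ∑ j, (A l).a z i j * ξ i * ξ j) ⟨1, one_pos, by simp⟩ ?_ ?_ ?_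
  · rintro s t hst ⟨c, hc, h⟩
    exact ⟨c, hc, fun l hl => h l (hst hl)⟩
  · rintro s t ⟨c, hc, h⟩ ⟨c', hc', h'⟩
    refine ⟨min c c', lt_min hc hc', fun l hl z ξ => ?_⟩
    rcases hl with hl | hl
    · exact (mul_le_mul_of_nonneg_right (min_le_left _ _) (sq_nonneg _)).trans (h l hl z ξ)
    · exact (mul_le_mul_of_nonneg_right (min_le_right _ _) (sq_nonneg _)).trans (h' l hl z ξ)
  · intro l hl
    obtain ⟨c, _, hc, _, h⟩ := (hr l hl).elliptic
    have hD : 0 < (d : ℝ) ^ 2 * C + 1 := by positivity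
    have hδ : 0 < c / (2 * ((d : ℝ) ^ 2 * C + 1)) := by positivity
    refine ⟨Set.Icc 0 1 ∩ Metric.ball l (c / (2 * ((d : ℝ) ^ 2 * C + 1))),
      inter_mem_nhdsWithin _ (Metric.ball_mem_nhds l hδ), c / 2, half_pos hc,
      fun m hm z ξ => ?_⟩
    have h1 := abs_sum_mul_mul_le (M := fun i j => (A m).a z i j - (A l).a z i j)
      (hCb m hm.1 l hl z) ξ
    have h2 := (h z ξ).1
    have h3 : ∑ i, ∑ j, ((A m).a z i j - (A l).a z i j) * ξ i * ξ j =
        ∑ i, ∑ j, (A m).a z i j * ξ i * ξ j - ∑ i, ∑ j, (A l).a z i j * ξ i * ξ j := by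
      simp only [sub_mul, Finset.sum_sub_distrib]
    rw [h3] at h1
    have h4 : (d : ℝ) ^ 2 * (C * |m - l|) ≤ c / 2 := by
      have h5 : |m - l| < c / (2 * ((d : ℝ) ^ 2 * C + 1)) := hm.2
      rw [lt_div_iff₀ (by positivity)] at h5
      nlinarith [abs_nonneg (m - l)]
    have h5 := mul_le_mul_of_nonneg_right h4 (sq_nonneg ‖ξ‖)
    linarith [(abs_le.mp h1).1]

theorem IsC1.uniformlyRegular (hA : IsC1 A) (hr : ∀ l ∈ Set.Icc (0 : ℝ) 1, (A l).Regular) :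
    UniformlyRegular fun (l : Set.Icc (0 : ℝ) 1) (_ : ℝ) => A l := by
  have ha := fun i j N => (hA.a_family i j).controlled (fun l hl => (hr l hl).a_smooth i j) N
  refine ⟨fun l _ => (hr l l.2).symm, ?_, fun j k N => (ha j k N).comp_fst, fun j N =>
    ((hA.b_family j).controlled (fun l hl => (hr l hl).b_smooth j) N).comp_fst, fun N =>
    (hA.c_family.controlled (fun l hl => (hr l hl).c_smooth) N).comp_fst⟩
  obtain ⟨c, hc, h⟩ := hA.exists_ellipticity hr
  choose C hC hb using fun i j => (ha i j 0).2
  have hC1 : ∀ i j, C i j ≤ ∑ i, ∑ j, C i j := fun i j =>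
    (Finset.single_le_sum (f := C i) (fun j _ => hC i j) (Finset.mem_univ j)).trans
      (Finset.single_le_sum (f := fun i => ∑ j, C i j)
        (fun i _ => Finset.sum_nonneg fun j _ => hC i j) (Finset.mem_univ i))
  have hC0 : 0 ≤ ∑ i, ∑ j, C i j :=
    Finset.sum_nonneg fun i _ => Finset.sum_nonneg fun j _ => hC i j
  refine ⟨c, (d : ℝ) ^ 2 * (∑ i, ∑ j, C i j) + 1, hc, by positivity,
    fun l _ z ξ => ⟨h l l.2 z ξ, ?_⟩⟩
  have h1 := abs_sum_mul_mul_le (M := (A l).a z) (C := ∑ i, ∑ j, C i j)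
    (fun i j => ((hb i j l z).norm_le).trans (by rw [mul_one]; exact hC1 i j)) ξ
  linarith [(abs_le.mp h1).2, sq_nonneg ‖ξ‖]

/-- The coefficients of index `m`, moved towards the ones of index `l`, at a speed proportional to
`c` and to the difference quotient. The bounded function `u`, which equals the identity on `[-1, 1]`,
limits the displacement for large parameters `τ`. -/
def segment (A : ℝ → Coefficients d) (u : ℝ → ℝ) (c l m τ : ℝ) : Coefficients d where
  a z := Matrix.of fun i j =>
    (A m).a z i j + c * u τ * (|l - m|⁻¹ * ((A l).a z i j - (A m).a z i j))
  b z i := (A m).b z i + c * u τ * (|l - m|⁻¹ * ((A l).b z i - (A m).b z i))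
  c z := (A m).c z + c * u τ * (|l - m|⁻¹ * ((A l).c z - (A m).c z))

theorem segment_eq_left {u : ℝ → ℝ} (hu : u 0 = 0) (c l m : ℝ) : segment A u c l m 0 = A m := by
  rw [segment, hu]
  simp only [mul_zero, zero_mul, add_zero]
  rfl

theorem segment_eq_right {u : ℝ → ℝ} {c l m τ : ℝ} (hu : c * u τ = |l - m|) :
    segment A u c l m τ = A l := by
  rcases eq_or_ne l m with rfl | hlm
  · rw [segment]
    simp only [sub_self, mul_zero, add_zero]
    rfl
  have h : |l - m| ≠ 0 := abs_ne_zero.mpr (sub_ne_zero.mpr hlm)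
  rw [segment, hu]
  simp only [mul_inv_cancel_left₀ h, add_sub_cancel]
  rfl

/-- If the displacement is small then the segments are uniformly elliptic. -/
theorem IsC1.exists_uniformlyRegular_segment (hA : IsC1 A)
    (hr : ∀ l ∈ Set.Icc (0 : ℝ) 1, (A l).Regular) {u : ℝ → ℝ} (hu : ∀ N : ℕ, ContDiff ℝ N u)
    (hub : ∀ N : ℕ, ∃ C, 1 ≤ C ∧ ∀ s, JetBound N 1 C u s) : ∃ c : ℝ, 0 < c ∧
      UniformlyRegular fun (q : Set.Icc (0 : ℝ) 1 × Set.Icc (0 : ℝ) 1) τ =>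
        segment A u c q.1 q.2 τ := by
  have hreg := hA.uniformlyRegular hr
  obtain ⟨l₀, l₁, h0, h1, hell⟩ := hreg.elliptic
  obtain ⟨C, hC, hCb⟩ := hA.exists_abs_sub_le
  obtain ⟨U, hU, hUb⟩ := hub 0
  have hD : 0 < (d : ℝ) ^ 2 * C * U + 1 := by positivity
  refine ⟨l₀ / (2 * ((d : ℝ) ^ 2 * C * U + 1)), by positivity, ?_⟩
  set c := l₀ / (2 * ((d : ℝ) ^ 2 * C * U + 1)) with hc
  have hc0 : 0 < c := by positivity
  have key : ∀ {f : ℝ → SpaceTime d → ℝ}, IsC1Family f →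
      (∀ l ∈ Set.Icc (0 : ℝ) 1, SmoothBounded (f l)) → ∀ N,
      Controlled N (fun _ => 1) fun (q : Set.Icc (0 : ℝ) 1 × Set.Icc (0 : ℝ) 1)
        (x : SpaceTime d × ℝ) => f q.2 x.1 + c * u x.2 * (|(q.1 - q.2 : ℝ)|⁻¹ *
          (f q.1 x.1 - f q.2 x.1)) := fun {f} hf hs N => by
    have k1 : Controlled N (fun _ => 1) fun (q : Set.Icc (0 : ℝ) 1 × Set.Icc (0 : ℝ) 1)
        (x : SpaceTime d × ℝ) => f q.2 x.1 :=
      ((hf.controlled hs N).reindex Prod.snd).comp_fst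
    have k2 : Controlled N (fun _ => 1) fun (q : Set.Icc (0 : ℝ) 1 × Set.Icc (0 : ℝ) 1)
        (x : SpaceTime d × ℝ) => |(q.1 - q.2 : ℝ)|⁻¹ * (f q.1 x.1 - f q.2 x.1) :=
      (hf.controlled_quotient hs N).comp_fst
    have k3 : Controlled N (fun _ => 1) fun (_ : Set.Icc (0 : ℝ) 1 × Set.Icc (0 : ℝ) 1)
        (x : SpaceTime d × ℝ) => u x.2 := by
      obtain ⟨V, hV, hVb⟩ := hub N
      exact ⟨fun _ => (hu N).comp contDiff_snd, V, zero_le_one.trans hV, fun _ x => by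
        rw [mul_one]
        exact JetBound.comp_snd (hu N) zero_le_one (hVb x.2)⟩
    exact k1.add (((k3.const_mul c).mul k2).mono_le fun _ => by rw [one_mul])
  refine ⟨fun q τ z => ?_, ⟨l₀ / 2, l₁ + l₀ / 2, half_pos h0, by positivity, fun q τ z ξ => ?_⟩,
    fun i j N => key (hA.a_family i j) (fun l hl => (hr l hl).a_smooth i j) N,
    fun i N => key (hA.b_family i) (fun l hl => (hr l hl).b_smooth i) N,
    fun N => key hA.c_family (fun l hl => (hr l hl).c_smooth) N⟩
  · ext i j
    have s1 := (hr q.1 q.1.2).symm z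
    have s2 := (hr q.2 q.2.2).symm z
    simp only [segment, Matrix.transpose_apply, Matrix.of_apply, s1.apply i j, s2.apply i j]
  · have e1 : ∀ i j, |c * u τ * (|(q.1 - q.2 : ℝ)|⁻¹ * ((A q.1).a z i j - (A q.2).a z i j))| ≤
        c * U * C := fun i j => by
      have e2 := hCb q.1 q.1.2 q.2 q.2.2 z i j
      have e3 : |u τ| ≤ U := (hUb τ).norm_le
      rw [abs_mul, abs_mul, abs_mul, abs_of_pos hc0, abs_inv, abs_abs]
      refine mul_le_mul (mul_le_mul_of_nonneg_left e3 hc0.le) ?_ (by positivity) (by positivity)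
      calc _ ≤ |(q.1 - q.2 : ℝ)|⁻¹ * (C * |(q.1 - q.2 : ℝ)|) :=
            mul_le_mul_of_nonneg_left e2 (by positivity)
        _ = C * (|(q.1 - q.2 : ℝ)|⁻¹ * |(q.1 - q.2 : ℝ)|) := by ring
        _ ≤ C := mul_le_of_le_one_right hC inv_mul_le_one
    have e4 := abs_sum_mul_mul_le (M := fun i j => c * u τ * (|(q.1 - q.2 : ℝ)|⁻¹ *
      ((A q.1).a z i j - (A q.2).a z i j))) e1 ξ
    have e5 : (d : ℝ) ^ 2 * (c * U * C) ≤ l₀ / 2 := by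
      have e6 : c * (2 * ((d : ℝ) ^ 2 * C * U + 1)) = l₀ := div_mul_cancel₀ _ (by positivity)
      linarith
    have e7 := mul_le_mul_of_nonneg_right e5 (sq_nonneg ‖ξ‖)
    have e8 := hell q.2 τ z ξ
    have e9 : ∑ i, ∑ j, (segment A u c q.1 q.2 τ).a z i j * ξ i * ξ j =
        ∑ i, ∑ j, (A q.2).a z i j * ξ i * ξ j + ∑ i, ∑ j, c * u τ * (|(q.1 - q.2 : ℝ)|⁻¹ *
          ((A q.1).a z i j - (A q.2).a z i j)) * ξ i * ξ j := by
      simp only [segment, Matrix.of_apply, add_mul, Finset.sum_add_distrib]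
    rw [e9]
    constructor <;> linarith [(abs_le.mp e4).1, (abs_le.mp e4).2]

end Family

end Coefficients

/-! ### The norm of the truncated kernels -/

theorem JetBound.translate_sub {V F : Type*} [NormedAddCommGroup V] [NormedSpace ℝ V]
    [NormedAddCommGroup F] [NormedSpace ℝ F] {N : ℕ} {B : ℝ} {f : V → F}
    (hf : ContDiff ℝ (N + 1 : ℕ) f) (hB : ∀ x, JetBound (N + 1) 1 B f x) (v x : V) :
    JetBound N 1 (B * ‖v‖) (fun x => f (x + v) - f x) x := fun j hj => by
  have hfj : ContDiff ℝ j f := hf.of_le (by exact_mod_cast hj.trans (Nat.le_succ N))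
  have hd : Differentiable ℝ (iteratedFDeriv ℝ j f) :=
    hf.differentiable_iteratedFDeriv (by exact_mod_cast Nat.lt_succ_of_le hj)
  have h1 := Convex.norm_image_sub_le_of_norm_fderiv_le (𝕜 := ℝ) (f := iteratedFDeriv ℝ j f)
    (C := B) (s := Set.univ) (x := x) (y := x + v) (fun y _ => hd y) (fun y _ => by
      rw [norm_fderiv_iteratedFDeriv]
      simpa using hB y (j + 1) (Nat.succ_le_succ hj)) convex_univ (Set.mem_univ _) (Set.mem_univ _)
  have h2 : (fun x => f (x + v) - f x) = (fun x => f (x + v)) - f := rfl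
  have h3 : ContDiff ℝ j fun x => f (x + v) := hfj.comp (contDiff_id.add contDiff_const)
  rw [h2, iteratedFDeriv_sub_apply h3.contDiffAt hfj.contDiffAt,
    iteratedFDeriv_comp_add_right, one_pow, mul_one]
  rwa [add_sub_cancel_left] at h1

namespace SpaceTime

variable {d : ℕ}

/-- Restriction to a fixed value of the parameter. -/
theorem contDiff_and_jetBound_slice {N : ℕ} {B : ℝ} {F : SpaceTime d × (SpaceTime d × ℝ) → ℝ}
    (hF : ContDiff ℝ N F) (hB : ∀ x, JetBound N 1 B F x) (τ : ℝ) :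
    ContDiff ℝ N (fun x : SpaceTime d × SpaceTime d => F (x.1, (x.2, τ))) ∧
      ∀ x, JetBound N 1 B (fun x : SpaceTime d × SpaceTime d => F (x.1, (x.2, τ))) x := by
  let L : SpaceTime d × SpaceTime d →L[ℝ] SpaceTime d × (SpaceTime d × ℝ) :=
    (ContinuousLinearMap.fst ℝ _ _).prod ((ContinuousLinearMap.snd ℝ _ _).prod 0)
  have hL : ‖L‖ ≤ 1 := ContinuousLinearMap.opNorm_le_bound _ zero_le_one fun x => by
    have e : L x = (x.1, (x.2, 0)) := rfl
    rw [one_mul, e, Prod.norm_def]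
    refine max_le (norm_fst_le x) ?_
    rw [Prod.norm_def, norm_zero, max_eq_left (norm_nonneg _)]
    exact norm_snd_le x
  have e : (fun x : SpaceTime d × SpaceTime d => F (x.1, (x.2, τ))) =
      fun x => F (L x + (0, (0, τ))) := funext fun x => by
    have e1 : L x + (0, (0, τ)) = (x.1, (x.2, τ)) :=
      Prod.ext (add_zero _) (Prod.ext (add_zero _) (zero_add _))
    rw [e1]
  rw [e]
  exact ⟨hF.comp (L.contDiff.add contDiff_const), fun x =>
    JetBound.comp_affine_of_le_one (x := x) L _ hL hF zero_le_one (hB _)⟩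

theorem contDiff_and_jetBound_slice_sub {N : ℕ} {B : ℝ}
    {F : SpaceTime d × (SpaceTime d × ℝ) → ℝ} (hF : ContDiff ℝ (N + 1 : ℕ) F)
    (hB : ∀ x, JetBound (N + 1) 1 B F x) (τ : ℝ) :
    ContDiff ℝ N (fun x : SpaceTime d × SpaceTime d => F (x.1, (x.2, τ)) - F (x.1, (x.2, 0))) ∧
      ∀ x, JetBound N 1 (B * |τ|)
        (fun x : SpaceTime d × SpaceTime d => F (x.1, (x.2, τ)) - F (x.1, (x.2, 0))) x := by
  let v : SpaceTime d × (SpaceTime d × ℝ) := (0, (0, τ))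
  have hv : ‖v‖ = |τ| := by simp [v, Prod.norm_def]
  have h1 : ContDiff ℝ N F := hF.of_le (by exact_mod_cast Nat.le_succ N)
  have h2 : ContDiff ℝ N fun x => F (x + v) := h1.comp (contDiff_id.add contDiff_const)
  have h3 : ∀ x, JetBound N 1 (B * |τ|) (fun x => F (x + v) - F x) x := fun x => by
    have := JetBound.translate_sub hF hB v x
    rwa [hv] at this
  have h4 := contDiff_and_jetBound_slice (F := fun x => F (x + v) - F x) (h2.sub h1) h3 0
  have e : ∀ y w : SpaceTime d, ((y, (w, 0)) : SpaceTime d × (SpaceTime d × ℝ)) + v =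
      (y, (w, τ)) := fun y w =>
    Prod.ext (add_zero _) (Prod.ext (add_zero _) (zero_add _))
  simp only [e] at h4
  exact h4

theorem norm_le_of_profiles {β L R : ℝ} {N : ℕ} {C : ℝ≥0}
    (hC : ∀ (B : ℝ≥0) (Kn : ℕ → SpaceTime d → SpaceTime d → ℝ),
      (∀ n, IsScaleKernel N (2 ^ n) B fun p => Kn n p.1 p.2) →
      ∀ β ≤ 2, SingularKernel.Bounds β L R (C * B) Kn) (hβ : β ≤ 2) {B : ℝ≥0}
    {K : SpaceTime d → SpaceTime d → ℝ} {F : ℕ → SpaceTime d × SpaceTime d → ℝ}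
    (hF : ∀ n, ContDiff ℝ N (F n)) (hB : ∀ n x, JetBound N 1 B (F n) x)
    (h0 : ∀ n x, 2 < parNorm x.1 → F n x = 0)
    (hsum : ∀ z w, z ≠ w →
      HasSum (fun n => (2 ^ n) ^ d * F n (dilate (2 ^ n) (z - w), w)) (K z w)) :
    SingularKernel.norm β L R K ≤ C * B :=
  norm_le_of_scaleKernels hC hβ
    (Kn := fun n z w => (2 ^ n) ^ d * F n (dilate (2 ^ n) (z - w), w))
    (fun n => ⟨F n, hF n, hB n, fun y w hy => h0 n (y, w) hy, rfl⟩) hsum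

end SpaceTime

namespace Coefficients

open SpaceTime

variable {d : ℕ} {κ : ℝ → ℝ} {φ : EuclideanSpace ℝ (Fin d) → ℝ}

theorem nonAnticipative_truncatedKernel (A : Coefficients d) (hκ : IsTimeCutoff κ) :
    SingularKernel.NonAnticipative (A.truncatedKernel κ φ) := fun z w h => by
  unfold truncatedKernel
  rw [hκ.eq_zero _ (Or.inl (sub_neg.mpr h))]
  simp only [zero_mul, tsum_zero]

theorem Regular.norm_truncatedKernel_lt_top {A : Coefficients d} (hA : A.Regular)
    (hκ : IsTimeCutoff κ) (hφ : IsSpaceCutoff φ) {β L R : ℝ} (hβ : β ≤ 2) (hL : 0 ≤ L)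
    (hR : 0 ≤ R) : SingularKernel.norm β L R (A.truncatedKernel κ φ) < ⊤ := by
  obtain ⟨N, C, hC⟩ := exists_bounds_const d L R hL hR
  obtain ⟨B, hB, F, hF, hsum⟩ := hA.uniformlyRegular.exists_kernel_pieces hκ hφ N
  have h := fun n => contDiff_and_jetBound_slice (hF () n).1 (hF () n).2.1 0
  refine (norm_le_of_profiles hC hβ (B := ⟨B, hB⟩)
    (F := fun n x => F () n (x.1, (x.2, 0))) (fun n => (h n).1) (fun n => (h n).2)
    (fun n x hx => (hF () n).2.2 _ hx) fun z w hzw => hsum () 0 z w hzw).trans_lt ?_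
  exact ENNReal.mul_lt_top ENNReal.coe_lt_top ENNReal.coe_lt_top

/-- Close parameters are joined by a segment of operators, along which the profiles have bounded
derivatives; for the others the bound of each kernel suffices. -/
theorem IsC1.exists_norm_sub_le {A : ℝ → Coefficients d} (hA : IsC1 A)
    (hr : ∀ l ∈ Set.Icc (0 : ℝ) 1, (A l).Regular) (hκ : IsTimeCutoff κ) (hφ : IsSpaceCutoff φ)
    {L R : ℝ} (hL : 0 ≤ L) (hR : 0 ≤ R) :
    ∃ C : ℝ≥0, ∀ β ≤ 2, ∀ l ∈ Set.Icc (0 : ℝ) 1, ∀ m ∈ Set.Icc (0 : ℝ) 1,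
      SingularKernel.norm β L R
          (fun z w => (A l).truncatedKernel κ φ z w - (A m).truncatedKernel κ φ z w) ≤
        (C : ℝ≥0∞) * ENNReal.ofReal |l - m| := by
  obtain ⟨N, C, hC⟩ := exists_bounds_const d L R hL hR
  obtain ⟨u, hu, hub, hu1⟩ := exists_truncated_id
  obtain ⟨B₀, hB₀, F, hF, hFsum⟩ := (hA.uniformlyRegular hr).exists_kernel_pieces hκ hφ N
  obtain ⟨c, hc, hseg⟩ := hA.exists_uniformlyRegular_segment hr hu hub
  obtain ⟨B₁, hB₁, G, hG, hGsum⟩ := hseg.exists_kernel_pieces hκ hφ (N + 1)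
  let D : ℝ≥0 := ⟨(B₁ + 2 * B₀) / c, by positivity⟩
  refine ⟨C * D, fun β hβ l hl m hm => ?_⟩
  -- It suffices to find profiles bounded by a multiple of the distance of the parameters.
  suffices h : ∃ E : ℕ → SpaceTime d × SpaceTime d → ℝ, (∀ n, ContDiff ℝ N (E n)) ∧
      (∀ n x, JetBound N 1 ((B₁ + 2 * B₀) / c * |l - m|) (E n) x) ∧
      (∀ n x, 2 < parNorm x.1 → E n x = 0) ∧ ∀ z w, z ≠ w →
        HasSum (fun n => (2 ^ n) ^ d * E n (dilate (2 ^ n) (z - w), w))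
          ((A l).truncatedKernel κ φ z w - (A m).truncatedKernel κ φ z w) by
    obtain ⟨E, h1, h2, h3, h4⟩ := h
    refine (norm_le_of_profiles hC hβ (B := D * Real.toNNReal |l - m|) h1 (fun n x => ?_) h3
      h4).trans (le_of_eq ?_)
    · rw [NNReal.coe_mul, Real.coe_toNNReal _ (abs_nonneg _)]
      exact h2 n x
    · rw [ENNReal.coe_mul, ENNReal.coe_mul, mul_assoc]
      rfl
  rcases le_or_gt |l - m| c with h | h
  · set τ := |l - m| / c with hτ
    have hτ1 : |τ| ≤ 1 := by
      rw [hτ, abs_div, abs_abs, abs_of_pos hc]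
      exact div_le_one_of_le₀ h hc.le
    have hl1 : segment A u c l m τ = A l := segment_eq_right (by
      rw [hu1 τ hτ1, hτ, mul_div_cancel₀ _ hc.ne'])
    have hm1 : segment A u c l m 0 = A m := segment_eq_left (hu1 0 (by simp)) c l m
    let q : Set.Icc (0 : ℝ) 1 × Set.Icc (0 : ℝ) 1 := (⟨l, hl⟩, ⟨m, hm⟩)
    have hsum : ∀ z w, z ≠ w → HasSum (fun n : ℕ => (2 ^ n : ℝ) ^ d *
        (G q n (dilate (2 ^ n) (z - w), (w, τ)) - G q n (dilate (2 ^ n) (z - w), (w, 0))))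
        ((A l).truncatedKernel κ φ z w - (A m).truncatedKernel κ φ z w) := fun z w hzw => by
      have s1 := (hGsum q τ z w hzw).sub (hGsum q 0 z w hzw)
      simp only [q, hl1, hm1, ← mul_sub] at s1
      exact s1
    have hslice := fun n => contDiff_and_jetBound_slice_sub (hG q n).1 (hG q n).2.1 τ
    refine ⟨fun n x => G q n (x.1, (x.2, τ)) - G q n (x.1, (x.2, 0)),
      fun n => (hslice n).1, fun n x => ((hslice n).2 x).mono zero_le_one le_rfl ?_,
      fun n x hx => ?_, hsum⟩
    · rw [hτ, abs_div, abs_abs, abs_of_pos hc, mul_div_assoc', div_mul_eq_mul_div]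
      gcongr
      linarith
    · simp only [(hG q n).2.2 (x.1, (x.2, τ)) hx, (hG q n).2.2 (x.1, (x.2, 0)) hx, sub_zero]
  · have hslice := fun (r : Set.Icc (0 : ℝ) 1) n =>
      contDiff_and_jetBound_slice (hF r n).1 (hF r n).2.1 0
    refine ⟨fun n x => F ⟨l, hl⟩ n (x.1, (x.2, 0)) - F ⟨m, hm⟩ n (x.1, (x.2, 0)),
      fun n => (hslice _ n).1.sub (hslice _ n).1, fun n x => ?_, fun n x hx => ?_,
      fun z w hzw => ?_⟩
    · have h1 := ((hslice ⟨m, hm⟩ n).2 x).const_mul (-1) (hslice ⟨m, hm⟩ n).1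
      have h2 := ((hslice ⟨l, hl⟩ n).2 x).add (hslice ⟨l, hl⟩ n).1
        (contDiff_const.mul (hslice ⟨m, hm⟩ n).1) h1
      simp only [neg_one_mul, ← sub_eq_add_neg] at h2
      refine h2.mono zero_le_one le_rfl ?_
      rw [abs_neg, abs_one, one_mul, div_mul_eq_mul_div, le_div_iff₀ hc]
      nlinarith
    · simp only [(hF _ n).2.2 (x.1, (x.2, 0)) hx, sub_zero]
    · have s1 := (hFsum ⟨l, hl⟩ 0 z w hzw).sub (hFsum ⟨m, hm⟩ 0 z w hzw)
      simp only [← mul_sub] at s1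
      exact s1

end Coefficients

end

theorem mainTheorem6 {d : ℕ} (κ : ℝ → ℝ) (hκ : IsTimeCutoff κ)
    (φ : EuclideanSpace ℝ (Fin d) → ℝ) (hφ : IsSpaceCutoff φ) :
    (∀ A : Coefficients d, A.Regular → A.Periodic →
      SingularKernel.NonAnticipative (A.truncatedKernel κ φ) ∧
      ∀ β L R : ℝ, β ≤ 2 → 0 ≤ L → 0 ≤ R →
        SingularKernel.norm β L R (A.truncatedKernel κ φ) < ⊤) ∧
    (∀ A : ℝ → Coefficients d,
      (∀ l ∈ Set.Icc (0 : ℝ) 1, (A l).Regular ∧ (A l).Periodic) → Coefficients.IsC1 A →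
      ∀ β L R : ℝ, β ≤ 2 → 0 ≤ L → 0 ≤ R →
        ∃ C : ℝ≥0, ∀ l ∈ Set.Icc (0 : ℝ) 1, ∀ m ∈ Set.Icc (0 : ℝ) 1,
          SingularKernel.norm β L R
              (fun z w => (A l).truncatedKernel κ φ z w - (A m).truncatedKernel κ φ z w) ≤
            (C : ℝ≥0∞) * ENNReal.ofReal |l - m|) := by
  refine ⟨fun A hA _ => ⟨A.nonAnticipative_truncatedKernel hκ, fun β L R hβ hL hR =>
    hA.norm_truncatedKernel_lt_top hκ hφ hβ hL hR⟩, fun A hr hA β L R hβ hL hR => ?_⟩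
  obtain ⟨C, hC⟩ := hA.exists_norm_sub_le (fun l hl => (hr l hl).1) hκ hφ hL hR
  exact ⟨C, hC β hβ⟩
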